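/- Let $d\in\{1,2,3\}$, let $\Omega\subset\mathbb R^d$ be a bounded open set with $\Omega=\operatorname{int}\overline\Omega$ (for example a bounded Lipschitz domain), and let $\sigma>0$. Write $\langle\cdot,\cdot\rangle$ and $\|\cdot\|$ for the inner product and norm of $L^2(\Omega)$. **Discrete spaces.** Let $\mathcal K_h$ be a conforming decomposition of $\overline\Omega$ into finitely many closed $d$-simplices which is shape regular with constant $\sigma$: each $K\in\mathcal K_h$ contains a ball of some radius $r>0$ with $\operatorname{diam}K\le\sigma r$. Let $$W_h=\{w\in L^2(\Omega): w|_K \text{ constant for all } K\},\qquad \mathbf V_h=\{\mathbf v\in H(\mathrm{div};\Omega): \mathbf v|_K(x)=\mathbf a_K+\beta_K x \text{ for all } K\},$$ and let $\mathbf Z_h$ be either $\{\mathbf z\in H^1(\Omega)^d: \mathbf z|_K \text{ affine for all }K\}$ or its intersection with $H^1_0(\Omega)^d$ (homogeneous Dirichlet condition). **Data.** Let $\mu,\nu_f,\rho_f,\tau>0$, $\alpha\in\mathbb R$, $\mathbf g\in\mathbb R^d$, $\mathbf f\in L^2(\Omega)^d$, $S_f\in L^2(\Omega)$, and assume - (A1)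 $b\in C^1(\mathbb R)$ and $0<b_m\le b'\le L_b<\infty$; - (A2) $h\in C^1(\mathbb R)$ and $0<h_m\le h'\le L_h<\infty$; - (A3) $K$ is measurable and $0<k_m\le K(x)\le k_M<\infty$ for all $x\in\Omega$. Let $\varepsilon(\mathbf u)=\frac12(\nabla\mathbf u+(\nabla\mathbf u)^t)$. Let $p^{n-1}\in W_h$ and $\mathbf u^{n-1}\in\mathbf Z_h$ be given, and let $(p^n,\mathbf q^n,\mathbf u^n)\in W_h\times\mathbf V_h\times\mathbf Z_h$ be a solution of the fully discrete non-linear Biot problem $$2\mu\langle\varepsilon(\mathbf u^n):\varepsilon(\mathbf z)\rangle+\langle h(\nabla\cdot\mathbf u^n),\nabla\cdot\mathbf z\rangle-\alpha\langle p^n,\nabla\cdot\mathbf z\rangle=\langle\mathbf f,\mathbf z\rangle,$$ $$\nu_f\langle K^{-1}\mathbf q^n,\mathbf v\rangle-\langle p^n,\nabla\cdot\mathbf v\rangle=\langle\rho_f\mathbf g,\mathbf v\rangle,$$ $$\langle b(p^n),w\rangle+\alpha\langle\nabla\cdot\mathbf u^n,w\rangle+\tau\langle\nabla\cdot\mathbf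 q^n,w\rangle=\tau\langle S_f,w\rangle+\langle b(p^{n-1}),w\rangle+\alpha\langle\nabla\cdot\mathbf u^{n-1},w\rangle$$ for all $\mathbf z\in\mathbf Z_h$, $\mathbf v\in\mathbf V_h$, $w\in W_h$. **Splitting L-scheme.** Let $L_1\ge L_b$ and $L_2\ge L_h+\alpha^2/b_m$. Let $(p^{n,i},\mathbf q^{n,i},\mathbf u^{n,i})_{i\ge0}$ be a sequence in $W_h\times\mathbf V_h\times\mathbf Z_h$, with arbitrary starting value (for example the solution at the previous time level), such that for all $i\ge0$ and all $\mathbf v\in\mathbf V_h$, $w\in W_h$, $\mathbf z\in\mathbf Z_h$ $$\nu_f\langle K^{-1}\mathbf q^{n,i+1},\mathbf v\rangle-\langle p^{n,i+1},\nabla\cdot\mathbf v\rangle=\langle\rho_f\mathbf g,\mathbf v\rangle,$$ $$\langle b(p^{n,i}),w\rangle+L_1\langle p^{n,i+1}-p^{n,i},w\rangle+\alpha\langle\nabla\cdot\mathbf u^{n,i},w\rangle+\tau\langle\nabla\cdot\mathbf q^{n,i+1},w\rangle=\tau\langle S_f,w\rangle+\langle b(p^{n-1}),w\rangle+\alpha\langle\nabla\cdot\mathbf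 u^{n-1},w\rangle,$$ $$2\mu\langle\varepsilon(\mathbf u^{n,i+1}):\varepsilon(\mathbf z)\rangle+L_2\langle\nabla\cdot\mathbf u^{n,i+1}-\nabla\cdot\mathbf u^{n,i},\nabla\cdot\mathbf z\rangle+\langle h(\nabla\cdot\mathbf u^{n,i}),\nabla\cdot\mathbf z\rangle-\alpha\langle p^{n,i+1},\nabla\cdot\mathbf z\rangle=\langle\mathbf f,\mathbf z\rangle.$$ Write $e_p^i=p^{n,i}-p^n$, $\mathbf e_{\mathbf q}^i=\mathbf q^{n,i}-\mathbf q^n$, $\mathbf e_{\mathbf u}^i=\mathbf u^{n,i}-\mathbf u^n$. **Theorem.** There is a constant $C>0$ depending only on $\Omega$, $d$ and $\sigma$ such that, for every mesh as above, each $w\in W_h$ is $w=\nabla\cdot\mathbf v$ for some $\mathbf v\in\mathbf V_h$ with $\|\mathbf v\|\le C\|w\|$, and for all data, discrete solutions and iterates as above the following holds. 1. For all $i\ge0$, $$\Big(L_1-\frac{b_m}2+\frac{\tau k_m^2}{\nu_f C^2k_M}\Big)\|e_p^{i+1}\|^2+\frac{\tau\nu_f}{k_M}\|\mathbf e_{\mathbf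 q}^{i+1}\|^2+L_2\|\nabla\cdot\mathbf e_{\mathbf u}^{i+1}\|^2\le(L_1-b_m)\|e_p^i\|^2+(L_2-h_m)\|\nabla\cdot\mathbf e_{\mathbf u}^i\|^2.$$ 2. The scheme converges linearly: let $E_i=\big(L_1-\frac{b_m}2+\frac{\tau k_m^2}{\nu_f C^2k_M}\big)\|e_p^{i}\|^2+\frac{\tau\nu_f}{k_M}\|\mathbf e_{\mathbf q}^{i}\|^2+L_2\|\nabla\cdot\mathbf e_{\mathbf u}^{i}\|^2$. There are $\rho\in(0,1)$ and $A\in\mathbb R$ such that $E_{i+1}\le\rho E_i$ and $\|e_p^i\|+\|\mathbf e_{\mathbf q}^i\|+\|\nabla\cdot\mathbf e_{\mathbf u}^i\|\le A\rho^i$ for all $i\ge 0$; under the homogeneous Dirichlet condition also $\|\mathbf e_{\mathbf u}^i\|_{H^1(\Omega)}\le A\rho^i$ for all $i\ge 0$. -/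

import Mathlib

open MeasureTheory Filter Topology
open scoped ContDiff

noncomputable section

namespace Biot

/-- The space `ℝ^d` with its Euclidean norm. -/
abbrev Vec (d : ℕ) : Type := EuclideanSpace ℝ (Fin d)

/-! ### `L²(Ω)`, weak derivatives, `H¹(Ω)`, `H¹₀(Ω)` and `H(div; Ω)` -/

section Sobolev

variable {d : ℕ}

/-- The inner product of `L²(Ω; F)`, with `F = ℝ` or `F = ℝ^d`. -/
def l2inner {F : Type*} [NormedAddCommGroup F] [InnerProductSpace ℝ F]
    (Ω : Set (Vec d)) (f g : Vec d → F) : ℝ :=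
  ∫ x in Ω, inner ℝ (f x) (g x)

/-- The norm of `L²(Ω; F)`. -/
def l2norm {F : Type*} [NormedAddCommGroup F] [InnerProductSpace ℝ F]
    (Ω : Set (Vec d)) (f : Vec d → F) : ℝ :=
  √(l2inner Ω f f)

/-- `f ∈ L²(Ω; F)`. -/
def MemL2 {F : Type*} [NormedAddCommGroup F] (Ω : Set (Vec d)) (f : Vec d → F) : Prop :=
  MemLp f 2 (volume.restrict Ω)

/-- `φ ∈ C_c^∞(Ω; F)`. -/
def IsTestFunction {F : Type*} [NormedAddCommGroup F] [NormedSpace ℝ F]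
    (Ω : Set (Vec d)) (φ : Vec d → F) : Prop :=
  ContDiff ℝ ∞ φ ∧ HasCompactSupport φ ∧ tsupport φ ⊆ Ω

/-- The classical partial derivative `∂ᵢ φ`. -/
def partialDeriv (i : Fin d) (φ : Vec d → ℝ) (x : Vec d) : ℝ :=
  fderiv ℝ φ x (EuclideanSpace.single i 1)

/-- `g ∈ L²(Ω)` is the weak partial derivative `∂ᵢ f` on `Ω`. -/
def HasWeakPartial (Ω : Set (Vec d)) (i : Fin d) (f g : Vec d → ℝ) : Prop :=
  MemL2 Ω g ∧ ∀ φ : Vec d → ℝ, IsTestFunction Ω φ →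
    ∫ x in Ω, f x * partialDeriv i φ x = -∫ x in Ω, g x * φ x

/-- `g ∈ L²(Ω)` is the weak divergence of `v` on `Ω`. -/
def HasWeakDiv (Ω : Set (Vec d)) (v : Vec d → Vec d) (g : Vec d → ℝ) : Prop :=
  MemL2 Ω g ∧ ∀ φ : Vec d → ℝ, IsTestFunction Ω φ →
    ∫ x in Ω, ∑ i, v x i * partialDeriv i φ x = -∫ x in Ω, g x * φ x

open Classical in
/-- The weak partial derivative `∂ᵢ f` on `Ω` (unique up to null sets if it exists; `0` if
there is none in `L²(Ω)`). -/
def weakPartial (Ω : Set (Vec d)) (i : Fin d) (f : Vec d → ℝ) : Vec d → ℝ :=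
  if hf : ∃ g, HasWeakPartial Ω i f g then hf.choose else 0

open Classical in
/-- The weak divergence of `v` on `Ω` (unique up to null sets if it exists; `0` if there is
none in `L²(Ω)`). -/
def weakDiv (Ω : Set (Vec d)) (v : Vec d → Vec d) : Vec d → ℝ :=
  if hv : ∃ g, HasWeakDiv Ω v g then hv.choose else 0

/-- `v ∈ H(div; Ω)`. -/
def MemHdiv (Ω : Set (Vec d)) (v : Vec d → Vec d) : Prop :=
  MemL2 Ω v ∧ ∃ g, HasWeakDiv Ω v g

/-- `z ∈ H¹(Ω)^d`. -/
def MemH1 (Ω : Set (Vec d)) (z : Vec d → Vec d) : Prop :=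
  MemL2 Ω z ∧ ∀ i j, ∃ g, HasWeakPartial Ω i (fun x => z x j) g

/-- The norm of `H¹(Ω)^d`. -/
def h1norm (Ω : Set (Vec d)) (z : Vec d → Vec d) : ℝ :=
  √(l2norm Ω z ^ 2 + ∑ i, ∑ j, l2norm Ω (weakPartial Ω i fun x => z x j) ^ 2)

/-- `z ∈ H¹₀(Ω)^d`: `z` is the limit in `H¹(Ω)^d` of functions in `C_c^∞(Ω)^d`. -/
def MemH10 (Ω : Set (Vec d)) (z : Vec d → Vec d) : Prop :=
  MemH1 Ω z ∧ ∃ φ : ℕ → Vec d → Vec d, (∀ n, IsTestFunction Ω (φ n)) ∧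
    Tendsto (fun n => h1norm Ω (z - φ n)) atTop (𝓝 0)

/-- The linearised strain `ε(z) = (∇z + (∇z)ᵗ) / 2`. -/
def strain (Ω : Set (Vec d)) (z : Vec d → Vec d) (x : Vec d) : Matrix (Fin d) (Fin d) ℝ :=
  Matrix.of fun i j =>
    (weakPartial Ω j (fun y => z y i) x + weakPartial Ω i (fun y => z y j) x) / 2

/-- `⟨ε(y) : ε(z)⟩`, the `L²(Ω)` inner product of two strains. -/
def strainInner (Ω : Set (Vec d)) (y z : Vec d → Vec d) : ℝ :=
  ∫ x in Ω, ∑ i, ∑ j, strain Ω y x i j * strain Ω z x i j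

end Sobolev

/-! ### Simplicial meshes and the discrete spaces -/

section Mesh

variable {d : ℕ}

/-- The `d`-simplices of a simplicial complex in `ℝ^d`, given by their sets of vertices. -/
def cells (T : Geometry.SimplicialComplex ℝ (Vec d)) : Set (Finset (Vec d)) :=
  {s | s ∈ T.faces ∧ s.card = d + 1}

/-- `T` is a (conforming) decomposition of `Ω` into finitely many closed `d`-simplices. -/
structure IsMesh (Ω : Set (Vec d)) (T : Geometry.SimplicialComplex ℝ (Vec d)) : Prop where
  finite : T.faces.Finite
  cover : ⋃ s ∈ cells T, convexHull ℝ (s : Set (Vec d)) = closure Ω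

/-- Shape regularity with constant `σ`: each cell `K` contains a ball of some radius `r > 0`
with `diam K ≤ σ r`. -/
def IsShapeRegular (σ : ℝ) (T : Geometry.SimplicialComplex ℝ (Vec d)) : Prop :=
  ∀ s ∈ cells T, ∃ (c : Vec d) (r : ℝ), 0 < r ∧
    Metric.closedBall c r ⊆ convexHull ℝ (s : Set (Vec d)) ∧
    Metric.diam (convexHull ℝ (s : Set (Vec d))) ≤ σ * r

/-- The pressure space `W_h`: functions in `L²(Ω)` that are constant on each cell. -/
def pressureSpace (Ω : Set (Vec d)) (T : Geometry.SimplicialComplex ℝ (Vec d)) :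
    Set (Vec d → ℝ) :=
  {w | MemL2 Ω w ∧ ∀ s ∈ cells T, ∃ c : ℝ,
    ∀ᵐ x ∂volume.restrict (Ω ∩ convexHull ℝ (s : Set (Vec d))), w x = c}

/-- The lowest order Raviart-Thomas space `V_h`: fields in `H(div; Ω)` of the form `a + β x`
on each cell. -/
def fluxSpace (Ω : Set (Vec d)) (T : Geometry.SimplicialComplex ℝ (Vec d)) :
    Set (Vec d → Vec d) :=
  {v | MemHdiv Ω v ∧ ∀ s ∈ cells T, ∃ (a : Vec d) (β : ℝ),
    ∀ᵐ x ∂volume.restrict (Ω ∩ convexHull ℝ (s : Set (Vec d))), v x = a + β • x}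

/-- The linear elements without boundary condition: fields in `H¹(Ω)^d` that are affine on
each cell. -/
def linearSpace (Ω : Set (Vec d)) (T : Geometry.SimplicialComplex ℝ (Vec d)) :
    Set (Vec d → Vec d) :=
  {z | MemH1 Ω z ∧ ∀ s ∈ cells T, ∃ A : Vec d →ᵃ[ℝ] Vec d,
    ∀ᵐ x ∂volume.restrict (Ω ∩ convexHull ℝ (s : Set (Vec d))), z x = A x}

/-- The linear elements with homogeneous Dirichlet boundary condition. -/
def linearSpaceZero (Ω : Set (Vec d)) (T : Geometry.SimplicialComplex ℝ (Vec d)) :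
    Set (Vec d → Vec d) :=
  {z | z ∈ linearSpace Ω T ∧ MemH10 Ω z}

/-- `C` is a bound for lifting piecewise constants through the divergence: every `w ∈ W_h` is
`div v` for some `v ∈ V_h` with `‖v‖ ≤ C ‖w‖`. -/
def IsDivLiftingConstant (Ω : Set (Vec d)) (T : Geometry.SimplicialComplex ℝ (Vec d))
    (C : ℝ) : Prop :=
  ∀ w ∈ pressureSpace Ω T, ∃ v ∈ fluxSpace Ω T,
    weakDiv Ω v =ᵐ[volume.restrict Ω] w ∧ l2norm Ω v ≤ C * l2norm Ω w

end Mesh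

/-! ### The discrete non-linear Biot problem and the splitting scheme -/

/-- The coefficients of one time step of the non-linear Biot model. -/
structure Coefficients (d : ℕ) where
  /-- shear modulus -/
  μ : ℝ
  /-- Biot coefficient -/
  α : ℝ
  /-- kinematic fluid viscosity -/
  νf : ℝ
  /-- fluid density -/
  ρf : ℝ
  /-- time step -/
  τ : ℝ
  /-- gravity vector -/
  grav : Vec d
  /-- density law -/
  b : ℝ → ℝ
  /-- volumetric stress law -/
  h : ℝ → ℝ
  /-- permeability -/
  K : Vec d → ℝ
  /-- body force at the new time level -/
  f : Vec d → Vec d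
  /-- fluid source at the new time level -/
  Sf : Vec d → ℝ

section Problem

variable {d : ℕ}

/-- `(p, q, u) ∈ W_h × V_h × Z` solves the fully discrete problem at one time step, given the
pressure `p₀` and the displacement `u₀` of the previous time level. The set `Z` is the
displacement space. -/
structure IsDiscreteSolution (Ω : Set (Vec d)) (T : Geometry.SimplicialComplex ℝ (Vec d))
    (Z : Set (Vec d → Vec d)) (D : Coefficients d) (p₀ : Vec d → ℝ) (u₀ : Vec d → Vec d)
    (p : Vec d → ℝ) (q u : Vec d → Vec d) : Prop where
  mem_p : p ∈ pressureSpace Ω T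
  mem_q : q ∈ fluxSpace Ω T
  mem_u : u ∈ Z
  displacement : ∀ z ∈ Z,
    2 * D.μ * strainInner Ω u z + l2inner Ω (fun x => D.h (weakDiv Ω u x)) (weakDiv Ω z)
      - D.α * l2inner Ω p (weakDiv Ω z) = l2inner Ω D.f z
  flow : ∀ v ∈ fluxSpace Ω T,
    D.νf * l2inner Ω (fun x => (D.K x)⁻¹ • q x) v - l2inner Ω p (weakDiv Ω v)
      = l2inner Ω (fun _ => D.ρf • D.grav) v
  mass : ∀ w ∈ pressureSpace Ω T,
    l2inner Ω (fun x => D.b (p x)) w + D.α * l2inner Ω (weakDiv Ω u) w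
        + D.τ * l2inner Ω (weakDiv Ω q) w
      = D.τ * l2inner Ω D.Sf w + l2inner Ω (fun x => D.b (p₀ x)) w
        + D.α * l2inner Ω (weakDiv Ω u₀) w

/-- `(p', q', u')` is obtained from the iterate with pressure `p` and displacement `u` by one
step of the splitting scheme with parameters `L₁, L₂`: first the linearised flow problem with
the old displacement, then the linearised mechanics problem with the new pressure. -/
structure IsSplittingStep (Ω : Set (Vec d)) (T : Geometry.SimplicialComplex ℝ (Vec d))
    (Z : Set (Vec d → Vec d)) (D : Coefficients d) (L₁ L₂ : ℝ)
    (p₀ : Vec d → ℝ) (u₀ : Vec d → Vec d) (p : Vec d → ℝ) (u : Vec d → Vec d)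
    (p' : Vec d → ℝ) (q' u' : Vec d → Vec d) : Prop where
  mem_p : p' ∈ pressureSpace Ω T
  mem_q : q' ∈ fluxSpace Ω T
  mem_u : u' ∈ Z
  flow : ∀ v ∈ fluxSpace Ω T,
    D.νf * l2inner Ω (fun x => (D.K x)⁻¹ • q' x) v - l2inner Ω p' (weakDiv Ω v)
      = l2inner Ω (fun _ => D.ρf • D.grav) v
  mass : ∀ w ∈ pressureSpace Ω T,
    l2inner Ω (fun x => D.b (p x)) w + L₁ * l2inner Ω (p' - p) w
        + D.α * l2inner Ω (weakDiv Ω u) w + D.τ * l2inner Ω (weakDiv Ω q') w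
      = D.τ * l2inner Ω D.Sf w + l2inner Ω (fun x => D.b (p₀ x)) w
        + D.α * l2inner Ω (weakDiv Ω u₀) w
  displacement : ∀ z ∈ Z,
    2 * D.μ * strainInner Ω u' z + L₂ * l2inner Ω (weakDiv Ω u' - weakDiv Ω u) (weakDiv Ω z)
        + l2inner Ω (fun x => D.h (weakDiv Ω u x)) (weakDiv Ω z)
        - D.α * l2inner Ω p' (weakDiv Ω z)
      = l2inner Ω D.f z

/-- The weighted energy of an error `(e_p, e_q, e_u)`. -/
def errorEnergy (Ω : Set (Vec d)) (L₁ L₂ b_m k_m k_M νf τ C : ℝ)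
    (ep : Vec d → ℝ) (eq eu : Vec d → Vec d) : ℝ :=
  (L₁ - b_m / 2 + τ * k_m ^ 2 / (νf * C ^ 2 * k_M)) * l2norm Ω ep ^ 2
    + τ * νf / k_M * l2norm Ω eq ^ 2 + L₂ * l2norm Ω (weakDiv Ω eu) ^ 2

end Problem

end Biot

end

/-! Convergence. Subtract the discrete problem from the scheme and test with the new errors. By the
mean value theorem `b` and `h` act on errors as multiplication by slopes `β ∈ [b_m, L_b]` and `η ∈
[h_m, L_h]`, so a pointwise quadratic inequality remains (`splitting_pointwise`). Its only term
without a sign is the lagged coupling `2 α P' (U - U')`, where `P'` is the new pressure error and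
`U`, `U'` are the old and new divergences of the displacement error. It is absorbed by `b_m P'²` and
`(α² / b_m) (U - U')²`, which explains the condition on `L₂`. The flux term `2 τ ⟨div e_q, e_p⟩`
equals `2 τ νf ⟨K⁻¹ e_q, e_q⟩`; half of its lower bound stays in the energy, and the other half
controls the pressure error through a lifting by the divergence (`IsSplittingStep.energy_le`). Since
`L₁ - b_m < L₁ - b_m / 2` and `L₂ - h_m < L₂`, one factor contracts both parts
(`exists_linear_convergence`). The strain term of the same estimate gives the `H¹` bound on `H¹₀` by
Korn and Poincaré (`MemH10.h1norm_sq_le`).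

The lifting constant. The longer part is a lifting bound uniform over shape regular meshes
(`exists_divLiftingConstant`). A piecewise constant `w` is replaced by a smooth `g` with the same
cell averages and comparable norm. A Fourier multiplier solves `div v = g` on a ball around `Ω`,
with `v` bounded in `H¹` by the `L²` norm of `g` (`exists_smooth_lifting`). The Raviart-Thomas
interpolant of `v` then has divergence `w`, and it is stable because the gradients of the
barycentric coordinates are at most `1 / r` while cells have diameter at most `σ r`.

No surface measure is used. The mean over a face is an average over a corner simplex after radial
projection, and the divergence theorem on a simplex is an identity for the cone over that face
(`integral_cornerSimplex_cone`): the faces through the apex contribute nothing to the flux of `φ(z)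
(z - x)`. Conformity of the interpolant comes from the cancellation of weighted normals at facets
inside `Ω`, proved by integrating the derivative of a bump function (`IsMesh.faceMean_eq_zero_or`).
-/

noncomputable section

namespace Biot

/-! ### Calculus of the inner product and norm of `L²`. -/

section L2
variable {d : ℕ} {Ω : Set (Vec d)} {F : Type*} [NormedAddCommGroup F] [InnerProductSpace ℝ F]

lemma l2inner_eq_inner {f g : Vec d → F} (hf : MemL2 Ω f) (hg : MemL2 Ω g) :
    l2inner Ω f g = inner ℝ (MemLp.toLp f hf) (MemLp.toLp g hg) := by
  rw [L2.inner_def, l2inner]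
  refine integral_congr_ae ?_
  filter_upwards [hf.coeFn_toLp, hg.coeFn_toLp] with x h1 h2
  rw [h1, h2]

lemma l2norm_eq_norm {f : Vec d → F} (hf : MemL2 Ω f) : l2norm Ω f = ‖MemLp.toLp f hf‖ := by
  rw [l2norm, l2inner_eq_inner hf hf, real_inner_self_eq_norm_sq, Real.sqrt_sq (norm_nonneg _)]

lemma l2norm_nonneg (f : Vec d → F) : 0 ≤ l2norm Ω f := Real.sqrt_nonneg _

lemma l2inner_self_nonneg (f : Vec d → F) : 0 ≤ l2inner Ω f f :=
  integral_nonneg fun _ => real_inner_self_nonneg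

lemma l2norm_sq (f : Vec d → F) : l2norm Ω f ^ 2 = l2inner Ω f f :=
  Real.sq_sqrt (l2inner_self_nonneg f)

lemma l2norm_sq_eq_integral (f : Vec d → F) : l2norm Ω f ^ 2 = ∫ x in Ω, ‖f x‖ ^ 2 := by
  rw [l2norm_sq, l2inner]
  simp_rw [real_inner_self_eq_norm_sq]

lemma l2inner_congr {f f' g g' : Vec d → F} (hf : f =ᵐ[volume.restrict Ω] f')
    (hg : g =ᵐ[volume.restrict Ω] g') : l2inner Ω f g = l2inner Ω f' g' := by
  refine integral_congr_ae ?_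
  filter_upwards [hf, hg] with x h1 h2
  rw [h1, h2]

lemma l2norm_congr {f f' : Vec d → F} (hf : f =ᵐ[volume.restrict Ω] f') :
    l2norm Ω f = l2norm Ω f' := by
  rw [l2norm, l2norm, l2inner_congr hf hf]

lemma MemL2.sub {E : Type*} [NormedAddCommGroup E] {f g : Vec d → E} (hf : MemL2 Ω f) (hg : MemL2 Ω g) : MemL2 Ω (f - g) :=
  MemLp.sub hf hg

lemma MemL2.add {E : Type*} [NormedAddCommGroup E] {f g : Vec d → E} (hf : MemL2 Ω f) (hg : MemL2 Ω g) : MemL2 Ω (f + g) :=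
  MemLp.add hf hg

lemma l2inner_sub_left {f f' g : Vec d → F} (hf : MemL2 Ω f) (hf' : MemL2 Ω f')
    (hg : MemL2 Ω g) : l2inner Ω (f - f') g = l2inner Ω f g - l2inner Ω f' g := by
  rw [l2inner_eq_inner (hf.sub hf') hg, l2inner_eq_inner hf hg, l2inner_eq_inner hf' hg,
    ← inner_sub_left]
  rfl

lemma l2norm_sub_le {f g : Vec d → F} (hf : MemL2 Ω f) (hg : MemL2 Ω g) :
    l2norm Ω (f - g) ≤ l2norm Ω f + l2norm Ω g := by
  rw [l2norm_eq_norm (hf.sub hg), l2norm_eq_norm hf, l2norm_eq_norm hg, MemLp.toLp_sub]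
  exact norm_sub_le _ _

lemma l2inner_le {f g : Vec d → F} (hf : MemL2 Ω f) (hg : MemL2 Ω g) :
    l2inner Ω f g ≤ l2norm Ω f * l2norm Ω g := by
  rw [l2inner_eq_inner hf hg, l2norm_eq_norm hf, l2norm_eq_norm hg]
  exact real_inner_le_norm _ _

lemma MemL2.integrable_inner {f g : Vec d → F} (hf : MemL2 Ω f) (hg : MemL2 Ω g) :
    Integrable (fun x => inner ℝ (f x) (g x)) (volume.restrict Ω) := by
  refine (L2.integrable_inner (𝕜 := ℝ) (MemLp.toLp f hf) (MemLp.toLp g hg)).congr ?_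
  filter_upwards [hf.coeFn_toLp, hg.coeFn_toLp] with x h1 h2
  rw [h1, h2]

lemma MemL2.integrable_mul {f g : Vec d → ℝ} (hf : MemL2 Ω f) (hg : MemL2 Ω g) :
    Integrable (fun x => f x * g x) (volume.restrict Ω) :=
  MemLp.integrable_mul hf hg

lemma MemL2.integrable_sq {f : Vec d → ℝ} (hf : MemL2 Ω f) :
    Integrable (fun x => f x ^ 2) (volume.restrict Ω) := MemLp.integrable_sq hf

lemma MemL2.coord {v : Vec d → Vec d} (hv : MemL2 Ω v) (i : Fin d) :
    MemL2 Ω (fun x => v x i) :=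
  (EuclideanSpace.proj (𝕜 := ℝ) i : Vec d →L[ℝ] ℝ).comp_memLp' hv

end L2

/-! ### Weak derivatives, `H(div)`, `H¹` and `H¹₀`. -/

section Weak
variable {d : ℕ} {Ω : Set (Vec d)}

lemma continuous_partialDeriv {φ : Vec d → ℝ} (hφ : ContDiff ℝ 1 φ) (i : Fin d) :
    Continuous (partialDeriv i φ) :=
  (hφ.continuous_fderiv one_ne_zero).clm_apply continuous_const

lemma hasCompactSupport_partialDeriv {φ : Vec d → ℝ} (hφ : HasCompactSupport φ) (i : Fin d) :
    HasCompactSupport (partialDeriv i φ) :=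
  hφ.fderiv_apply (𝕜 := ℝ) _

lemma IsTestFunction.memL2 {F : Type*} [NormedAddCommGroup F] [NormedSpace ℝ F]
    {φ : Vec d → F} (hφ : IsTestFunction Ω φ) : MemL2 Ω φ :=
  (hφ.1.continuous.memLp_of_hasCompactSupport hφ.2.1).restrict Ω

lemma IsTestFunction.memL2_partialDeriv {φ : Vec d → ℝ} (hφ : IsTestFunction Ω φ) (i : Fin d) :
    MemL2 Ω (partialDeriv i φ) :=
  ((continuous_partialDeriv (hφ.1.of_le (by simp)) i).memLp_of_hasCompactSupport
    (hasCompactSupport_partialDeriv hφ.2.1 i)).restrict Ω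

/-- The fundamental lemma of the calculus of variations. It makes the choices in `weakPartial` and
`weakDiv` harmless: any two candidates agree almost everywhere. -/
lemma ae_eq_of_forall_testFunction (hΩ : IsOpen Ω) {g g' : Vec d → ℝ} (hg : MemL2 Ω g)
    (hg' : MemL2 Ω g')
    (h : ∀ φ : Vec d → ℝ, IsTestFunction Ω φ → ∫ x in Ω, g x * φ x = ∫ x in Ω, g' x * φ x) :
    g =ᵐ[volume.restrict Ω] g' := by
  have hl : LocallyIntegrable (g - g') (volume.restrict Ω) :=
    (hg.sub hg').locallyIntegrable one_le_two
  have key : ∀ᵐ x, x ∈ Ω → (g - g') x = 0 := by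
    refine hΩ.ae_eq_zero_of_integral_contDiff_smul_eq_zero ?_ ?_
    · rw [locallyIntegrableOn_iff hΩ.isLocallyClosed]
      intro k hk hkc
      have := hl.integrableOn_isCompact hkc
      rwa [IntegrableOn, Measure.restrict_restrict_of_subset hk] at this
    · intro φ h1 h2 h3
      have hφ : IsTestFunction Ω φ := ⟨h1, h2, h3⟩
      have e : ∫ x, φ x • (g - g') x = ∫ x in Ω, φ x • (g - g') x := by
        refine (setIntegral_eq_integral_of_forall_compl_eq_zero fun x hx => ?_).symm
        rw [image_eq_zero_of_notMem_tsupport (fun hx' => hx (h3 hx')), zero_smul]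
      rw [e]
      have := h φ hφ
      have e2 : ∀ x, φ x • (g - g') x = g x * φ x - g' x * φ x := fun x => by
        simp only [Pi.sub_apply, smul_eq_mul]; ring
      simp_rw [e2]
      rw [integral_sub (hg.integrable_mul hφ.memL2) (hg'.integrable_mul hφ.memL2), this, sub_self]
  rw [EventuallyEq, ae_restrict_iff' hΩ.measurableSet]
  filter_upwards [key] with x hx hxΩ
  exact sub_eq_zero.1 (hx hxΩ)

lemma HasWeakPartial.ae_eq (hΩ : IsOpen Ω) {i : Fin d} {f g g' : Vec d → ℝ}
    (h : HasWeakPartial Ω i f g) (h' : HasWeakPartial Ω i f g') :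
    g =ᵐ[volume.restrict Ω] g' :=
  ae_eq_of_forall_testFunction hΩ h.1 h'.1 fun φ hφ =>
    neg_injective ((h.2 φ hφ).symm.trans (h'.2 φ hφ))

lemma HasWeakDiv.ae_eq (hΩ : IsOpen Ω) {v : Vec d → Vec d} {g g' : Vec d → ℝ}
    (h : HasWeakDiv Ω v g) (h' : HasWeakDiv Ω v g') : g =ᵐ[volume.restrict Ω] g' :=
  ae_eq_of_forall_testFunction hΩ h.1 h'.1 fun φ hφ =>
    neg_injective ((h.2 φ hφ).symm.trans (h'.2 φ hφ))

lemma HasWeakPartial.hasWeakPartial_weakPartial {i : Fin d} {f g : Vec d → ℝ}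
    (h : HasWeakPartial Ω i f g) : HasWeakPartial Ω i f (weakPartial Ω i f) := by
  have : ∃ g, HasWeakPartial Ω i f g := ⟨g, h⟩
  rw [weakPartial, dif_pos this]
  exact this.choose_spec

lemma HasWeakDiv.hasWeakDiv_weakDiv {v : Vec d → Vec d} {g : Vec d → ℝ}
    (h : HasWeakDiv Ω v g) : HasWeakDiv Ω v (weakDiv Ω v) := by
  have : ∃ g, HasWeakDiv Ω v g := ⟨g, h⟩
  rw [weakDiv, dif_pos this]
  exact this.choose_spec

lemma HasWeakPartial.weakPartial_ae_eq (hΩ : IsOpen Ω) {i : Fin d} {f g : Vec d → ℝ}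
    (h : HasWeakPartial Ω i f g) : weakPartial Ω i f =ᵐ[volume.restrict Ω] g :=
  h.hasWeakPartial_weakPartial.ae_eq hΩ h

lemma HasWeakDiv.weakDiv_ae_eq (hΩ : IsOpen Ω) {v : Vec d → Vec d} {g : Vec d → ℝ}
    (h : HasWeakDiv Ω v g) : weakDiv Ω v =ᵐ[volume.restrict Ω] g :=
  h.hasWeakDiv_weakDiv.ae_eq hΩ h

lemma HasWeakPartial.sub {i : Fin d} {f f' g g' : Vec d → ℝ} (hf : MemL2 Ω f)
    (hf' : MemL2 Ω f') (h : HasWeakPartial Ω i f g) (h' : HasWeakPartial Ω i f' g') :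
    HasWeakPartial Ω i (f - f') (g - g') := by
  refine ⟨h.1.sub h'.1, fun φ hφ => ?_⟩
  simp only [Pi.sub_apply, sub_mul]
  rw [integral_sub (hf.integrable_mul (hφ.memL2_partialDeriv i))
    (hf'.integrable_mul (hφ.memL2_partialDeriv i)),
    integral_sub (h.1.integrable_mul hφ.memL2) (h'.1.integrable_mul hφ.memL2), h.2 φ hφ,
    h'.2 φ hφ]
  ring

lemma integrable_sum_mul_partialDeriv {v : Vec d → Vec d} (hv : MemL2 Ω v) {φ : Vec d → ℝ}
    (hφ : IsTestFunction Ω φ) :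
    Integrable (fun x => ∑ i, v x i * partialDeriv i φ x) (volume.restrict Ω) :=
  integrable_finsetSum _ fun i _ => (hv.coord i).integrable_mul (hφ.memL2_partialDeriv i)

lemma HasWeakDiv.sub {v v' : Vec d → Vec d} {g g' : Vec d → ℝ} (hv : MemL2 Ω v)
    (hv' : MemL2 Ω v') (h : HasWeakDiv Ω v g) (h' : HasWeakDiv Ω v' g') :
    HasWeakDiv Ω (v - v') (g - g') := by
  refine ⟨h.1.sub h'.1, fun φ hφ => ?_⟩
  simp only [Pi.sub_apply, PiLp.sub_apply, sub_mul, Finset.sum_sub_distrib]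
  rw [integral_sub (integrable_sum_mul_partialDeriv hv hφ)
    (integrable_sum_mul_partialDeriv hv' hφ),
    integral_sub (h.1.integrable_mul hφ.memL2) (h'.1.integrable_mul hφ.memL2), h.2 φ hφ,
    h'.2 φ hφ]
  ring

lemma MemH1.hasWeakPartial {z : Vec d → Vec d} (hz : MemH1 Ω z) (i j : Fin d) :
    HasWeakPartial Ω i (fun x => z x j) (weakPartial Ω i fun x => z x j) :=
  (hz.2 i j).choose_spec.hasWeakPartial_weakPartial

/-- Displacements thereby share the calculus of `weakDiv` with the fluxes. -/
lemma MemH1.hasWeakDiv {z : Vec d → Vec d} (hz : MemH1 Ω z) :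
    HasWeakDiv Ω z (fun x => ∑ i, weakPartial Ω i (fun y => z y i) x) := by
  refine ⟨memLp_finsetSum _ fun i _ => (hz.hasWeakPartial i i).1, fun φ hφ => ?_⟩
  simp_rw [Finset.sum_mul]
  rw [integral_finsetSum _ fun i _ => (hz.1.coord i).integrable_mul (hφ.memL2_partialDeriv i),
    integral_finsetSum _ fun i _ => (hz.hasWeakPartial i i).1.integrable_mul hφ.memL2,
    ← Finset.sum_neg_distrib]
  exact Finset.sum_congr rfl fun i _ => (hz.hasWeakPartial i i).2 φ hφ

lemma MemH1.memHdiv {z : Vec d → Vec d} (hz : MemH1 Ω z) : MemHdiv Ω z := ⟨hz.1, _, hz.hasWeakDiv⟩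

lemma MemHdiv.hasWeakDiv {v : Vec d → Vec d} (hv : MemHdiv Ω v) :
    HasWeakDiv Ω v (weakDiv Ω v) := hv.2.choose_spec.hasWeakDiv_weakDiv

lemma MemHdiv.sub {v v' : Vec d → Vec d} (hv : MemHdiv Ω v) (hv' : MemHdiv Ω v') :
    MemHdiv Ω (v - v') :=
  ⟨hv.1.sub hv'.1, _, hv.hasWeakDiv.sub hv.1 hv'.1 hv'.hasWeakDiv⟩

lemma MemHdiv.weakDiv_sub (hΩ : IsOpen Ω) {v v' : Vec d → Vec d} (hv : MemHdiv Ω v)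
    (hv' : MemHdiv Ω v') :
    weakDiv Ω (v - v') =ᵐ[volume.restrict Ω] weakDiv Ω v - weakDiv Ω v' :=
  (hv.hasWeakDiv.sub hv.1 hv'.1 hv'.hasWeakDiv).weakDiv_ae_eq hΩ

lemma MemH1.sub {z z' : Vec d → Vec d} (hz : MemH1 Ω z) (hz' : MemH1 Ω z') : MemH1 Ω (z - z') :=
  ⟨hz.1.sub hz'.1, fun i j =>
    ⟨_, (hz.hasWeakPartial i j).sub (hz.1.coord j) (hz'.1.coord j) (hz'.hasWeakPartial i j)⟩⟩

lemma MemH1.weakPartial_sub (hΩ : IsOpen Ω) {z z' : Vec d → Vec d} (hz : MemH1 Ω z)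
    (hz' : MemH1 Ω z') (i j : Fin d) :
    weakPartial Ω i (fun x => (z - z') x j) =ᵐ[volume.restrict Ω]
      weakPartial Ω i (fun x => z x j) - weakPartial Ω i (fun x => z' x j) :=
  ((hz.hasWeakPartial i j).sub (hz.1.coord j) (hz'.1.coord j)
    (hz'.hasWeakPartial i j)).weakPartial_ae_eq hΩ

/-! ### The norm of `H¹` -/

lemma l2norm_le_h1norm (z : Vec d → Vec d) : l2norm Ω z ≤ h1norm Ω z :=
  Real.le_sqrt_of_sq_le (le_add_of_nonneg_right
    (Finset.sum_nonneg fun _ _ => Finset.sum_nonneg fun _ _ => sq_nonneg _))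

lemma l2norm_weakPartial_le_h1norm (z : Vec d → Vec d) (i j : Fin d) :
    l2norm Ω (weakPartial Ω i fun x => z x j) ≤ h1norm Ω z := by
  refine Real.le_sqrt_of_sq_le ?_
  have h1 : l2norm Ω (weakPartial Ω i fun x => z x j) ^ 2
      ≤ ∑ j, l2norm Ω (weakPartial Ω i fun x => z x j) ^ 2 :=
    Finset.single_le_sum (f := fun j => l2norm Ω (weakPartial Ω i fun x => z x j) ^ 2)
      (fun _ _ => sq_nonneg _) (Finset.mem_univ j)
  have h2 : ∑ j, l2norm Ω (weakPartial Ω i fun x => z x j) ^ 2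
      ≤ ∑ i, ∑ j, l2norm Ω (weakPartial Ω i fun x => z x j) ^ 2 :=
    Finset.single_le_sum (f := fun i => ∑ j, l2norm Ω (weakPartial Ω i fun x => z x j) ^ 2)
      (fun _ _ => Finset.sum_nonneg fun _ _ => sq_nonneg _) (Finset.mem_univ i)
  nlinarith [sq_nonneg (l2norm Ω z)]

/-- Convergence can thus be checked component by component, so that a triangle inequality for
`h1norm` is not needed. -/
lemma tendsto_h1norm_zero_iff {z : ℕ → Vec d → Vec d} :
    Tendsto (fun n => h1norm Ω (z n)) atTop (𝓝 0) ↔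
      Tendsto (fun n => l2norm Ω (z n)) atTop (𝓝 0) ∧
      ∀ i j, Tendsto (fun n => l2norm Ω (weakPartial Ω i fun x => z n x j)) atTop (𝓝 0) := by
  constructor
  · intro h
    exact ⟨squeeze_zero (fun _ => l2norm_nonneg _) (fun _ => l2norm_le_h1norm _) h, fun i j =>
      squeeze_zero (fun _ => l2norm_nonneg _) (fun _ => l2norm_weakPartial_le_h1norm _ i j) h⟩
  · rintro ⟨h1, h2⟩
    have : Tendsto (fun n => l2norm Ω (z n) ^ 2
        + ∑ i, ∑ j, l2norm Ω (weakPartial Ω i fun x => z n x j) ^ 2) atTop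
        (𝓝 (0 ^ 2 + ∑ i : Fin d, ∑ j : Fin d, 0 ^ 2)) :=
      (h1.pow 2).add (tendsto_finsetSum _ fun i _ => tendsto_finsetSum _ fun j _ =>
        (h2 i j).pow 2)
    simpa [h1norm] using this.sqrt

lemma IsTestFunction.coord {φ : Vec d → Vec d} (hφ : IsTestFunction Ω φ) (j : Fin d) :
    IsTestFunction Ω (fun x => φ x j) := by
  have hs : (fun x => φ x j) = (EuclideanSpace.proj (𝕜 := ℝ) j : Vec d →L[ℝ] ℝ) ∘ φ := rfl
  refine ⟨(EuclideanSpace.proj (𝕜 := ℝ) j : Vec d →L[ℝ] ℝ).contDiff.comp hφ.1,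
    hφ.2.1.comp_left (g := (EuclideanSpace.proj (𝕜 := ℝ) j : Vec d →L[ℝ] ℝ)) (map_zero _),
    (closure_mono ?_).trans hφ.2.2⟩
  rw [hs]
  exact Function.support_comp_subset (map_zero _) _

lemma IsTestFunction.sub {F : Type*} [NormedAddCommGroup F] [NormedSpace ℝ F] {φ ψ : Vec d → F}
    (hφ : IsTestFunction Ω φ) (hψ : IsTestFunction Ω ψ) : IsTestFunction Ω (φ - ψ) :=
  ⟨hφ.1.sub hψ.1, hφ.2.1.sub hψ.2.1,
    (tsupport_sub φ ψ).trans (Set.union_subset hφ.2.2 hψ.2.2)⟩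

lemma integral_mul_partialDeriv {φ ψ : Vec d → ℝ} (hφ : ContDiff ℝ 1 φ) (hψ : ContDiff ℝ 1 ψ)
    (hψc : HasCompactSupport ψ) (i : Fin d) :
    ∫ x, φ x * partialDeriv i ψ x = -∫ x, partialDeriv i φ x * ψ x := by
  have h1 : Continuous fun x => partialDeriv i φ x * ψ x :=
    (continuous_partialDeriv hφ i).mul hψ.continuous
  have h2 : Continuous fun x => φ x * partialDeriv i ψ x :=
    hφ.continuous.mul (continuous_partialDeriv hψ i)
  exact integral_mul_fderiv_eq_neg_fderiv_mul_of_integrable (𝕜 := ℝ) (v := EuclideanSpace.single i 1)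
    (h1.integrable_of_hasCompactSupport hψc.mul_left)
    (h2.integrable_of_hasCompactSupport (hasCompactSupport_partialDeriv hψc i).mul_left)
    ((hφ.continuous.mul hψ.continuous).integrable_of_hasCompactSupport hψc.mul_left)
    (fun x _ => hφ.differentiable one_ne_zero x) (fun x _ => hψ.differentiable one_ne_zero x)

lemma setIntegral_eq_integral_of_tsupport_subset {ψ : Vec d → ℝ} (h : tsupport ψ ⊆ Ω) :
    ∫ x in Ω, ψ x = ∫ x, ψ x :=
  setIntegral_eq_integral_of_forall_compl_eq_zero fun _ hx =>
    image_eq_zero_of_notMem_tsupport fun hx' => hx (h hx')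

lemma tsupport_partialDeriv_subset (φ : Vec d → ℝ) (i : Fin d) :
    tsupport (partialDeriv i φ) ⊆ tsupport φ :=
  tsupport_fderiv_apply_subset ℝ _

lemma IsTestFunction.hasWeakPartial {φ : Vec d → ℝ} (hφ : IsTestFunction Ω φ) (i : Fin d) :
    HasWeakPartial Ω i φ (partialDeriv i φ) := by
  refine ⟨hφ.memL2_partialDeriv i, fun ψ hψ => ?_⟩
  rw [setIntegral_eq_integral_of_tsupport_subset, setIntegral_eq_integral_of_tsupport_subset]
  · exact integral_mul_partialDeriv (hφ.1.of_le (by simp)) (hψ.1.of_le (by simp)) hψ.2.1 i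
  · exact (tsupport_mul_subset_right).trans hψ.2.2
  · exact (tsupport_mul_subset_left).trans hφ.2.2

lemma IsTestFunction.memH1 {φ : Vec d → Vec d} (hφ : IsTestFunction Ω φ) : MemH1 Ω φ :=
  ⟨hφ.memL2, fun i j => ⟨_, (hφ.coord j).hasWeakPartial i⟩⟩

lemma MemH10.sub (hΩ : IsOpen Ω) {z z' : Vec d → Vec d} (hz : MemH10 Ω z) (hz' : MemH10 Ω z') :
    MemH10 Ω (z - z') := by
  obtain ⟨h1, φ, hφ, hφt⟩ := hz
  obtain ⟨h1', φ', hφ', hφt'⟩ := hz'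
  refine ⟨h1.sub h1', fun n => φ n - φ' n, fun n => (hφ n).sub (hφ' n), ?_⟩
  rw [tendsto_h1norm_zero_iff] at hφt hφt' ⊢
  have e : ∀ n, z - z' - (φ n - φ' n) = (z - φ n) - (z' - φ' n) := fun n => by abel
  simp_rw [e]
  have a : ∀ n, MemH1 Ω (z - φ n) := fun n => h1.sub (hφ n).memH1
  have a' : ∀ n, MemH1 Ω (z' - φ' n) := fun n => h1'.sub (hφ' n).memH1
  refine ⟨squeeze_zero (fun _ => l2norm_nonneg _) (fun n => l2norm_sub_le (a n).1 (a' n).1)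
    (by simpa using hφt.1.add hφt'.1), fun i j => ?_⟩
  refine squeeze_zero (fun _ => l2norm_nonneg _) (fun n => ?_)
    (by simpa using (hφt.2 i j).add (hφt'.2 i j))
  rw [l2norm_congr ((a n).weakPartial_sub hΩ (a' n) i j)]
  exact l2norm_sub_le ((a n).hasWeakPartial i j).1 ((a' n).hasWeakPartial i j).1

end Weak

/-! ### Differences of discrete functions, so that errors are admissible test functions. -/

section Spaces
variable {d : ℕ} {Ω : Set (Vec d)} {T : Geometry.SimplicialComplex ℝ (Vec d)}

lemma sub_mem_pressureSpace {p p' : Vec d → ℝ} (hp : p ∈ pressureSpace Ω T)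
    (hp' : p' ∈ pressureSpace Ω T) : p - p' ∈ pressureSpace Ω T := by
  refine ⟨hp.1.sub hp'.1, fun s hs => ?_⟩
  obtain ⟨c, hc⟩ := hp.2 s hs
  obtain ⟨c', hc'⟩ := hp'.2 s hs
  refine ⟨c - c', ?_⟩
  filter_upwards [hc, hc'] with x h h'
  rw [Pi.sub_apply, h, h']

lemma sub_mem_fluxSpace {q q' : Vec d → Vec d} (hq : q ∈ fluxSpace Ω T)
    (hq' : q' ∈ fluxSpace Ω T) : q - q' ∈ fluxSpace Ω T := by
  refine ⟨hq.1.sub hq'.1, fun s hs => ?_⟩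
  obtain ⟨a, β, hc⟩ := hq.2 s hs
  obtain ⟨a', β', hc'⟩ := hq'.2 s hs
  refine ⟨a - a', β - β', ?_⟩
  filter_upwards [hc, hc'] with x h h'
  rw [Pi.sub_apply, h, h', sub_smul]
  abel

lemma sub_mem_linearSpace {z z' : Vec d → Vec d} (hz : z ∈ linearSpace Ω T)
    (hz' : z' ∈ linearSpace Ω T) : z - z' ∈ linearSpace Ω T := by
  refine ⟨hz.1.sub hz'.1, fun s hs => ?_⟩
  obtain ⟨A, hc⟩ := hz.2 s hs
  obtain ⟨A', hc'⟩ := hz'.2 s hs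
  refine ⟨A - A', ?_⟩
  filter_upwards [hc, hc'] with x h h'
  rw [Pi.sub_apply, h, h']
  rfl

lemma sub_mem_linearSpaceZero (hΩ : IsOpen Ω) {z z' : Vec d → Vec d}
    (hz : z ∈ linearSpaceZero Ω T) (hz' : z' ∈ linearSpaceZero Ω T) :
    z - z' ∈ linearSpaceZero Ω T :=
  ⟨sub_mem_linearSpace hz.1 hz'.1, hz.2.sub hΩ hz'.2⟩

end Spaces

/-! ### A bounded right inverse of the divergence by Fourier multipliers. -/

section Fourier
open FourierTransform SchwartzMap
variable {d : ℕ}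

/-- Both sides are tested against smooth compactly supported functions. The multiplication formula
moves the transform onto the test function, by Fubini for the integral and by duality for the `L²`
extension. -/
lemma fourier_ae_eq_fourier_toLp {F : Vec d → ℂ} (h1 : Integrable F) (h2 : MemLp F 2) :
    𝓕 F =ᵐ[volume] (𝓕 (MemLp.toLp F h2) : Lp ℂ 2 (volume : Measure (Vec d))) := by
  have hc : Continuous (𝓕 F) := VectorFourier.fourierIntegral_continuous
    Real.continuous_fourierChar (L := innerₗ (Vec d)) continuous_inner h1
  refine ae_eq_of_integral_contDiff_smul_eq hc.locallyIntegrable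
    ((Lp.memLp _).locallyIntegrable one_le_two) fun φ hφ hφc => ?_
  have hφC : ContDiff ℝ ∞ (fun x => (φ x : ℂ)) := Complex.ofRealCLM.contDiff.comp hφ
  have hφCc : HasCompactSupport (fun x => (φ x : ℂ)) := hφc.comp_left (g := Complex.ofReal) rfl
  let Φ : 𝓢(Vec d, ℂ) := hφCc.toSchwartzMap hφC
  have e := congrArg (fun u => u Φ) (Lp.fourier_toTemperedDistribution_eq (MemLp.toLp F h2))
  simp only [TemperedDistribution.fourier_apply, Lp.toTemperedDistribution_apply] at e
  have e1 : ∫ x, φ x • (𝓕 (MemLp.toLp F h2) : Lp ℂ 2 (volume : Measure (Vec d))) x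
      = ∫ x, Φ x • (𝓕 (MemLp.toLp F h2) : Lp ℂ 2 (volume : Measure (Vec d))) x := by
    refine integral_congr_ae (Eventually.of_forall fun x => ?_)
    change φ x • _ = (φ x : ℂ) • _
    simp
  rw [e1, ← e]
  have e2 : ∫ x, (𝓕 Φ) x • (MemLp.toLp F h2) x = ∫ x, (𝓕 Φ) x • F x := by
    refine integral_congr_ae ?_
    filter_upwards [h2.coeFn_toLp] with x hx
    rw [hx]
  rw [e2]
  have e3 := VectorFourier.integral_fourierIntegral_smul_eq_flip (μ := volume) (ν := volume)
    (L := innerₗ (Vec d)) Real.continuous_fourierChar continuous_inner Φ.integrable h1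
  have e4 : (innerₗ (Vec d)).flip = innerₗ (Vec d) := flip_innerₗ _
  rw [e4] at e3
  refine Eq.trans ?_ e3.symm
  refine integral_congr_ae (Eventually.of_forall fun x => ?_)
  exact (Complex.coe_smul (φ x) (𝓕 F x)).symm

/-- Plancherel's theorem, carried over from the `L²` extension to the pointwise Fourier integral,
whose derivatives can be computed. -/
lemma fourier_memLp_two {F : Vec d → ℂ} (h1 : Integrable F) (h2 : MemLp F 2) :
    MemLp (𝓕 F) 2 ∧ ∫ x, ‖𝓕 F x‖ ^ 2 = ∫ x, ‖F x‖ ^ 2 := by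
  have h := fourier_ae_eq_fourier_toLp h1 h2
  have hm : MemLp (𝓕 F) 2 := (memLp_congr_ae h).2 (Lp.memLp _)
  have hn : ∀ {f : Vec d → ℂ} (hf : MemLp f 2), ∫ x, ‖f x‖ ^ 2 = ‖hf.toLp f‖ ^ 2 := by
    intro f hf
    have := l2norm_sq_eq_integral (Ω := (Set.univ : Set (Vec d))) f
    rw [Lp.norm_toLp, ← ENNReal.toReal_pow]
    have h3 := hf.eLpNorm_eq_integral_rpow_norm two_ne_zero ENNReal.ofNat_ne_top
    rw [h3, ENNReal.toReal_pow, ENNReal.toReal_ofReal (by positivity)]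
    simp only [ENNReal.toReal_ofNat, Real.rpow_ofNat]
    rw [← Real.rpow_natCast, ← Real.rpow_mul (integral_nonneg fun _ => by positivity)]
    norm_num
  refine ⟨hm, ?_⟩
  rw [hn hm, hn h2, ← Lp.norm_fourier_eq (MemLp.toLp F h2)]
  congr 2
  rw [← Lp.toLp_coeFn (𝓕 (MemLp.toLp F h2)) (Lp.memLp _)]
  exact (MemLp.toLp_eq_toLp_iff _ _).2 h

lemma fderiv_fourier_apply {F : Vec d → ℂ} (h1 : Integrable F)
    (h2 : Integrable fun ξ => ‖ξ‖ * ‖F ξ‖) (x w : Vec d) :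
    fderiv ℝ (𝓕 F) x w =
      𝓕 (fun ξ => -(2 * Real.pi * Complex.I * (inner ℝ ξ w : ℝ)) * F ξ) x := by
  rw [Real.fderiv_fourier h1 h2]
  have : Integrable (VectorFourier.fourierSMulRight (innerSL ℝ) F) := by
    refine (h2.const_mul (2 * Real.pi * ‖innerSL (E := Vec d) ℝ‖)).mono
      (h1.1.fourierSMulRight) (Eventually.of_forall fun ξ => ?_)
    refine (VectorFourier.norm_fourierSMulRight_le _ _ _).trans ?_
    rw [Real.norm_of_nonneg (by positivity)]
    apply le_of_eq
    ring
  rw [Real.fourier_continuousLinearMap_apply this]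
  refine congrArg (fun f : Vec d → ℂ => 𝓕 f x) (funext fun ξ => ?_)
  rw [VectorFourier.fourierSMulRight_apply]
  change -(2 * Real.pi * Complex.I) • (inner ℝ ξ w : ℝ) • F ξ = _
  simp only [smul_eq_mul, Complex.real_smul]
  ring

/-- The multiplier need not be smooth, so `m S` need not be a Schwartz function. The decay of `S`
still makes all moments finite, which is what differentiating the transform requires. -/
lemma multiplier_integrable {m : Vec d → ℂ} (hm : Measurable m) {c : ℝ} (hc : ∀ ξ, ‖m ξ‖ ≤ c)
    (S : 𝓢(Vec d, ℂ)) : (∀ n : ℕ, Integrable fun ξ => ‖ξ‖ ^ n * ‖m ξ * S ξ‖) ∧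
      Integrable (fun ξ => m ξ * S ξ) ∧ MemLp (fun ξ => m ξ * S ξ) 2 ∧
      ∫ ξ, ‖m ξ * S ξ‖ ^ 2 ≤ c ^ 2 * ∫ ξ, ‖S ξ‖ ^ 2 := by
  have hmeas : AEStronglyMeasurable (fun ξ => m ξ * S ξ) volume :=
    hm.aestronglyMeasurable.mul S.continuous.aestronglyMeasurable
  have hle : ∀ ξ, ‖m ξ * S ξ‖ ≤ c * ‖S ξ‖ := fun ξ => by
    rw [norm_mul]; exact mul_le_mul_of_nonneg_right (hc ξ) (norm_nonneg _)
  have hc0 : 0 ≤ c := (norm_nonneg _).trans (hc 0)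
  have hint : Integrable (fun ξ => m ξ * S ξ) :=
    (S.integrable.norm.const_mul c).mono' hmeas (Eventually.of_forall hle)
  have h2 : MemLp (fun ξ => m ξ * S ξ) 2 :=
    (S.memLp 2).of_le_mul hmeas (Eventually.of_forall hle)
  refine ⟨fun n => ?_, hint, h2, ?_⟩
  · refine ((S.integrable_pow_mul volume n).const_mul c).mono'
      ((continuous_norm.pow n).aestronglyMeasurable.mul hmeas.norm)
      (Eventually.of_forall fun ξ => ?_)
    rw [Real.norm_of_nonneg (by positivity)]
    calc ‖ξ‖ ^ n * ‖m ξ * S ξ‖ ≤ ‖ξ‖ ^ n * (c * ‖S ξ‖) := by gcongr; exact hle ξ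
      _ = c * (‖ξ‖ ^ n * ‖S ξ‖) := by ring
  · rw [← integral_const_mul]
    refine integral_mono (h2.integrable_norm_pow two_ne_zero)
      (((S.memLp 2).integrable_norm_pow two_ne_zero).const_mul _)
      fun ξ => ?_
    calc ‖m ξ * S ξ‖ ^ 2 ≤ (c * ‖S ξ‖) ^ 2 := by gcongr; exact hle ξ
      _ = c ^ 2 * ‖S ξ‖ ^ 2 := by ring

/-- The Fourier multiplier of a right inverse of the divergence, up to a translation by `a`. -/
def liftMultiplier (a : Vec d) (j : Fin d) (ξ : Vec d) : ℂ :=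
  (ξ j : ℂ) * (1 - Complex.exp (Complex.I * ((-2 * Real.pi * inner ℝ ξ a : ℝ) : ℂ))) /
    (-(2 * Real.pi * Complex.I) * (‖ξ‖ : ℂ) ^ 2)

lemma measurable_liftMultiplier (a : Vec d) (j : Fin d) : Measurable (liftMultiplier a j) := by
  unfold liftMultiplier
  have h1 : Measurable fun ξ : Vec d => (ξ j : ℂ) := by
    have : Continuous fun ξ : Vec d => (ξ j : ℂ) := by fun_prop
    exact this.measurable
  have h2 : Measurable fun ξ : Vec d =>
      (1 - Complex.exp (Complex.I * ((-2 * Real.pi * inner ℝ ξ a : ℝ) : ℂ))) := by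
    have : Continuous fun ξ : Vec d =>
      (1 - Complex.exp (Complex.I * ((-2 * Real.pi * inner ℝ ξ a : ℝ) : ℂ))) := by fun_prop
    exact this.measurable
  have h3 : Measurable fun ξ : Vec d => -(2 * Real.pi * Complex.I) * (‖ξ‖ : ℂ) ^ 2 := by
    have : Continuous fun ξ : Vec d => -(2 * Real.pi * Complex.I) * (‖ξ‖ : ℂ) ^ 2 := by fun_prop
    exact this.measurable
  exact (h1.mul h2).div h3

lemma norm_liftMultiplier (a : Vec d) (j : Fin d) (ξ : Vec d) :
    ‖liftMultiplier a j ξ‖ = |ξ j| *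
      ‖Complex.exp (Complex.I * ((-2 * Real.pi * inner ℝ ξ a : ℝ) : ℂ)) - 1‖ /
        (2 * Real.pi * ‖ξ‖ ^ 2) := by
  rw [liftMultiplier, norm_div, norm_mul, norm_sub_rev 1]
  congr 1
  · simp
  · simp [abs_of_pos Real.pi_pos]

lemma abs_coord_le_norm (x : Vec d) (j : Fin d) : |x j| ≤ ‖x‖ := PiLp.norm_apply_le x j

/-- The factor `1 - exp (-2πi ξ·a)` vanishes at the origin and cancels one power of `‖ξ‖` in the
denominator, while `ξ j` cancels the other. Without the translation by `a` low frequencies would be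
unbounded. -/
lemma norm_liftMultiplier_le (a : Vec d) (j : Fin d) (ξ : Vec d) :
    ‖liftMultiplier a j ξ‖ ≤ ‖a‖ := by
  rw [norm_liftMultiplier]
  refine div_le_of_le_mul₀ (by positivity) (norm_nonneg _) ?_
  have h1 := Real.norm_exp_I_mul_ofReal_sub_one_le (x := -2 * Real.pi * inner ℝ ξ a)
  have h2 : ‖(-2 * Real.pi * inner ℝ ξ a : ℝ)‖ ≤ 2 * Real.pi * (‖ξ‖ * ‖a‖) := by
    rw [norm_mul, norm_mul, norm_neg, Real.norm_of_nonneg Real.pi_pos.le,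
      Real.norm_of_nonneg (zero_le_two)]
    gcongr
    exact norm_inner_le_norm ξ a
  calc _ ≤ ‖ξ‖ * (2 * Real.pi * (‖ξ‖ * ‖a‖)) :=
        mul_le_mul (abs_coord_le_norm ξ j) (h1.trans h2) (norm_nonneg _) (norm_nonneg _)
    _ = _ := by ring

/-- After one more derivative the powers of `‖ξ‖` cancel by themselves; the oscillating factor only
contributes its bound `2`. -/
lemma norm_mul_liftMultiplier_le (a : Vec d) (j k : Fin d) (ξ : Vec d) :
    ‖-(2 * Real.pi * Complex.I * (ξ k : ℝ)) * liftMultiplier a j ξ‖ ≤ 2 := by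
  rw [norm_mul, norm_liftMultiplier]
  have h1 : ‖Complex.exp (Complex.I * ((-2 * Real.pi * inner ℝ ξ a : ℝ) : ℂ)) - 1‖ ≤ 2 := by
    refine (norm_sub_le _ _).trans ?_
    rw [mul_comm, Complex.norm_exp_ofReal_mul_I, norm_one]
    norm_num
  have h2 : ‖-(2 * Real.pi * Complex.I * (ξ k : ℝ))‖ = 2 * Real.pi * |ξ k| := by
    simp [abs_of_pos Real.pi_pos]
  rw [h2, ← mul_div_assoc]
  refine div_le_of_le_mul₀ (by positivity) zero_le_two ?_
  calc _ ≤ 2 * Real.pi * ‖ξ‖ * (‖ξ‖ * 2) := by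
        gcongr
        exacts [abs_coord_le_norm ξ k, abs_coord_le_norm ξ j]
    _ = _ := by ring

/-- In space the right-hand side becomes `g - g (· + a)`: the divergence is correct up to a
translate of the datum. -/
lemma sum_mul_liftMultiplier (a : Vec d) {ξ : Vec d} (hξ : ξ ≠ 0) :
    ∑ j, -(2 * Real.pi * Complex.I * (ξ j : ℝ)) * liftMultiplier a j ξ =
      1 - Complex.exp (Complex.I * ((-2 * Real.pi * inner ℝ ξ a : ℝ) : ℂ)) := by
  have hn : (‖ξ‖ : ℂ) ^ 2 ≠ 0 := pow_ne_zero _ (by simpa using hξ)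
  have hs : ∑ j, (ξ j : ℂ) ^ 2 = (‖ξ‖ : ℂ) ^ 2 := by
    rw [← Complex.ofReal_pow, EuclideanSpace.real_norm_sq_eq]
    push_cast
    rfl
  set E := 1 - Complex.exp (Complex.I * ((-2 * Real.pi * inner ℝ ξ a : ℝ) : ℂ)) with hE
  have hpi : (Real.pi : ℂ) ≠ 0 := by exact_mod_cast Real.pi_ne_zero
  have : ∀ j, -(2 * Real.pi * Complex.I * (ξ j : ℝ)) * liftMultiplier a j ξ
      = (ξ j : ℂ) ^ 2 * (E / (‖ξ‖ : ℂ) ^ 2) := fun j => by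
    rw [liftMultiplier, ← hE]
    have := Complex.I_ne_zero
    field_simp
  simp_rw [this]
  rw [← Finset.sum_mul, hs, mul_div_cancel₀ _ hn]

lemma partialDeriv_re_fourier {F : Vec d → ℂ} (h1 : Integrable F)
    (h2 : Integrable fun ξ => ‖ξ‖ * ‖F ξ‖) (x : Vec d) (k : Fin d) :
    partialDeriv k (fun y => (𝓕 F y).re) x =
      (𝓕 (fun ξ => -(2 * Real.pi * Complex.I * (ξ k : ℝ)) * F ξ) x).re := by
  have hd : DifferentiableAt ℝ (𝓕 F) x := Real.differentiable_fourier h1 h2 x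
  have e : HasFDerivAt (fun y => (𝓕 F y).re) (Complex.reCLM ∘L fderiv ℝ (𝓕 F) x) x :=
    Complex.reCLM.hasFDerivAt.comp x hd.hasFDerivAt
  rw [partialDeriv, e.fderiv, ContinuousLinearMap.comp_apply, fderiv_fourier_apply h1 h2]
  simp [EuclideanSpace.inner_single_right]

lemma re_memLp_two {f : Vec d → ℂ} (hf : MemLp f 2) :
    MemLp (fun x => (f x).re) 2 ∧ ∫ x, (f x).re ^ 2 ≤ ∫ x, ‖f x‖ ^ 2 := by
  have h : MemLp (fun x => (f x).re) 2 := hf.re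
  refine ⟨h, integral_mono h.integrable_sq (hf.integrable_norm_pow two_ne_zero) fun x => ?_⟩
  rw [← sq_abs]
  exact pow_le_pow_left₀ (abs_nonneg _) (Complex.abs_re_le_norm _) 2

/-- A smooth right inverse of the divergence on a ball, bounded from `L²` to `H¹`. -/
theorem exists_smooth_lifting (hd : 1 ≤ d) {R : ℝ} (hR : 0 < R) : ∃ C : ℝ, 0 < C ∧
    ∀ g : Vec d → ℝ, ContDiff ℝ ∞ g → HasCompactSupport g →
      tsupport g ⊆ Metric.closedBall 0 R →
      ∃ v : Fin d → Vec d → ℝ, (∀ i, ContDiff ℝ 1 (v i)) ∧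
        (∀ x ∈ Metric.closedBall (0 : Vec d) R, ∑ i, partialDeriv i (v i) x = g x) ∧
        (∀ i, MemLp (v i) 2 ∧ ∫ x, v i x ^ 2 ≤ C * ∫ x, g x ^ 2) ∧
        ∀ i k, MemLp (partialDeriv k (v i)) 2 ∧
          ∫ x, partialDeriv k (v i) x ^ 2 ≤ C * ∫ x, g x ^ 2 := by
  -- A shift of length `3 R` moves the ball of radius `R` off itself, so `g (x + a) = 0` whenever
  -- `‖x‖ ≤ R`.
  set a : Vec d := EuclideanSpace.single ⟨0, hd⟩ (3 * R) with ha
  have hna : ‖a‖ = 3 * R := by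
    rw [ha, PiLp.norm_single, Real.norm_of_nonneg (by positivity)]
  refine ⟨‖a‖ ^ 2 + 2 ^ 2, by positivity, fun g hg hgc hgs => ?_⟩
  have hgC : ContDiff ℝ ∞ (fun x => (g x : ℂ)) := Complex.ofRealCLM.contDiff.comp hg
  have hgCc : HasCompactSupport (fun x => (g x : ℂ)) := hgc.comp_left (g := Complex.ofReal) rfl
  let G : 𝓢(Vec d, ℂ) := hgCc.toSchwartzMap hgC
  have hG : ∀ x, G x = (g x : ℂ) := fun x => rfl
  -- With `g` written as the transform of `S`, differentiation becomes multiplication by `-2πi ξ`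
  -- under the transform.
  let S : 𝓢(Vec d, ℂ) := 𝓕⁻ G
  have hFS : 𝓕 S = G := FourierTransform.fourier_fourierInv_eq G
  have hFS' : ∀ x, 𝓕 (S : Vec d → ℂ) x = g x := fun x => by
    rw [← SchwartzMap.fourier_coe, hFS, hG]
  have hSg : ∫ ξ, ‖S ξ‖ ^ 2 = ∫ x, g x ^ 2 := by
    rw [← SchwartzMap.integral_norm_sq_fourier S, hFS]
    refine integral_congr_ae (Eventually.of_forall fun x => ?_)
    simp [hG]
  have hg0 : 0 ≤ ∫ x, g x ^ 2 := integral_nonneg fun _ => sq_nonneg _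
  let F : Fin d → Vec d → ℂ := fun j ξ => liftMultiplier a j ξ * S ξ
  have hF := fun j => multiplier_integrable (measurable_liftMultiplier a j)
    (norm_liftMultiplier_le a j) S
  have hm' : ∀ j k : Fin d, Measurable fun ξ : Vec d =>
      -(2 * Real.pi * Complex.I * (ξ k : ℝ)) * liftMultiplier a j ξ := fun j k => by
    have : Continuous fun ξ : Vec d => -(2 * Real.pi * Complex.I * ((ξ k : ℝ) : ℂ)) := by fun_prop
    exact this.measurable.mul (measurable_liftMultiplier a j)
  have hF' := fun j k => multiplier_integrable (hm' j k) (norm_mul_liftMultiplier_le a j k) S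
  have hF1 : ∀ j, Integrable fun ξ => ‖ξ‖ * ‖F j ξ‖ := fun j => by
    simpa only [pow_one] using (hF j).1 1
  have hpd : ∀ j k x, partialDeriv k (fun y => (𝓕 (F j) y).re) x =
      (𝓕 (fun ξ => -(2 * Real.pi * Complex.I * (ξ k : ℝ)) * liftMultiplier a j ξ * S ξ) x).re :=
    fun j k x => by
      rw [partialDeriv_re_fourier (hF j).2.1 (hF1 j)]
      simp only [mul_assoc]
  -- Taking real parts makes it unnecessary to show that the transforms are real.
  refine ⟨fun j x => (𝓕 (F j) x).re, fun j => ?_, fun x hx => ?_, fun j => ?_, fun j k => ?_⟩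
  · have : ContDiff ℝ ((1 : ℕ∞) : WithTop ℕ∞) (𝓕 (F j)) :=
      Real.contDiff_fourier fun n _ => (hF j).1 n
    exact Complex.reCLM.contDiff.comp this
  · simp only [hpd]
    rw [← Complex.re_sum]
    have hsum : ∑ j, 𝓕 (fun ξ => -(2 * Real.pi * Complex.I * (ξ j : ℝ)) *
        liftMultiplier a j ξ * S ξ) x = g x - g (x + a) := by
      simp only [Real.fourier_eq']
      rw [← integral_finsetSum]
      · have e : ∀ y, 𝓕 (S : Vec d → ℂ) y = ∫ ξ, Complex.exp (((-2 * Real.pi *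
            inner ℝ ξ y : ℝ) : ℂ) * Complex.I) • S ξ := fun y => Real.fourier_eq' _ _
        have hi : ∀ y, Integrable fun ξ => Complex.exp (((-2 * Real.pi *
            inner ℝ ξ y : ℝ) : ℂ) * Complex.I) • S ξ := fun y => by
          have := (Real.fourierIntegral_convergent_iff (μ := volume) (f := (S : Vec d → ℂ)) y).2
            S.integrable
          refine this.congr (Eventually.of_forall fun ξ => ?_)
          simp only [Circle.smul_def, Real.fourierChar_apply, mul_neg, neg_mul]
        rw [← hFS' x, ← hFS' (x + a), e, e, ← integral_sub (hi _) (hi _)]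
        refine integral_congr_ae ?_
        have h0 : ∀ᵐ ξ : Vec d, ξ ≠ 0 := by
          have : Nonempty (Fin d) := ⟨⟨0, hd⟩⟩
          exact Measure.ae_ne volume 0
        filter_upwards [h0] with ξ hξ
        rw [← Finset.smul_sum, ← Finset.sum_mul, sum_mul_liftMultiplier a hξ, inner_add_right]
        simp only [smul_eq_mul, mul_add, Complex.ofReal_add, add_mul, Complex.exp_add]
        ring_nf
      · intro j _
        have := (Real.fourierIntegral_convergent_iff (μ := volume) x).2 (hF' j j).2.1
        refine this.congr (Eventually.of_forall fun ξ => ?_)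
        simp only [Circle.smul_def, Real.fourierChar_apply, mul_neg, neg_mul]
    rw [hsum]
    have hz : g (x + a) = 0 := by
      refine image_eq_zero_of_notMem_tsupport fun h => ?_
      have h1 := mem_closedBall_zero_iff.1 (hgs h)
      have h2 := mem_closedBall_zero_iff.1 hx
      have h3 : ‖a‖ ≤ ‖x + a‖ + ‖x‖ := by
        have := norm_sub_le (x + a) x
        simpa using this
      linarith
    simp [hz]
  · have h := fourier_memLp_two (hF j).2.1 (hF j).2.2.1
    refine ⟨(re_memLp_two h.1).1, (re_memLp_two h.1).2.trans ?_⟩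
    rw [h.2]
    refine (hF j).2.2.2.trans ?_
    rw [hSg]
    gcongr
    exact le_add_of_nonneg_right (by norm_num)
  · have h := fourier_memLp_two (hF' j k).2.1 (hF' j k).2.2.1
    have he : partialDeriv k (fun y => (𝓕 (F j) y).re) = fun x => (𝓕 (fun ξ =>
      -(2 * Real.pi * Complex.I * (ξ k : ℝ)) * liftMultiplier a j ξ * S ξ) x).re :=
      funext fun x => hpd j k x
    rw [he]
    refine ⟨(re_memLp_two h.1).1, (re_memLp_two h.1).2.trans ?_⟩
    rw [h.2]
    refine (hF' j k).2.2.2.trans ?_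
    rw [hSg]
    gcongr
    exact le_add_of_nonneg_left (by positivity)

end Fourier

/-! ### The divergence theorem on a corner simplex. -/

section Cone
open scoped Pointwise
variable {ι : Type*} [Fintype ι]

/-- The corner simplex `{t | 0 ≤ t, ∑ tᵢ ≤ 1}`. -/
def cornerSimplex (ι : Type*) [Fintype ι] : Set (ι → ℝ) := {t | (∀ i, 0 ≤ t i) ∧ ∑ i, t i ≤ 1}

/-- The radial projection onto the face `∑ tᵢ = 1` of the corner simplex. -/
def radialProj (t : ι → ℝ) : ι → ℝ := (∑ i, t i)⁻¹ • t

lemma isClosed_cornerSimplex : IsClosed (cornerSimplex ι) := by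
  have : cornerSimplex ι = (⋂ i, {t | 0 ≤ t i}) ∩ {t | ∑ i, t i ≤ 1} := by
    ext t; simp [cornerSimplex]
  rw [this]
  exact (isClosed_iInter fun i => isClosed_le continuous_const (continuous_apply i)).inter
    (isClosed_le (by fun_prop) continuous_const)

lemma isCompact_cornerSimplex : IsCompact (cornerSimplex ι) := by
  refine (isCompact_Icc (a := (0 : ι → ℝ)) (b := 1)).of_isClosed_subset isClosed_cornerSimplex
    fun t ht => ⟨ht.1, fun i => ?_⟩
  exact (Finset.single_le_sum (fun j _ => ht.1 j) (Finset.mem_univ i)).trans ht.2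

lemma measurableSet_cornerSimplex : MeasurableSet (cornerSimplex ι) :=
  isClosed_cornerSimplex.measurableSet

lemma volume_cornerSimplex_lt_top : volume (cornerSimplex ι) < ⊤ :=
  isCompact_cornerSimplex.measure_lt_top

lemma volume_cornerSimplex_pos : 0 < volume (cornerSimplex ι) := by
  rcases isEmpty_or_nonempty ι with h | h
  · have : cornerSimplex ι = Set.univ := by
      ext t; simp [cornerSimplex]
    rw [this]
    exact (isOpen_univ.measure_pos_iff volume).2 Set.univ_nonempty
  have hc : (0 : ℝ) < Fintype.card ι := by exact_mod_cast Fintype.card_pos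
  have hsub : Set.pi Set.univ (fun _ : ι => Set.Ioo (0 : ℝ) (Fintype.card ι : ℝ)⁻¹) ⊆
      cornerSimplex ι := by
    intro t ht
    refine ⟨fun i => (ht i trivial).1.le, ?_⟩
    calc ∑ i, t i ≤ ∑ _i : ι, (Fintype.card ι : ℝ)⁻¹ :=
          Finset.sum_le_sum fun i _ => (ht i trivial).2.le
      _ = 1 := by simp [hc.ne']
  refine lt_of_lt_of_le ?_ (measure_mono hsub)
  refine ((isOpen_set_pi Set.finite_univ fun _ _ => isOpen_Ioo).measure_pos_iff volume).2 ?_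
  rw [Set.univ_pi_nonempty_iff]
  exact fun _ => Set.nonempty_Ioo.2 (by positivity)

lemma mem_smul_cornerSimplex_iff {r : ℝ} (hr : 0 < r) {t : ι → ℝ} :
    t ∈ r • cornerSimplex ι ↔ (∀ i, 0 ≤ t i) ∧ ∑ i, t i ≤ r := by
  rw [Set.mem_smul_set_iff_inv_smul_mem₀ hr.ne']
  simp only [cornerSimplex, Set.mem_ofPred_eq, Pi.smul_apply, smul_eq_mul, ← Finset.mul_sum]
  refine and_congr (forall_congr' fun i => ?_) ?_
  · exact ⟨fun h => (mul_nonneg_iff_of_pos_left (inv_pos.2 hr)).1 h, fun h => by positivity⟩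
  · rw [inv_mul_le_iff₀ hr, mul_one]

lemma radialProj_smul {r : ℝ} (hr : 0 < r) (t : ι → ℝ) : radialProj (r • t) = radialProj t := by
  simp only [radialProj, Pi.smul_apply, smul_eq_mul, ← Finset.mul_sum, smul_smul]
  congr 1
  rw [mul_inv, mul_comm, ← mul_assoc, mul_inv_cancel₀ hr.ne', one_mul]

lemma measurable_radialProj : Measurable (radialProj : (ι → ℝ) → ι → ℝ) := by
  unfold radialProj
  have : Measurable fun t : ι → ℝ => ∑ i, t i := (by fun_prop : Continuous _).measurable
  exact this.inv.smul measurable_id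

lemma radialProj_mem {t : ι → ℝ} (ht : ∀ i, 0 ≤ t i) : radialProj t ∈ cornerSimplex ι := by
  have hs : 0 ≤ ∑ i, t i := Finset.sum_nonneg fun i _ => ht i
  refine ⟨fun i => mul_nonneg (inv_nonneg.2 hs) (ht i), ?_⟩
  simp only [radialProj, Pi.smul_apply, smul_eq_mul, ← Finset.mul_sum]
  exact inv_mul_le_one

lemma integrableOn_comp_radialProj {ψ : (ι → ℝ) → ℝ} (hψ : Continuous ψ) {A : Set (ι → ℝ)}
    (hA : ∀ t ∈ A, ∀ i, 0 ≤ t i) (hAm : MeasurableSet A) (hAf : volume A < ⊤) :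
    IntegrableOn (fun t => ψ (radialProj t)) A := by
  obtain ⟨M, hM⟩ := isCompact_cornerSimplex.exists_bound_of_continuousOn
    (f := ψ) hψ.continuousOn
  exact IntegrableOn.of_bound hAf
    (hψ.measurable.comp measurable_radialProj).aestronglyMeasurable M
    ((ae_restrict_iff' hAm).2 (Eventually.of_forall fun t ht => hM _ (radialProj_mem (hA t ht))))

/-- The divergence theorem on the corner simplex, seen as a cone with vertex `0`. -/
theorem integral_cornerSimplex_cone {ψ : (ι → ℝ) → ℝ} (hψ : ContDiff ℝ 1 ψ) :
    ∫ t in cornerSimplex ι, (Fintype.card ι * ψ t + fderiv ℝ ψ t t) =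
      Fintype.card ι * ∫ t in cornerSimplex ι, ψ (radialProj t) := by
  set S := cornerSimplex ι with hS
  set n := Fintype.card ι with hn
  set H := ∫ t in S, ψ (radialProj t) with hH
  set J : ℝ → ℝ := fun r => ∫ t in S, ψ (r • t) with hJ
  have hint : ∀ {f : (ι → ℝ) → ℝ}, Continuous f → IntegrableOn f S := fun hf =>
    hf.continuousOn.integrableOn_compact isCompact_cornerSimplex
  have hfd : Continuous (fderiv ℝ ψ) := hψ.continuous_fderiv one_ne_zero
  have hJ' : HasDerivAt J (∫ t in S, fderiv ℝ ψ t t) 1 := by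
    have hcont : Continuous fun p : ℝ × (ι → ℝ) => fderiv ℝ ψ (p.1 • p.2) p.2 := by
      exact (hfd.comp (continuous_fst.smul continuous_snd)).clm_apply continuous_snd
    obtain ⟨M, hM⟩ := ((isCompact_closedBall (1 : ℝ) 1).prod
      (isCompact_cornerSimplex (ι := ι))).exists_bound_of_continuousOn hcont.continuousOn
    have := (hasDerivAt_integral_of_dominated_loc_of_deriv_le (μ := volume.restrict S)
      (F := fun r t => ψ (r • t)) (F' := fun r t => fderiv ℝ ψ (r • t) t) (x₀ := (1 : ℝ))
      (bound := fun _ => M) (Metric.closedBall_mem_nhds (1 : ℝ) one_pos) ?_ ?_ ?_ ?_ ?_ ?_).2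
    · simpa using this
    · exact Eventually.of_forall fun r =>
        (hψ.continuous.comp (continuous_const_smul r)).aestronglyMeasurable
    · exact hint (hψ.continuous.comp (continuous_const_smul (1 : ℝ)))
    · exact (hcont.comp (Continuous.prodMk_right (1 : ℝ))).aestronglyMeasurable
    · refine (ae_restrict_iff' measurableSet_cornerSimplex).2 (Eventually.of_forall fun t ht r hr => ?_)
      exact hM (r, t) ⟨hr, ht⟩
    · exact integrableOn_const volume_cornerSimplex_lt_top.ne
    · refine Eventually.of_forall fun t r _ => ?_
      have h1 : HasDerivAt (fun r : ℝ => r • t) t r := by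
        simpa using (hasDerivAt_id r).smul_const t
      exact ((hψ.differentiable one_ne_zero (r • t)).hasFDerivAt).comp_hasDerivAt r h1
  -- `D r` is the integral of `ψ - ψ ∘ radialProj` over `r • S`. The product rule gives its
  -- derivative at `1`; the thin shell `r • S \ S` shows that this derivative is zero. Comparing the
  -- two gives the identity.
  set D : ℝ → ℝ := fun r => r ^ n * (J r - H) with hD
  have hD' : HasDerivAt D (n * (J 1 - H) + ∫ t in S, fderiv ℝ ψ t t) 1 := by
    have := (hasDerivAt_pow n (1 : ℝ)).mul (hJ'.sub_const H)
    simp only [one_pow, mul_one, one_mul] at this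
    exact this
  have hDint : ∀ r : ℝ, 0 < r → D r = ∫ t in r • S, (ψ t - ψ (radialProj t)) := by
    intro r hr
    have h1 := Measure.setIntegral_comp_smul_of_pos volume
      (fun t => ψ t - ψ (radialProj t)) S hr
    simp only [radialProj_smul hr, Module.finrank_fintype_fun_eq_card, ← hn, smul_eq_mul] at h1
    have hc : Continuous fun t : ι → ℝ => ψ (r • t) := hψ.continuous.comp (continuous_const_smul r)
    rw [integral_sub (hint hc)
      (integrableOn_comp_radialProj hψ.continuous (fun t ht => ht.1) measurableSet_cornerSimplex
        volume_cornerSimplex_lt_top)] at h1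
    rw [hD]
    change r ^ n * ((∫ t in S, ψ (r • t)) - H) = _
    rw [h1, ← mul_assoc, mul_inv_cancel₀ (by positivity), one_mul]
  obtain ⟨L, hL⟩ := (hψ.locallyLipschitz.locallyLipschitzOn (s := (2 : ℝ) • S)
    ).exists_lipschitzOnWith_of_compact (isCompact_cornerSimplex.smul (2 : ℝ))
  have hbound : ∀ r ∈ Set.Ioo (1 : ℝ) 2,
      ‖slope D 1 r‖ ≤ L * (r ^ n - 1) * volume.real S := by
    intro r hr
    have hr0 : 0 < r := by linarith [hr.1]
    have hSr : S ⊆ r • S := fun t ht =>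
      (mem_smul_cornerSimplex_iff hr0).2 ⟨ht.1, ht.2.trans hr.1.le⟩
    have hrm : MeasurableSet (r • S) := (isCompact_cornerSimplex.smul r).isClosed.measurableSet
    have hrf : volume (r • S) < ⊤ := (isCompact_cornerSimplex.smul r).measure_lt_top
    have hi : IntegrableOn (fun t => ψ t - ψ (radialProj t)) (r • S) := by
      refine Integrable.sub
        (hψ.continuous.continuousOn.integrableOn_compact (isCompact_cornerSimplex.smul r)) ?_
      exact integrableOn_comp_radialProj hψ.continuous
        (fun t ht => ((mem_smul_cornerSimplex_iff hr0).1 ht).1) hrm hrf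
    have hD1 : D 1 = ∫ t in S, (ψ t - ψ (radialProj t)) := by
      simpa using hDint 1 one_pos
    have hdiff : D r - D 1 = ∫ t in r • S \ S, (ψ t - ψ (radialProj t)) := by
      rw [hDint r hr0, hD1, setIntegral_sdiff measurableSet_cornerSimplex hi hSr]
    -- On the shell a point is within `r - 1` of its projection. The integrand and the volume of the
    -- shell are then both of first order in `r - 1`, and the difference quotient tends to zero.
    have hpt : ∀ t ∈ r • S \ S, ‖ψ t - ψ (radialProj t)‖ ≤ L * (r - 1) := by
      intro t ht
      have ht1 := (mem_smul_cornerSimplex_iff hr0).1 ht.1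
      have ht2 : 1 < ∑ i, t i := by
        by_contra h
        exact ht.2 ⟨ht1.1, not_lt.1 h⟩
      have hs : 0 < ∑ i, t i := one_pos.trans ht2
      have hmem : t ∈ (2 : ℝ) • S :=
        (mem_smul_cornerSimplex_iff two_pos).2 ⟨ht1.1, ht1.2.trans hr.2.le⟩
      have hp := radialProj_mem ht1.1
      have hmem' : radialProj t ∈ (2 : ℝ) • S :=
        (mem_smul_cornerSimplex_iff two_pos).2 ⟨hp.1, hp.2.trans one_le_two⟩
      have h1 := hL.dist_le_mul t hmem _ hmem'
      rw [Real.dist_eq] at h1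
      refine h1.trans (mul_le_mul_of_nonneg_left ?_ L.2)
      refine (dist_pi_le_iff (by linarith [hr.1])).2 fun i => ?_
      have hti : t i ≤ ∑ i, t i := Finset.single_le_sum (fun j _ => ht1.1 j) (Finset.mem_univ i)
      have e : t i - (∑ i, t i)⁻¹ * t i = (∑ i, t i - 1) * (t i / ∑ i, t i) := by
        field_simp
      rw [Real.dist_eq, radialProj, Pi.smul_apply, smul_eq_mul, e, abs_of_nonneg]
      · have : t i / ∑ i, t i ≤ 1 := (div_le_one hs).2 hti
        have h3 : 0 ≤ ∑ i, t i - 1 := by linarith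
        nlinarith [ht1.2]
      · exact mul_nonneg (by linarith) (div_nonneg (ht1.1 i) hs.le)
    have hvol : volume.real (r • S \ S) = (r ^ n - 1) * volume.real S := by
      rw [measureReal_sdiff hSr measurableSet_cornerSimplex]
      have : volume.real (r • S) = r ^ n * volume.real S := by
        rw [Measure.real, Measure.addHaar_smul_of_nonneg _ hr0.le,
          Module.finrank_fintype_fun_eq_card, ENNReal.toReal_mul,
          ENNReal.toReal_ofReal (by positivity)]
        rfl
      rw [this]
      ring
    have h2 := norm_setIntegral_le_of_norm_le_const (μ := volume)
      ((measure_mono Set.sdiff_subset).trans_lt hrf) hpt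
    rw [← hdiff, hvol] at h2
    rw [slope_def_field, norm_div, div_le_iff₀ (by rw [Real.norm_eq_abs, abs_pos]; linarith [hr.1]),
      Real.norm_eq_abs (r - 1), abs_of_pos (by linarith [hr.1])]
    calc _ ≤ _ := h2
      _ = _ := by ring
  have hlim : Tendsto (slope D 1) (𝓝[>] 1) (𝓝 (n * (J 1 - H) + ∫ t in S, fderiv ℝ ψ t t)) :=
    (hasDerivAt_iff_tendsto_slope.1 hD').mono_left
      (nhdsWithin_mono _ fun x hx => ne_of_gt hx)
  have hlim0 : Tendsto (slope D 1) (𝓝[>] 1) (𝓝 0) := by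
    refine squeeze_zero_norm' (a := fun r => L * (r ^ n - 1) * volume.real S) ?_ ?_
    · filter_upwards [Ioo_mem_nhdsGT (one_lt_two : (1 : ℝ) < 2)] with r hr using hbound r hr
    · have : Continuous fun r : ℝ => L * (r ^ n - 1) * volume.real S := by fun_prop
      have h := (this.tendsto 1).mono_left (nhdsWithin_le_nhds (s := Set.Ioi 1))
      simpa using h
  have hfin := tendsto_nhds_unique hlim hlim0
  have hJ1 : J 1 = ∫ t in S, ψ t := by simp [hJ]
  have hc : Continuous fun t : ι → ℝ => fderiv ℝ ψ t t := hfd.clm_apply continuous_id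
  rw [integral_add ((hint hψ.continuous).const_mul _) (hint hc),
    integral_const_mul, ← hJ1]
  linear_combination hfin

end Cone

/-! ### Cells as affine images of the corner simplex. -/

section Cell
variable {d : ℕ} {s : Finset (Vec d)} {x : Vec d}

/-- The edges issuing from `x` form a basis. In these coordinates `x` is the origin and the opposite
face is the set `∑ t = 1`. -/
lemma exists_cellEquiv (hi : AffineIndependent ℝ ((↑) : s → Vec d)) (hc : s.card = d + 1)
    (hx : x ∈ s) : ∃ e : (↥(s.erase x) → ℝ) ≃L[ℝ] Vec d,
      ∀ t, e t = ∑ y, t y • ((y : Vec d) - x) := by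
  have hli : LinearIndependent ℝ fun y : ↥(s.erase x) => (y : Vec d) - x := by
    have h := (affineIndependent_iff_linearIndependent_vsub ℝ _ (⟨x, hx⟩ : s)).1 hi
    exact h.comp (fun y : ↥(s.erase x) =>
      ⟨⟨y, Finset.mem_of_mem_erase y.2⟩, fun h' => Finset.ne_of_mem_erase y.2
        (congrArg Subtype.val h')⟩) fun y z h' => by
          have := congrArg (fun u => ((u : {i : s // i ≠ ⟨x, hx⟩}) : s).1) h'
          exact Subtype.ext this
  have hcard : Fintype.card ↥(s.erase x) = Module.finrank ℝ (Vec d) := by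
    rw [Fintype.card_coe, Finset.card_erase_of_mem hx, hc, finrank_euclideanSpace_fin]
    rfl
  have hspan := (linearIndependent_iff_card_eq_finrank_span.1 hli)
  let b : Module.Basis ↥(s.erase x) ℝ (Vec d) := Module.Basis.mk hli
    (le_of_eq ((hli.span_eq_top_of_card_eq_finrank' hcard).symm))
  refine ⟨b.equivFun.symm.toContinuousLinearEquiv, fun t => ?_⟩
  change b.equivFun.symm t = _
  rw [Module.Basis.equivFun_symm_apply]
  simp [b]

lemma card_erase_eq (hc : s.card = d + 1) (hx : x ∈ s) : (s.erase x).card = d := by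
  rw [Finset.card_erase_of_mem hx, hc]; rfl

/-- The weight at `x` is what the other weights leave over, so `∑ w = 1` turns into `∑ t ≤ 1`. -/
lemma convexHull_eq_image (hx : x ∈ s) : convexHull ℝ (s : Set (Vec d)) =
    (fun t : ↥(s.erase x) → ℝ => x + ∑ y, t y • ((y : Vec d) - x)) ''
      cornerSimplex ↥(s.erase x) := by
  ext p
  simp only [Set.mem_image]
  constructor
  · intro hp
    obtain ⟨w, hw0, hw1, hwp⟩ := Finset.mem_convexHull'.1 hp
    refine ⟨fun y => w y, ⟨fun y => hw0 y (Finset.mem_of_mem_erase y.2), ?_⟩, ?_⟩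
    · rw [Finset.sum_coe_sort (s.erase x) w]
      rw [← Finset.add_sum_erase s w hx] at hw1
      linarith [hw0 x hx]
    · rw [Finset.sum_coe_sort (s.erase x) fun y => w y • (y - x)]
      simp only [smul_sub, Finset.sum_sub_distrib, ← Finset.sum_smul]
      rw [← Finset.add_sum_erase s w hx] at hw1
      rw [← Finset.add_sum_erase s _ hx] at hwp
      have hwx : w x = 1 - ∑ y ∈ s.erase x, w y := by linarith
      rw [← hwp, hwx]
      module
  · rintro ⟨t, ⟨ht0, ht1⟩, rfl⟩
    have hcv := convex_convexHull ℝ (s : Set (Vec d))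
    have hxm : x ∈ convexHull ℝ (s : Set (Vec d)) := subset_convexHull ℝ _ hx
    have e : x + ∑ y, t y • ((y : Vec d) - x) =
        (1 - ∑ y, t y) • x + (∑ y, t y • (y : Vec d)) := by
      simp only [smul_sub, Finset.sum_sub_distrib, ← Finset.sum_smul]
      module
    rw [e]
    have hw : ∑ o : Option ↥(s.erase x), o.elim (1 - ∑ y, t y) t •
        o.elim x (fun y => (y : Vec d)) = (1 - ∑ y, t y) • x + (∑ y, t y • (y : Vec d)) := by
      rw [Fintype.sum_option]; rfl
    rw [← hw]
    refine hcv.sum_mem ?_ ?_ ?_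
    · rintro (_ | y) _
      · simpa using ht1
      · exact ht0 y
    · rw [Fintype.sum_option]; simp
    · rintro (_ | y) _
      · exact hxm
      · exact subset_convexHull ℝ _ (Finset.mem_of_mem_erase y.2)

/-- Change of variables from the corner simplex to a cell. -/
lemma exists_setIntegral_cell (hi : AffineIndependent ℝ ((↑) : s → Vec d))
    (hc : s.card = d + 1) (hx : x ∈ s) : ∃ c : ℝ, 0 < c ∧ ∀ g : Vec d → ℝ,
      ∫ t in cornerSimplex ↥(s.erase x), g (x + ∑ y, t y • ((y : Vec d) - x)) =
        c * ∫ z in convexHull ℝ (s : Set (Vec d)), g z := by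
  obtain ⟨e, he⟩ := exists_cellEquiv hi hc hx
  have hmap : (volume.map e).IsAddHaarMeasure := e.isAddHaarMeasure_map volume
  -- The constant is the ratio of two Haar measures. Its value as an inverse determinant never
  -- matters, since every later identity is homogeneous in it.
  have hsm := Measure.isAddLeftInvariant_eq_smul (volume.map e) (volume : Measure (Vec d))
  set c := Measure.addHaarScalarFactor (volume.map e) (volume : Measure (Vec d)) with hcdef
  have hcpos : 0 < c := Measure.addHaarScalarFactor_pos_of_isAddHaarMeasure _ _
  refine ⟨c, hcpos, fun g => ?_⟩
  have hemb : MeasurableEmbedding e := e.toHomeomorph.measurableEmbedding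
  have hte : MeasurableEmbedding (fun z : Vec d => x + z) :=
    (Homeomorph.addLeft x).measurableEmbedding
  have hmp : MeasurePreserving (fun z : Vec d => x + z) volume volume :=
    measurePreserving_add_left volume x
  have him : convexHull ℝ (s : Set (Vec d)) =
      (fun z => x + z) '' (e '' cornerSimplex ↥(s.erase x)) := by
    rw [convexHull_eq_image hx, Set.image_image]
    simp only [he]
  rw [him, hmp.setIntegral_image_emb hte]
  simp only [← he]
  have h1 := hemb.setIntegral_map (μ := volume) (fun z => g (x + z))
    (e '' cornerSimplex ↥(s.erase x))
  rw [Set.preimage_image_eq _ e.injective, hsm, Measure.restrict_smul, integral_smul_nnreal_measure]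
    at h1
  rw [← h1]
  rfl

lemma isCompact_cell (s : Finset (Vec d)) : IsCompact (convexHull ℝ (s : Set (Vec d))) :=
  s.finite_toSet.isCompact_convexHull (𝕜 := ℝ)

lemma measurableSet_cell (s : Finset (Vec d)) :
    MeasurableSet (convexHull ℝ (s : Set (Vec d))) := (isCompact_cell s).isClosed.measurableSet

lemma volume_cell_pos (hi : AffineIndependent ℝ ((↑) : s → Vec d))
    (hc : s.card = d + 1) : 0 < volume.real (convexHull ℝ (s : Set (Vec d))) := by
  obtain ⟨x, hx⟩ : s.Nonempty := Finset.card_pos.1 (by omega)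
  obtain ⟨c, hc0, h⟩ := exists_setIntegral_cell hi hc hx
  have h1 := h fun _ => 1
  simp only [integral_const, smul_eq_mul, mul_one, measureReal_restrict_apply_univ] at h1
  have : 0 < volume.real (cornerSimplex ↥(s.erase x)) :=
    ENNReal.toReal_pos volume_cornerSimplex_pos.ne' volume_cornerSimplex_lt_top.ne
  rw [h1] at this
  exact (mul_pos_iff_of_pos_left hc0).1 this

end Cell

/-! ### Means over faces and the divergence theorem on a cell. -/

section FaceMean
variable {d : ℕ}

/-- The point of the face spanned by `F` with (not normalised) barycentric coordinates `t`. -/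
def facePoint (F : Finset (Vec d)) (t : F → ℝ) : Vec d := ∑ y : F, radialProj t y • (y : Vec d)

/-- The mean value of `φ` over the face with vertices `F`. -/
def faceMean (F : Finset (Vec d)) (φ : Vec d → ℝ) : ℝ :=
  ⨍ t in cornerSimplex F, φ (facePoint F t)

lemma faceMean_eq (F : Finset (Vec d)) (φ : Vec d → ℝ) : faceMean F φ =
    (volume.real (cornerSimplex F))⁻¹ * ∫ t in cornerSimplex F, φ (facePoint F t) :=
  setAverage_eq _ _ _

lemma volume_real_cornerSimplex_pos (F : Finset (Vec d)) : 0 < volume.real (cornerSimplex F) :=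
  ENNReal.toReal_pos volume_cornerSimplex_pos.ne' volume_cornerSimplex_lt_top.ne

lemma integrableOn_facePoint (F : Finset (Vec d)) {φ : Vec d → ℝ} (hφ : Continuous φ) :
    IntegrableOn (fun t => φ (facePoint F t)) (cornerSimplex F) := by
  have : Continuous fun r : F → ℝ => φ (∑ y : F, r y • (y : Vec d)) := by fun_prop
  exact integrableOn_comp_radialProj this (fun t ht => ht.1) measurableSet_cornerSimplex
    volume_cornerSimplex_lt_top

/-- Parameters with a vanishing coordinate form a null set, so only the relative interior of the
face counts. -/
lemma faceMean_congr {F : Finset (Vec d)} {φ ψ : Vec d → ℝ}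
    (h : ∀ t ∈ cornerSimplex F, (∀ y, 0 < t y) → φ (facePoint F t) = ψ (facePoint F t)) :
    faceMean F φ = faceMean F ψ := by
  rw [faceMean_eq, faceMean_eq]
  congr 1
  refine setIntegral_congr_ae measurableSet_cornerSimplex ?_
  have h0 : ∀ᵐ t : F → ℝ, ∀ y, t y ≠ 0 := by
    rw [ae_all_iff]
    intro y
    have := Measure.pi_hyperplane (fun _ : F => (volume : Measure ℝ)) y 0
    exact measure_eq_zero_iff_ae_notMem.1 this
  filter_upwards [h0] with t ht0 ht
  exact h t ht fun y => lt_of_le_of_ne (ht.1 y) (ht0 y).symm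

lemma faceMean_sub_mul_add (F : Finset (Vec d)) {φ : Vec d → ℝ} (hφ : Continuous φ) (m : ℝ) :
    faceMean F (fun z => (φ z - m) ^ 2) =
      faceMean F (fun z => φ z ^ 2) - 2 * m * faceMean F φ + m ^ 2 := by
  simp only [faceMean_eq]
  have h1 := integrableOn_facePoint F hφ
  have h2 : IntegrableOn (fun t => φ (facePoint F t) ^ 2) (cornerSimplex F) :=
    integrableOn_facePoint F (hφ.pow 2)
  have hv := volume_real_cornerSimplex_pos F
  have e : ∀ t : F → ℝ, (φ (facePoint F t) - m) ^ 2 =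
      φ (facePoint F t) ^ 2 - 2 * m * φ (facePoint F t) + m ^ 2 := fun t => by ring
  simp_rw [e]
  have h3 : IntegrableOn (fun t => φ (facePoint F t) ^ 2 - 2 * m * φ (facePoint F t))
    (cornerSimplex F) := h2.sub (h1.const_mul _)
  rw [integral_add h3 (integrableOn_const volume_cornerSimplex_lt_top.ne),
    integral_sub h2 (h1.const_mul _), integral_const_mul, integral_const]
  simp only [smul_eq_mul, measureReal_restrict_apply_univ]
  field_simp

lemma faceMean_nonneg (F : Finset (Vec d)) {φ : Vec d → ℝ} (hφ : ∀ z, 0 ≤ φ z) :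
    0 ≤ faceMean F φ := by
  rw [faceMean_eq]
  exact mul_nonneg (inv_nonneg.2 measureReal_nonneg) (integral_nonneg fun _ => hφ _)

/-- Jensen's inequality, from the non-negativity of the variance. -/
lemma sq_faceMean_le (F : Finset (Vec d)) {φ : Vec d → ℝ} (hφ : Continuous φ) :
    faceMean F φ ^ 2 ≤ faceMean F fun z => φ z ^ 2 := by
  have h := faceMean_nonneg F (φ := fun z => (φ z - faceMean F φ) ^ 2) fun _ => sq_nonneg _
  rw [faceMean_sub_mul_add F hφ] at h
  linarith [h, sq (faceMean F φ)]

lemma sum_radialProj {F : Finset (Vec d)} {t : F → ℝ} (ht : ∑ y, t y ≠ 0) :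
    ∑ y, radialProj t y = 1 := by
  simp only [radialProj, Pi.smul_apply, smul_eq_mul, ← Finset.mul_sum]
  exact inv_mul_cancel₀ ht

lemma sum_pos_of_forall_pos {F : Finset (Vec d)} (hF : F.Nonempty) {t : F → ℝ}
    (ht : ∀ y, 0 < t y) : 0 < ∑ y, t y :=
  Finset.sum_pos (fun y _ => ht y) ⟨⟨_, hF.choose_spec⟩, Finset.mem_univ _⟩

lemma facePoint_mem {F : Finset (Vec d)} (hF : F.Nonempty) {t : F → ℝ} (ht : ∀ y, 0 < t y) :
    facePoint F t ∈ convexHull ℝ (F : Set (Vec d)) := by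
  refine (convex_convexHull ℝ _).sum_mem
    (fun y _ => (radialProj_mem fun y => (ht y).le).1 y)
    (sum_radialProj (sum_pos_of_forall_pos hF ht).ne') fun y _ => subset_convexHull ℝ _ y.2

/-- The divergence theorem on a cell, seen as a cone over the face opposite to `x`. -/
theorem integral_cell_cone (hd : 1 ≤ d) {s : Finset (Vec d)} {x : Vec d}
    (hi : AffineIndependent ℝ ((↑) : s → Vec d)) (hc : s.card = d + 1) (hx : x ∈ s)
    {φ : Vec d → ℝ} (hφ : ContDiff ℝ 1 φ) :
    ∫ z in convexHull ℝ (s : Set (Vec d)), (d * φ z + fderiv ℝ φ z (z - x)) =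
      d * volume.real (convexHull ℝ (s : Set (Vec d))) * faceMean (s.erase x) φ := by
  obtain ⟨c, hc0, hcv⟩ := exists_setIntegral_cell hi hc hx
  obtain ⟨e, he⟩ := exists_cellEquiv hi hc hx
  have hcard : Fintype.card ↥(s.erase x) = d := by rw [Fintype.card_coe, card_erase_eq hc hx]
  have hne : (s.erase x).Nonempty := Finset.card_pos.1 (by rw [card_erase_eq hc hx]; exact hd)
  have hψ : ContDiff ℝ 1 fun t => φ (x + e t) :=
    hφ.comp (contDiff_const.add e.contDiff)
  have hcone := integral_cornerSimplex_cone hψ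
  rw [hcard] at hcone
  have hder : ∀ t, fderiv ℝ (fun t => φ (x + e t)) t t = fderiv ℝ φ (x + e t) (e t) := by
    intro t
    have h1 : HasFDerivAt (fun t => x + e t) (e : (↥(s.erase x) → ℝ) →L[ℝ] Vec d) t :=
      e.hasFDerivAt.const_add x
    have h2 := (hφ.differentiable one_ne_zero (x + e t)).hasFDerivAt.comp t h1
    have h3 : fderiv ℝ (fun t => φ (x + e t)) t = _ := h2.fderiv
    rw [h3]
    rfl
  simp only [hder] at hcone
  have h1 := hcv fun z => d * φ z + fderiv ℝ φ z (z - x)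
  simp only [← he, add_sub_cancel_left] at h1
  have h2 := hcv fun _ => 1
  simp only [integral_const, smul_eq_mul, mul_one, measureReal_restrict_apply_univ] at h2
  -- For weights `ρ` of sum one, `x + ∑ ρ y • (y - x) = ∑ ρ y • y`: in the chart of the cell the
  -- radial projection is `facePoint`.
  have h3 : ∫ t in cornerSimplex ↥(s.erase x), φ (x + e (radialProj t)) =
      volume.real (cornerSimplex ↥(s.erase x)) * faceMean (s.erase x) φ := by
    have : faceMean (s.erase x) φ = (volume.real (cornerSimplex ↥(s.erase x)))⁻¹ *
        ∫ t in cornerSimplex ↥(s.erase x), φ (x + e (radialProj t)) := by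
      rw [faceMean_eq]
      congr 1
      refine setIntegral_congr_ae measurableSet_cornerSimplex ?_
      have h0 : ∀ᵐ t : ↥(s.erase x) → ℝ, ∀ y, t y ≠ 0 := by
        rw [ae_all_iff]
        intro y
        exact measure_eq_zero_iff_ae_notMem.1
          (Measure.pi_hyperplane (fun _ : ↥(s.erase x) => (volume : Measure ℝ)) y 0)
      filter_upwards [h0] with t ht0 ht
      have hs : 0 < ∑ y, t y :=
        sum_pos_of_forall_pos hne fun y => lt_of_le_of_ne (ht.1 y) (ht0 y).symm
      congr 1
      rw [he]
      simp only [smul_sub, Finset.sum_sub_distrib, ← Finset.sum_smul, sum_radialProj hs.ne',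
        one_smul, facePoint]
      abel
    rw [this, mul_inv_cancel_left₀ (volume_real_cornerSimplex_pos _).ne']
  rw [h3, h1, h2] at hcone
  have : c * ∫ z in convexHull ℝ (s : Set (Vec d)), (d * φ z + fderiv ℝ φ z (z - x)) =
      c * (d * volume.real (convexHull ℝ (s : Set (Vec d))) * faceMean (s.erase x) φ) := by
    rw [hcone]; ring
  exact mul_left_cancel₀ hc0.ne' this

end FaceMean

/-! ### The Raviart-Thomas interpolant on one cell. -/

section RT
variable {d : ℕ} {s : Finset (Vec d)} {x : Vec d}

/-- The gradients of the barycentric coordinates of a simplex. -/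
lemma exists_baryGrad (hi : AffineIndependent ℝ ((↑) : s → Vec d)) (hc : s.card = d + 1) :
    ∃ G : Vec d → Vec d →ₗ[ℝ] ℝ, (∀ c, ∑ x ∈ s, G x c = 0) ∧ (∀ c, ∑ x ∈ s, G x c • x = c) ∧
      ∀ c₀ r, 0 < r → Metric.closedBall c₀ r ⊆ convexHull ℝ (s : Set (Vec d)) →
        ∀ x ∈ s, ∀ c, |G x c| ≤ ‖c‖ / r := by
  classical
  have hspan : affineSpan ℝ (Set.range ((↑) : s → Vec d)) = ⊤ := by
    rw [hi.affineSpan_eq_top_iff_card_eq_finrank_add_one, Fintype.card_coe, hc,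
      finrank_euclideanSpace_fin]
  let b : AffineBasis s ℝ (Vec d) := ⟨(↑), hi, hspan⟩
  have hlin : ∀ i (p c : Vec d), (b.coord i).linear c = b.coord i (p + c) - b.coord i p := by
    intro i p c
    have := (b.coord i).linearMap_vsub (p + c) p
    simpa using this
  refine ⟨fun x => if h : x ∈ s then (b.coord ⟨x, h⟩).linear else 0, fun c => ?_, fun c => ?_, ?_⟩
  · rw [← Finset.sum_attach]
    simp only [Finset.coe_mem, dite_true]
    simp only [hlin _ 0 c, Finset.sum_sub_distrib]
    have h1 := b.sum_coord_apply_eq_one (0 + c)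
    have h2 := b.sum_coord_apply_eq_one 0
    rw [Finset.univ_eq_attach] at h1 h2
    exact sub_eq_zero.2 (h1.trans h2.symm)
  · rw [← Finset.sum_attach]
    simp only [Finset.coe_mem, dite_true]
    simp only [hlin _ 0 c, sub_smul, Finset.sum_sub_distrib]
    have h1 := b.linear_combination_coord_eq_self (0 + c)
    have h2 := b.linear_combination_coord_eq_self 0
    rw [Finset.univ_eq_attach] at h1 h2
    have : ∑ y ∈ s.attach, b.coord y (0 + c) • (y : Vec d) -
        ∑ y ∈ s.attach, b.coord y 0 • (y : Vec d) = (0 + c) - 0 := congrArg₂ (· - ·) h1 h2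
    simpa using this
  · intro c₀ r hr hball x hx c
    have hrange : Set.range b = (s : Set (Vec d)) := Subtype.range_coe
    have hcoord : ∀ p ∈ Metric.closedBall c₀ r, ∀ i, 0 ≤ b.coord i p ∧ b.coord i p ≤ 1 := by
      intro p hp i
      have h1 := hball hp
      rw [← hrange, b.convexHull_eq_nonneg_coord] at h1
      refine ⟨h1 i, ?_⟩
      rw [← b.sum_coord_apply_eq_one p]
      exact Finset.single_le_sum (f := fun i => b.coord i p) (fun j _ => h1 j) (Finset.mem_univ i)
    simp only [hx, dite_true]
    rcases eq_or_ne c 0 with rfl | hc0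
    · simp
    have hn : 0 < ‖c‖ := norm_pos_iff.2 hc0
    have hmem : c₀ + (r / ‖c‖) • c ∈ Metric.closedBall c₀ r := by
      rw [mem_closedBall_iff_norm, add_sub_cancel_left, norm_smul, norm_div, norm_norm,
        div_mul_cancel₀ _ hn.ne', Real.norm_of_nonneg hr.le]
    have h1 := hcoord _ hmem ⟨x, hx⟩
    have h2 := hcoord _ (Metric.mem_closedBall_self hr.le) ⟨x, hx⟩
    have h3 := hlin ⟨x, hx⟩ c₀ ((r / ‖c‖) • c)
    rw [map_smul, smul_eq_mul] at h3
    -- The centre and the shifted point both lie in the ball, hence in the cell, where barycentric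
    -- coordinates take values in `[0, 1]`.
    have h4 : |r / ‖c‖ * (b.coord ⟨x, hx⟩).linear c| ≤ 1 := by
      rw [h3, abs_le]
      constructor <;> linarith [h1.1, h1.2, h2.1, h2.2]
    rw [abs_mul, abs_of_pos (by positivity), div_mul_eq_mul_div, div_le_one hn] at h4
    rw [le_div_iff₀ hr]
    linarith

open Classical in
/-- The gradient of the barycentric coordinate of the simplex `s` belonging to the vertex `x`. -/
def baryGrad (s : Finset (Vec d)) (x : Vec d) : Vec d →ₗ[ℝ] ℝ :=
  if h : AffineIndependent ℝ ((↑) : s → Vec d) ∧ s.card = d + 1 then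
    (exists_baryGrad h.1 h.2).choose x else 0

lemma baryGrad_spec (hi : AffineIndependent ℝ ((↑) : s → Vec d)) (hc : s.card = d + 1) :
    (∀ c, ∑ x ∈ s, baryGrad s x c = 0) ∧ (∀ c, ∑ x ∈ s, baryGrad s x c • x = c) ∧
      ∀ c₀ r, 0 < r → Metric.closedBall c₀ r ⊆ convexHull ℝ (s : Set (Vec d)) →
        ∀ x ∈ s, ∀ c, |baryGrad s x c| ≤ ‖c‖ / r := by
  have e : baryGrad s = (exists_baryGrad hi hc).choose := by
    funext x
    rw [baryGrad, dif_pos ⟨hi, hc⟩]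
  rw [e]
  exact (exists_baryGrad hi hc).choose_spec

lemma integrableOn_cell {f : Vec d → ℝ} (hf : Continuous f) :
    IntegrableOn f (convexHull ℝ (s : Set (Vec d))) :=
  hf.continuousOn.integrableOn_compact (isCompact_cell s)

/-- Sum the cone identities over all vertices with weights `baryGrad s x c`. The weights add up to
zero, which removes the terms without derivative, and `∑ baryGrad s x c • x = c` recovers the
direction. Geometrically, `-d |K|` times the gradient at `x` is the outer normal of the opposite
face times its area. -/
lemma integral_cell_fderiv (hd : 1 ≤ d) (hi : AffineIndependent ℝ ((↑) : s → Vec d))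
    (hc : s.card = d + 1) {φ : Vec d → ℝ} (hφ : ContDiff ℝ 1 φ) (c : Vec d) :
    ∫ z in convexHull ℝ (s : Set (Vec d)), fderiv ℝ φ z c =
      -(d * volume.real (convexHull ℝ (s : Set (Vec d))) *
        ∑ x ∈ s, baryGrad s x c * faceMean (s.erase x) φ) := by
  obtain ⟨h0, h1, -⟩ := baryGrad_spec hi hc
  have hfd : Continuous (fderiv ℝ φ) := hφ.continuous_fderiv one_ne_zero
  have hint : ∀ x ∈ s, IntegrableOn (fun z => baryGrad s x c * (d * φ z + fderiv ℝ φ z (z - x)))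
      (convexHull ℝ (s : Set (Vec d))) := fun x _ => by
    refine integrableOn_cell ?_
    have := hφ.continuous
    fun_prop
  have e : ∀ z, fderiv ℝ φ z c =
      -∑ x ∈ s, baryGrad s x c * (d * φ z + fderiv ℝ φ z (z - x)) := by
    intro z
    simp only [mul_add, Finset.sum_add_distrib, ← Finset.sum_mul, h0, zero_mul, zero_add, map_sub,
      mul_sub, Finset.sum_sub_distrib, zero_sub, neg_neg]
    conv_lhs => rw [← h1 c, map_sum]
    simp
  simp_rw [e]
  rw [integral_neg, integral_finsetSum _ hint, Finset.mul_sum]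
  congr 1
  refine Finset.sum_congr rfl fun x hx => ?_
  rw [integral_const_mul, integral_cell_cone hd hi hc hx hφ]
  ring

/-- The flux coefficients of the Raviart-Thomas interpolant of a field `v` on the cell `s`. -/
def rtCoeff (v : Fin d → Vec d → ℝ) (s : Finset (Vec d)) (x : Vec d) : ℝ :=
  ∑ i, baryGrad s x (EuclideanSpace.single i 1) * faceMean (s.erase x) (v i)

/-- The Raviart-Thomas interpolant of a field `v` on the cell `s`. -/
def rtLocal (v : Fin d → Vec d → ℝ) (s : Finset (Vec d)) (z : Vec d) : Vec d :=
  -∑ x ∈ s, rtCoeff v s x • (z - x)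

/-- The divergence of the Raviart-Thomas interpolant on the cell `s`. -/
def rtDiv (v : Fin d → Vec d → ℝ) (s : Finset (Vec d)) : ℝ := -(d * ∑ x ∈ s, rtCoeff v s x)

/-- The interpolant is built from the fluxes of `v` through the faces, so its constant divergence is
the cell average of the divergence of `v`. -/
lemma volume_mul_rtDiv (hd : 1 ≤ d) (hi : AffineIndependent ℝ ((↑) : s → Vec d))
    (hc : s.card = d + 1) {v : Fin d → Vec d → ℝ} (hv : ∀ i, ContDiff ℝ 1 (v i)) :
    volume.real (convexHull ℝ (s : Set (Vec d))) * rtDiv v s =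
      ∫ z in convexHull ℝ (s : Set (Vec d)), ∑ i, partialDeriv i (v i) z := by
  rw [integral_finsetSum _ fun i _ => integrableOn_cell (continuous_partialDeriv (hv i) i)]
  simp only [partialDeriv, integral_cell_fderiv hd hi hc (hv _), rtDiv, rtCoeff]
  rw [Finset.sum_comm, Finset.sum_neg_distrib, ← Finset.mul_sum]
  ring

lemma rtLocal_eq (v : Fin d → Vec d → ℝ) (s : Finset (Vec d)) : ∃ (a : Vec d) (β : ℝ),
    ∀ z, rtLocal v s z = a + β • z := by
  refine ⟨∑ x ∈ s, rtCoeff v s x • x, -∑ x ∈ s, rtCoeff v s x, fun z => ?_⟩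
  simp only [rtLocal, smul_sub, Finset.sum_sub_distrib, neg_smul, Finset.sum_smul]
  abel

lemma continuous_rtLocal (v : Fin d → Vec d → ℝ) (s : Finset (Vec d)) :
    Continuous (rtLocal v s) := by
  unfold rtLocal
  fun_prop

/-- Integration by parts for the Raviart-Thomas interpolant on a cell. -/
lemma integral_cell_rtLocal (hd : 1 ≤ d) (hi : AffineIndependent ℝ ((↑) : s → Vec d))
    (hc : s.card = d + 1) (v : Fin d → Vec d → ℝ) {φ : Vec d → ℝ} (hφ : ContDiff ℝ 1 φ) :
    ∫ z in convexHull ℝ (s : Set (Vec d)), (fderiv ℝ φ z (rtLocal v s z) + rtDiv v s * φ z) =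
      -(d * ∑ x ∈ s, ∑ i, volume.real (convexHull ℝ (s : Set (Vec d))) *
        baryGrad s x (EuclideanSpace.single i 1) * faceMean (s.erase x) (v i) *
          faceMean (s.erase x) φ) := by
  have hfd : Continuous (fderiv ℝ φ) := hφ.continuous_fderiv one_ne_zero
  have hφc := hφ.continuous
  -- Each basis field `z - x` produces exactly the integrand of the cone identity with apex `x`.
  have e : ∀ z, fderiv ℝ φ z (rtLocal v s z) + rtDiv v s * φ z =
      -∑ x ∈ s, rtCoeff v s x * (d * φ z + fderiv ℝ φ z (z - x)) := by
    intro z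
    simp only [rtLocal, rtDiv, map_neg, map_sum, map_smul, smul_eq_mul, mul_add,
      Finset.sum_add_distrib]
    rw [Finset.mul_sum, neg_mul, Finset.sum_mul]
    rw [neg_add, add_comm]
    congr 2
    exact Finset.sum_congr rfl fun x _ => by ring
  simp_rw [e]
  rw [integral_neg, integral_finsetSum _ fun x _ => integrableOn_cell (by fun_prop),
    Finset.mul_sum]
  congr 1
  refine Finset.sum_congr rfl fun x hx => ?_
  rw [integral_const_mul, integral_cell_cone hd hi hc hx hφ, rtCoeff, Finset.sum_mul,
    Finset.mul_sum]
  exact Finset.sum_congr rfl fun i _ => by ring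

end RT

/-! ### Stability of the interpolant on one cell. -/

section RTBound
variable {d : ℕ} {s : Finset (Vec d)}

lemma vec_eq_sum (w : Vec d) : w = ∑ k, w k • EuclideanSpace.single k (1 : ℝ) := by
  ext j
  simp [Finset.sum_apply, Pi.single_apply]

lemma fderiv_apply_eq_sum (φ : Vec d → ℝ) (z w : Vec d) :
    fderiv ℝ φ z w = ∑ k, w k * partialDeriv k φ z := by
  conv_lhs => rw [vec_eq_sum w, map_sum]
  simp [partialDeriv]

lemma sq_fderiv_apply_le (φ : Vec d → ℝ) (z w : Vec d) :
    fderiv ℝ φ z w ^ 2 ≤ ‖w‖ ^ 2 * ∑ k, partialDeriv k φ z ^ 2 := by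
  rw [fderiv_apply_eq_sum, EuclideanSpace.real_norm_sq_eq]
  exact Finset.sum_mul_sq_le_sq_mul_sq _ _ _

lemma dist_le_diam_cell {x z : Vec d} (hx : x ∈ s)
    (hz : z ∈ convexHull ℝ (s : Set (Vec d))) :
    ‖z - x‖ ≤ Metric.diam (convexHull ℝ (s : Set (Vec d))) := by
  rw [← dist_eq_norm]
  exact Metric.dist_le_diam_of_mem (isCompact_cell s).isBounded hz (subset_convexHull ℝ _ hx)

/-- A trace inequality: the cone identity for `φ²`, with the estimate `2 φ ∇φ·(z - x) ≤ φ² + Δ²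
|∇φ|²`. -/
lemma faceMean_sq_le (hd : 1 ≤ d) (hi : AffineIndependent ℝ ((↑) : s → Vec d))
    (hc : s.card = d + 1) {x : Vec d} (hx : x ∈ s) {φ : Vec d → ℝ} (hφ : ContDiff ℝ 1 φ)
    {Δ : ℝ} (hΔ : Metric.diam (convexHull ℝ (s : Set (Vec d))) ≤ Δ) :
    d * volume.real (convexHull ℝ (s : Set (Vec d))) * faceMean (s.erase x) (fun z => φ z ^ 2) ≤
      (d + 1 + Δ ^ 2) * ∫ z in convexHull ℝ (s : Set (Vec d)),
        (φ z ^ 2 + ∑ k, partialDeriv k φ z ^ 2) := by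
  have hφ2 : ContDiff ℝ 1 fun z => φ z ^ 2 := hφ.pow 2
  rw [← integral_cell_cone hd hi hc hx hφ2, ← integral_const_mul]
  have hcp := fun k => continuous_partialDeriv hφ k
  have hc1 := hφ.continuous
  have hc2 := hφ2.continuous_fderiv one_ne_zero
  refine setIntegral_mono_on (integrableOn_cell (by fun_prop)) (integrableOn_cell (by fun_prop))
    (measurableSet_cell s) fun z hz => ?_
  have hder : fderiv ℝ (fun z => φ z ^ 2) z (z - x) = 2 * φ z * fderiv ℝ φ z (z - x) := by
    have h : HasFDerivAt (fun z => φ z ^ 2) _ z :=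
      (hφ.differentiable one_ne_zero z).hasFDerivAt.pow 2
    rw [h.fderiv]
    simp
  rw [hder]
  have h1 : fderiv ℝ φ z (z - x) ^ 2 ≤ Δ ^ 2 * ∑ k, partialDeriv k φ z ^ 2 := by
    refine (sq_fderiv_apply_le φ z _).trans ?_
    gcongr
    exact (dist_le_diam_cell hx hz).trans hΔ
  have h2 := two_mul_le_add_sq (φ z) (fderiv ℝ φ z (z - x))
  have h3 : 0 ≤ ∑ k, partialDeriv k φ z ^ 2 := Finset.sum_nonneg fun _ _ => sq_nonneg _
  have h4 : (0 : ℝ) ≤ d := Nat.cast_nonneg d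
  nlinarith [mul_nonneg h4 h3, mul_nonneg (sq_nonneg Δ) (sq_nonneg (φ z))]

/-- Shape regularity enters here. The coefficients carry a factor `1 / r` and the basis fields have
length at most `σ r`, so the radius cancels and no negative power of the mesh size remains. -/
lemma norm_rtLocal_sq_le (hi : AffineIndependent ℝ ((↑) : s → Vec d)) (hc : s.card = d + 1)
    {v : Fin d → Vec d → ℝ} (hv : ∀ i, ContDiff ℝ 1 (v i)) {σ r : ℝ} {c₀ : Vec d} (hr : 0 < r)
    (hball : Metric.closedBall c₀ r ⊆ convexHull ℝ (s : Set (Vec d)))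
    (hdiam : Metric.diam (convexHull ℝ (s : Set (Vec d))) ≤ σ * r) {z : Vec d}
    (hz : z ∈ convexHull ℝ (s : Set (Vec d))) :
    ‖rtLocal v s z‖ ^ 2 ≤ σ ^ 2 * ((d + 1) * d) *
      ∑ x ∈ s, ∑ i, faceMean (s.erase x) (fun z => v i z ^ 2) := by
  have hG := (baryGrad_spec hi hc).2.2 c₀ r hr hball
  have hcoef : ∀ x ∈ s, |rtCoeff v s x| ≤ ∑ i, |faceMean (s.erase x) (v i)| / r := by
    intro x hx
    refine (Finset.abs_sum_le_sum_abs _ _).trans (Finset.sum_le_sum fun i _ => ?_)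
    rw [abs_mul]
    have := hG x hx (EuclideanSpace.single i 1)
    rw [PiLp.norm_single, norm_one] at this
    calc _ ≤ 1 / r * |faceMean (s.erase x) (v i)| := by gcongr
      _ = _ := by ring
  have hσ : 0 ≤ σ * r := Metric.diam_nonneg.trans hdiam
  have h1 : ‖rtLocal v s z‖ ≤ σ * ∑ x ∈ s, ∑ i, |faceMean (s.erase x) (v i)| := by
    rw [rtLocal, norm_neg]
    refine (norm_sum_le _ _).trans ?_
    rw [Finset.mul_sum]
    refine Finset.sum_le_sum fun x hx => ?_
    rw [norm_smul, Real.norm_eq_abs]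
    calc _ ≤ (∑ i, |faceMean (s.erase x) (v i)| / r) * (σ * r) :=
          mul_le_mul (hcoef x hx) ((dist_le_diam_cell hx hz).trans hdiam) (norm_nonneg _)
            (Finset.sum_nonneg fun _ _ => by positivity)
      _ = _ := by
          rw [← Finset.sum_div]
          field_simp
  calc ‖rtLocal v s z‖ ^ 2 ≤ (σ * ∑ x ∈ s, ∑ i, |faceMean (s.erase x) (v i)|) ^ 2 := by gcongr
    _ = σ ^ 2 * (∑ x ∈ s, ∑ i, |faceMean (s.erase x) (v i)|) ^ 2 := by ring
    _ ≤ σ ^ 2 * (s.card * ∑ x ∈ s, (∑ i, |faceMean (s.erase x) (v i)|) ^ 2) := by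
        gcongr
        exact sq_sum_le_card_mul_sum_sq
    _ ≤ σ ^ 2 * (s.card * ∑ x ∈ s, (d * ∑ i, |faceMean (s.erase x) (v i)| ^ 2)) := by
        gcongr with x hx
        simpa using sq_sum_le_card_mul_sum_sq (s := (Finset.univ : Finset (Fin d)))
          (f := fun i => |faceMean (s.erase x) (v i)|)
    _ ≤ σ ^ 2 * (s.card * ∑ x ∈ s, (d * ∑ i, faceMean (s.erase x) (fun z => v i z ^ 2))) := by
        gcongr with x hx i
        rw [sq_abs]
        exact sq_faceMean_le _ (hv i).continuous
    _ = _ := by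
        rw [hc, ← Finset.mul_sum]
        push_cast
        ring

/-- Local stability of the Raviart-Thomas interpolant. -/
lemma integral_norm_rtLocal_sq_le (hd : 1 ≤ d) (hi : AffineIndependent ℝ ((↑) : s → Vec d))
    (hc : s.card = d + 1) {v : Fin d → Vec d → ℝ} (hv : ∀ i, ContDiff ℝ 1 (v i)) {σ r Δ : ℝ}
    {c₀ : Vec d} (hr : 0 < r)
    (hball : Metric.closedBall c₀ r ⊆ convexHull ℝ (s : Set (Vec d)))
    (hdiam : Metric.diam (convexHull ℝ (s : Set (Vec d))) ≤ σ * r)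
    (hΔ : Metric.diam (convexHull ℝ (s : Set (Vec d))) ≤ Δ) :
    ∫ z in convexHull ℝ (s : Set (Vec d)), ‖rtLocal v s z‖ ^ 2 ≤
      σ ^ 2 * (d + 1) ^ 2 * (d + 1 + Δ ^ 2) * ∑ i, ∫ z in convexHull ℝ (s : Set (Vec d)),
        (v i z ^ 2 + ∑ k, partialDeriv k (v i) z ^ 2) := by
  set K := convexHull ℝ (s : Set (Vec d)) with hK
  have hcont := (continuous_rtLocal v s).norm.pow 2
  have hKf : volume K ≠ ⊤ := (isCompact_cell s).measure_lt_top.ne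
  calc ∫ z in K, ‖rtLocal v s z‖ ^ 2
      ≤ ∫ z in K, σ ^ 2 * ((d + 1) * d) *
        ∑ x ∈ s, ∑ i, faceMean (s.erase x) (fun z => v i z ^ 2) :=
        setIntegral_mono_on (integrableOn_cell hcont) (integrableOn_const hKf)
          (measurableSet_cell s) fun z hz => norm_rtLocal_sq_le hi hc hv hr hball hdiam hz
    _ = σ ^ 2 * (d + 1) * ∑ x ∈ s, ∑ i,
          (d * volume.real K * faceMean (s.erase x) (fun z => v i z ^ 2)) := by
        rw [integral_const]
        simp only [smul_eq_mul, measureReal_restrict_apply_univ, ← Finset.mul_sum]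
        ring
    _ ≤ σ ^ 2 * (d + 1) * ∑ x ∈ s, ∑ i, ((d + 1 + Δ ^ 2) *
          ∫ z in K, (v i z ^ 2 + ∑ k, partialDeriv k (v i) z ^ 2)) := by
        refine mul_le_mul_of_nonneg_left (Finset.sum_le_sum fun x hx =>
          Finset.sum_le_sum fun i _ => ?_) (by positivity)
        exact faceMean_sq_le hd hi hc hx (hv i) hΔ
    _ = _ := by
        rw [Finset.sum_const, hc, ← Finset.mul_sum]
        simp only [nsmul_eq_mul]
        push_cast
        ring

end RTBound

/-! ### Measure and incidence geometry of a conforming mesh. -/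

section MeshGeometry
variable {d : ℕ} {Ω : Set (Vec d)} {T : Geometry.SimplicialComplex ℝ (Vec d)}

/-- The closed cell spanned by `s`. -/
abbrev cell (s : Finset (Vec d)) : Set (Vec d) := convexHull ℝ (s : Set (Vec d))

lemma ae_cell_eq_interior (s : Finset (Vec d)) : (interior (cell s) : Set (Vec d)) =ᵐ[volume] cell s :=
  interior_ae_eq_of_null_frontier ((convex_convexHull ℝ _).addHaar_frontier volume)

/-- By conformity the intersection lies in the affine span of the common vertices. That span is the
whole space only if all `d + 1` vertices are shared. -/
lemma volume_inter_cell_eq_zero {s t : Finset (Vec d)} (hs : s ∈ cells T) (ht : t ∈ cells T)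
    (hst : s ≠ t) : volume (cell s ∩ cell t) = 0 := by
  classical
  have hsub : cell s ∩ cell t ⊆ affineSpan ℝ (((s ∩ t : Finset (Vec d)) : Set (Vec d))) := by
    refine (T.inter_subset_convexHull hs.1 ht.1).trans ?_
    rw [← Finset.coe_inter]
    exact convexHull_subset_affineSpan _
  refine measure_mono_null hsub (Measure.addHaar_affineSubspace volume _ fun htop => ?_)
  have hi : AffineIndependent ℝ ((↑) : (s ∩ t : Finset (Vec d)) → Vec d) :=
    (T.indep hs.1).mono (Finset.coe_subset.2 Finset.inter_subset_left)
  have hr : Set.range ((↑) : (s ∩ t : Finset (Vec d)) → Vec d) =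
    ((s ∩ t : Finset (Vec d)) : Set (Vec d)) := Subtype.range_coe
  rw [← hr, hi.affineSpan_eq_top_iff_card_eq_finrank_add_one, Fintype.card_coe,
    finrank_euclideanSpace_fin] at htop
  have h1 : s ∩ t = s := Finset.eq_of_subset_of_card_le Finset.inter_subset_left
    (by rw [htop, hs.2])
  have h2 : s ∩ t = t := Finset.eq_of_subset_of_card_le Finset.inter_subset_right
    (by rw [htop, ht.2])
  exact hst (h1.symm.trans h2)

lemma disjoint_interior_cell {s t : Finset (Vec d)} (hs : s ∈ cells T) (ht : t ∈ cells T)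
    (hst : s ≠ t) : Disjoint (interior (cell s)) (interior (cell t)) := by
  rw [Set.disjoint_iff_inter_eq_empty]
  by_contra h
  have h1 : 0 < volume (interior (cell s) ∩ interior (cell t)) :=
    (isOpen_interior.inter isOpen_interior).measure_pos volume (Set.nonempty_iff_ne_empty.2 h)
  exact h1.ne' (measure_mono_null (Set.inter_subset_inter interior_subset interior_subset)
    (volume_inter_cell_eq_zero hs ht hst))

/-- The finite set of cells of a mesh. -/
def IsMesh.cellFinset (hT : IsMesh Ω T) : Finset (Finset (Vec d)) :=
  (hT.finite.subset (fun _ hs => hs.1 : cells T ⊆ T.faces)).toFinset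

lemma IsMesh.mem_cellFinset (hT : IsMesh Ω T) {s : Finset (Vec d)} :
    s ∈ hT.cellFinset ↔ s ∈ cells T := Set.Finite.mem_toFinset _

lemma IsMesh.cell_subset_closure (hT : IsMesh Ω T) {s : Finset (Vec d)} (hs : s ∈ cells T) :
    cell s ⊆ closure Ω := by
  rw [← hT.cover]
  exact Set.subset_biUnion_of_mem (u := fun s : Finset (Vec d) => cell s) hs

lemma IsMesh.interior_cell_subset (hT : IsMesh Ω T) (hreg : interior (closure Ω) = Ω)
    {s : Finset (Vec d)} (hs : s ∈ cells T) : interior (cell s) ⊆ Ω := by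
  rw [← hreg]
  exact interior_mono (hT.cell_subset_closure hs)

/-- Frontiers of convex sets are null. The inclusion of the open cells in `Ω` rests on `interior
(closure Ω) = Ω`, which excludes slits. -/
lemma IsMesh.ae_eq_biUnion (hT : IsMesh Ω T) (hreg : interior (closure Ω) = Ω) :
    Ω =ᵐ[volume] ⋃ s ∈ hT.cellFinset, interior (cell s) := by
  have hsub : Ω \ (⋃ s ∈ hT.cellFinset, interior (cell s)) ⊆
      ⋃ s ∈ hT.cellFinset, frontier (cell s) := by
    rintro z ⟨hz, hz'⟩
    have := subset_closure hz
    rw [← hT.cover] at this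
    obtain ⟨s, hs, hzs⟩ := Set.mem_iUnion₂.1 this
    refine Set.mem_iUnion₂.2 ⟨s, hT.mem_cellFinset.2 hs, subset_closure hzs, fun hi => hz' ?_⟩
    exact Set.mem_iUnion₂.2 ⟨s, hT.mem_cellFinset.2 hs, hi⟩
  refine ae_eq_set.2 ⟨measure_mono_null hsub ?_, ?_⟩
  · exact (measure_biUnion_null_iff hT.cellFinset.countable_toSet).2
      fun s _ => (convex_convexHull ℝ _).addHaar_frontier volume
  · have h : (⋃ s ∈ hT.cellFinset, interior (cell s)) ⊆ Ω := Set.iUnion₂_subset fun s hs =>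
      hT.interior_cell_subset hreg (hT.mem_cellFinset.1 hs)
    rw [Set.sdiff_eq_empty.2 h, measure_empty]

lemma IsMesh.setIntegral_eq_sum_interior (hT : IsMesh Ω T) (hreg : interior (closure Ω) = Ω)
    {f : Vec d → ℝ} (hf : IntegrableOn f Ω) :
    ∫ z in Ω, f z = ∑ s ∈ hT.cellFinset, ∫ z in interior (cell s), f z := by
  rw [setIntegral_congr_set (hT.ae_eq_biUnion hreg), integral_biUnion_finset]
  · exact fun s _ => isOpen_interior.measurableSet
  · exact fun s hs t ht hst => disjoint_interior_cell (hT.mem_cellFinset.1 hs)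
      (hT.mem_cellFinset.1 ht) hst
  · exact fun s hs => hf.mono_set (hT.interior_cell_subset hreg (hT.mem_cellFinset.1 hs))

lemma setIntegral_interior_cell (s : Finset (Vec d)) (f : Vec d → ℝ) :
    ∫ z in interior (cell s), f z = ∫ z in cell s, f z :=
  setIntegral_congr_set (ae_cell_eq_interior s)

lemma IsMesh.setIntegral_eq_sum (hT : IsMesh Ω T) (hreg : interior (closure Ω) = Ω)
    {f : Vec d → ℝ} (hf : IntegrableOn f Ω) :
    ∫ z in Ω, f z = ∑ s ∈ hT.cellFinset, ∫ z in cell s, f z := by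
  rw [hT.setIntegral_eq_sum_interior hreg hf]
  exact Finset.sum_congr rfl fun s _ => setIntegral_interior_cell s f

/-- By conformity the point would be a convex combination of the common vertices. Uniqueness of
barycentric coordinates would then make its coordinate at some vertex outside `F'` vanish. -/
lemma facePoint_notMem_of_ne {F F' : Finset (Vec d)} (hF : F ∈ T.faces) (hF' : F' ∈ T.faces)
    (hcard : F.card = F'.card) (hne : F ≠ F') {t : F → ℝ} (ht : ∀ y, 0 < t y) :
    facePoint F t ∉ cell F' := by
  classical
  intro hmem
  have hFn : F.Nonempty := T.nonempty_of_mem_faces hF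
  have h1 := T.inter_subset_convexHull hF hF' ⟨facePoint_mem hFn ht, hmem⟩
  rw [← Finset.coe_inter] at h1
  obtain ⟨w, hw0, hw1, hwp⟩ := Finset.mem_convexHull'.1 h1
  obtain ⟨y, hyF, hyF'⟩ : ∃ y ∈ F, y ∉ F' := by
    by_contra! h
    exact hne (Finset.eq_of_subset_of_card_le h hcard.ge)
  have hs := sum_pos_of_forall_pos hFn ht
  have hsum : ∑ z : F, (if (z : Vec d) ∈ F' then w z else 0) = 1 := by
    rw [Finset.sum_coe_sort F fun z => if z ∈ F' then w z else 0, ← Finset.sum_filter,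
      Finset.filter_mem_eq_inter, hw1]
  have hpt : ∑ z : F, (if (z : Vec d) ∈ F' then w z else 0) • (z : Vec d) = facePoint F t := by
    rw [Finset.sum_coe_sort F fun z => (if z ∈ F' then w z else 0) • z]
    simp only [ite_smul, zero_smul]
    rw [← Finset.sum_filter, Finset.filter_mem_eq_inter, hwp]
  have := (T.indep hF).eq_zero_of_sum_eq_zero (s := Finset.univ)
    (w := fun z : F => radialProj t z - if (z : Vec d) ∈ F' then w z else 0)
    (by rw [Finset.sum_sub_distrib, sum_radialProj hs.ne', hsum, sub_self])
    (by
      simp only [sub_smul, Finset.sum_sub_distrib]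
      rw [hpt, facePoint, sub_self]) ⟨y, hyF⟩ (Finset.mem_univ _)
  simp only [hyF', if_false, sub_zero] at this
  have hp : 0 < radialProj t ⟨y, hyF⟩ := mul_pos (inv_pos.2 hs) (ht _)
  exact hp.ne' this

lemma faceMean_pos {F : Finset (Vec d)} (hF : F.Nonempty) {χ : Vec d → ℝ} (hχ : Continuous χ)
    (h0 : ∀ z, 0 ≤ χ z) {t : F → ℝ} (ht : ∀ y, 0 < t y) (hpos : 0 < χ (facePoint F t)) :
    0 < faceMean F χ := by
  rw [faceMean_eq]
  refine mul_pos (inv_pos.2 (volume_real_cornerSimplex_pos F)) ?_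
  rw [setIntegral_pos_iff_support_of_nonneg_ae (Eventually.of_forall fun t => h0 _)
    (integrableOn_facePoint F hχ)]
  set S := ∑ y, t y with hS
  have hSpos : 0 < S := sum_pos_of_forall_pos hF ht
  -- The projection ignores scaling. Rescaling to sum `1 / 2` moves the parameter into the interior
  -- of the corner simplex, where positivity on a neighbourhood gives positive volume.
  set t' : F → ℝ := (2 * S)⁻¹ • t with ht'
  have ht'pos : ∀ y, 0 < t' y := fun y => mul_pos (by positivity) (ht y)
  have hrp : radialProj t' = radialProj t := radialProj_smul (by positivity) t
  have hsum' : ∑ y, t' y = 1 / 2 := by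
    simp only [ht', Pi.smul_apply, smul_eq_mul, ← Finset.mul_sum, ← hS]
    field_simp
  have hcont : ContinuousAt (fun u : F → ℝ => χ (facePoint F u)) t' := by
    have hsc : Continuous fun u : F → ℝ => ∑ y, u y := by fun_prop
    have h1 : ContinuousAt (radialProj : (F → ℝ) → F → ℝ) t' := by
      refine ContinuousAt.smul (hsc.continuousAt.inv₀ ?_) continuousAt_id
      rw [hsum']; norm_num
    have h2 : Continuous fun r : F → ℝ => χ (∑ y : F, r y • (y : Vec d)) := by fun_prop
    exact h2.continuousAt.comp h1
  have hev : ∀ᶠ u in 𝓝 t', 0 < χ (facePoint F u) := by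
    refine hcont.eventually (lt_mem_nhds ?_)
    change 0 < χ (∑ y : F, radialProj t' y • (y : Vec d))
    rw [hrp]
    exact hpos
  have hopen : IsOpen {u : F → ℝ | (∀ y, 0 < u y) ∧ ∑ y, u y < 1} := by
    have : {u : F → ℝ | (∀ y, 0 < u y) ∧ ∑ y, u y < 1} =
        (⋂ y, {u | 0 < u y}) ∩ {u | ∑ y, u y < 1} := by
      ext u; simp
    rw [this]
    exact (isOpen_iInter_of_finite fun y => isOpen_lt continuous_const (continuous_apply y)).inter
      (isOpen_lt (by fun_prop) continuous_const)
  have hev2 : ∀ᶠ u in 𝓝 t', (∀ y, 0 < u y) ∧ ∑ y, u y < 1 :=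
    hopen.mem_nhds ⟨ht'pos, by rw [hsum']; norm_num⟩
  refine lt_of_lt_of_le (Measure.measure_pos_of_mem_nhds volume (hev.and hev2)) (measure_mono ?_)
  rintro u ⟨hu1, hu2, hu3⟩
  exact ⟨hu1.ne', fun y => (hu2 y).le, hu3.le⟩

end MeshGeometry

/-! ### The global Raviart-Thomas interpolant: conformity and stability. -/

section GlobalRT
variable {d : ℕ} {Ω : Set (Vec d)} {T : Geometry.SimplicialComplex ℝ (Vec d)}

lemma faceMean_eq_zero {F : Finset (Vec d)} {φ : Vec d → ℝ}
    (h : ∀ t : F → ℝ, (∀ y, 0 < t y) → φ (facePoint F t) = 0) : faceMean F φ = 0 := by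
  have h1 : faceMean F φ = faceMean F fun _ => 0 := faceMean_congr fun t _ ht => h t ht
  rw [h1, faceMean_eq]
  simp

lemma integral_partialDeriv_eq_zero {χ : Vec d → ℝ} (hχ : ContDiff ℝ 1 χ)
    (hχc : HasCompactSupport χ) (i : Fin d) : ∫ z, partialDeriv i χ z = 0 := by
  have h := integral_mul_partialDeriv (φ := fun _ => 1) contDiff_const hχ hχc i
  simpa [partialDeriv] using h

/-- The pairs of a cell and a vertex of it. -/
def IsMesh.corners (hT : IsMesh Ω T) : Finset (Σ _ : Finset (Vec d), Vec d) :=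
  hT.cellFinset.sigma fun s => s

lemma IsMesh.mem_corners (hT : IsMesh Ω T) {p : Σ _ : Finset (Vec d), Vec d} :
    p ∈ hT.corners ↔ p.1 ∈ cells T ∧ p.2 ∈ p.1 := by
  rw [IsMesh.corners, Finset.mem_sigma, hT.mem_cellFinset]

lemma erase_mem_faces (hd : 1 ≤ d) {s : Finset (Vec d)} {x : Vec d} (hs : s ∈ cells T)
    (hx : x ∈ s) : s.erase x ∈ T.faces := by
  refine T.down_closed hs.1 (Finset.erase_subset _ _) (Finset.card_pos.1 ?_)
  rw [card_erase_eq hs.2 hx]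
  exact hd

/-- Over every facet of the mesh, test functions have mean zero or the area weighted outer
normals of the adjacent cells cancel. -/
lemma IsMesh.faceMean_eq_zero_or (hT : IsMesh Ω T) (hd : 1 ≤ d) (hΩ : IsOpen Ω)
    (hreg : interior (closure Ω) = Ω) {F : Finset (Vec d)} (hF : F ∈ T.faces) (hFc : F.card = d)
    {φ : Vec d → ℝ} (hφ : IsTestFunction Ω φ) :
    faceMean F φ = 0 ∨ ∀ i, ∑ p ∈ hT.corners with p.1.erase p.2 = F,
      volume.real (cell p.1) * baryGrad p.1 p.2 (EuclideanSpace.single i 1) = 0 := by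
  by_cases h : ∃ t : F → ℝ, (∀ y, 0 < t y) ∧ facePoint F t ∈ Ω
  swap
  · refine Or.inl (faceMean_eq_zero fun t ht => image_eq_zero_of_notMem_tsupport fun hm => ?_)
    exact h ⟨t, ht, hφ.2.2 hm⟩
  obtain ⟨t, ht, htΩ⟩ := h
  refine Or.inr fun i => ?_
  have hFn : F.Nonempty := T.nonempty_of_mem_faces hF
  -- The other facets form a closed set missing the chosen point, so a bump there sees the facet `F`
  -- alone. This makes it unnecessary to determine how many cells meet at `F` and on which side.
  set B : Set (Vec d) := ⋃ p ∈ hT.corners.filter (fun p => p.1.erase p.2 ≠ F),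
    cell (p.1.erase p.2) with hB
  have hBc : IsClosed B :=
    Set.Finite.isClosed_biUnion (Finset.finite_toSet _) fun p _ => (isCompact_cell _).isClosed
  have hfaces : ∀ p ∈ hT.corners, p.1.erase p.2 ∈ T.faces ∧ (p.1.erase p.2).card = d := by
    intro p hp
    have hp' := hT.mem_corners.1 hp
    exact ⟨erase_mem_faces hd hp'.1 hp'.2, card_erase_eq hp'.1.2 hp'.2⟩
  have htB : facePoint F t ∉ B := by
    intro hm
    obtain ⟨p, hp, hpm⟩ := Set.mem_iUnion₂.1 hm
    rw [Finset.mem_filter] at hp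
    obtain ⟨h1, h2⟩ := hfaces p hp.1
    exact facePoint_notMem_of_ne hF h1 (hFc.trans h2.symm) hp.2.symm ht hpm
  obtain ⟨χ, hχs, hχc, hχ, hχr, hχ1⟩ := exists_contDiff_tsupport_subset (n := 1)
    ((hΩ.inter hBc.isOpen_compl).mem_nhds ⟨htΩ, htB⟩)
  replace hχ : ContDiff ℝ 1 χ := hχ
  have hpos : 0 < faceMean F χ := faceMean_pos hFn hχ.continuous
    (fun z => (hχr ⟨z, rfl⟩).1) ht (by rw [hχ1]; exact one_pos)
  have hzero : ∀ p ∈ hT.corners, p.1.erase p.2 ≠ F → faceMean (p.1.erase p.2) χ = 0 := by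
    intro p hp hne
    refine faceMean_eq_zero fun u hu => image_eq_zero_of_notMem_tsupport fun hm => ?_
    refine (hχs hm).2 (Set.mem_iUnion₂.2 ⟨p, Finset.mem_filter.2 ⟨hp, hne⟩, ?_⟩)
    exact facePoint_mem (T.nonempty_of_mem_faces (hfaces p hp).1) hu
  have hint : IntegrableOn (partialDeriv i χ) Ω :=
    ((continuous_partialDeriv hχ i).integrable_of_hasCompactSupport
      (hasCompactSupport_partialDeriv hχc i)).integrableOn
  -- Evaluated cell by cell, this vanishing integral is, up to a non-zero factor, the sum of the
  -- weighted normals at `F` times the positive mean of `χ`.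
  have h0 : ∫ z in Ω, partialDeriv i χ z = 0 := by
    rw [setIntegral_eq_integral_of_tsupport_subset, integral_partialDeriv_eq_zero hχ hχc]
    exact (tsupport_partialDeriv_subset χ i).trans (hχs.trans Set.inter_subset_left)
  rw [hT.setIntegral_eq_sum hreg hint] at h0
  have h1 : ∀ s ∈ hT.cellFinset, ∫ z in cell s, partialDeriv i χ z =
      -(d * ∑ x ∈ s, volume.real (cell s) * baryGrad s x (EuclideanSpace.single i 1) *
        faceMean (s.erase x) χ) := by
    intro s hs
    have hs' := hT.mem_cellFinset.1 hs
    have := integral_cell_fderiv hd (T.indep hs'.1) hs'.2 hχ (EuclideanSpace.single i 1)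
    refine this.trans ?_
    rw [mul_assoc, Finset.mul_sum]
    simp only [mul_assoc]
  rw [Finset.sum_congr rfl h1, Finset.sum_neg_distrib, neg_eq_zero, ← Finset.mul_sum,
    mul_eq_zero_iff_left (by exact_mod_cast (by omega : d ≠ 0)),
    Finset.sum_sigma' hT.cellFinset (fun s => s)] at h0
  change ∑ p ∈ hT.corners, volume.real (cell p.1) *
    baryGrad p.1 p.2 (EuclideanSpace.single i 1) * faceMean (p.1.erase p.2) χ = 0 at h0
  rw [← Finset.sum_filter_add_sum_filter_not _ fun p => p.1.erase p.2 = F] at h0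
  have h2 : ∑ p ∈ hT.corners with ¬ p.1.erase p.2 = F, volume.real (cell p.1) *
    baryGrad p.1 p.2 (EuclideanSpace.single i 1) * faceMean (p.1.erase p.2) χ = 0 := by
    refine Finset.sum_eq_zero fun p hp => ?_
    rw [Finset.mem_filter] at hp
    rw [hzero p hp.1 hp.2, mul_zero]
  have h3 : ∑ p ∈ hT.corners with p.1.erase p.2 = F, volume.real (cell p.1) *
      baryGrad p.1 p.2 (EuclideanSpace.single i 1) * faceMean (p.1.erase p.2) χ =
      (∑ p ∈ hT.corners with p.1.erase p.2 = F, volume.real (cell p.1) *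
      baryGrad p.1 p.2 (EuclideanSpace.single i 1)) * faceMean F χ := by
    rw [Finset.sum_mul]
    refine Finset.sum_congr rfl fun p hp => ?_
    rw [(Finset.mem_filter.1 hp).2]
  rw [h2, add_zero, h3] at h0
  exact (mul_eq_zero.1 h0).resolve_right hpos.ne'

/-- The fluxes of a conforming interpolant through the facets cancel. -/
lemma IsMesh.sum_flux_eq_zero (hT : IsMesh Ω T) (hd : 1 ≤ d) (hΩ : IsOpen Ω)
    (hreg : interior (closure Ω) = Ω) (v : Fin d → Vec d → ℝ) {φ : Vec d → ℝ}
    (hφ : IsTestFunction Ω φ) :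
    ∑ s ∈ hT.cellFinset, ∑ x ∈ s, ∑ i, volume.real (cell s) *
      baryGrad s x (EuclideanSpace.single i 1) * faceMean (s.erase x) (v i) *
        faceMean (s.erase x) φ = 0 := by
  classical
  rw [Finset.sum_sigma' hT.cellFinset (fun s => s)]
  change ∑ p ∈ hT.corners, ∑ i, volume.real (cell p.1) *
      baryGrad p.1 p.2 (EuclideanSpace.single i 1) * faceMean (p.1.erase p.2) (v i) *
        faceMean (p.1.erase p.2) φ = 0
  -- Grouped by facets, the means of `v` and `φ` depend on the facet only and factor out of the sum
  -- of the normals.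
  rw [← Finset.sum_fiberwise_of_maps_to (g := fun p => p.1.erase p.2)
    (t := hT.corners.image fun p => p.1.erase p.2)
    fun p hp => Finset.mem_image_of_mem _ hp]
  refine Finset.sum_eq_zero fun F hF => ?_
  obtain ⟨q, hq, rfl⟩ := Finset.mem_image.1 hF
  have hq' := hT.mem_corners.1 hq
  set F := q.1.erase q.2 with hFdef
  have e : ∑ p ∈ hT.corners with p.1.erase p.2 = F, ∑ i, volume.real (cell p.1) *
      baryGrad p.1 p.2 (EuclideanSpace.single i 1) * faceMean (p.1.erase p.2) (v i) *
        faceMean (p.1.erase p.2) φ =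
      ∑ i, (∑ p ∈ hT.corners with p.1.erase p.2 = F, volume.real (cell p.1) *
        baryGrad p.1 p.2 (EuclideanSpace.single i 1)) * (faceMean F (v i) * faceMean F φ) := by
    rw [Finset.sum_comm]
    refine Finset.sum_congr rfl fun i _ => ?_
    rw [Finset.sum_mul]
    refine Finset.sum_congr rfl fun p hp => ?_
    rw [(Finset.mem_filter.1 hp).2]
    ring
  rw [e]
  refine Finset.sum_eq_zero fun i _ => ?_
  rcases hT.faceMean_eq_zero_or hd hΩ hreg (erase_mem_faces hd hq'.1 hq'.2)
    (card_erase_eq hq'.1.2 hq'.2) hφ with h | h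
  · rw [h, mul_zero, mul_zero]
  · rw [h i, zero_mul]

/-- The Raviart-Thomas interpolant of a field `v`. -/
def IsMesh.rtField (hT : IsMesh Ω T) (v : Fin d → Vec d → ℝ) (z : Vec d) : Vec d :=
  ∑ s ∈ hT.cellFinset, (interior (cell s)).indicator (rtLocal v s) z

/-- The divergence of the Raviart-Thomas interpolant of a field `v`. -/
def IsMesh.rtFieldDiv (hT : IsMesh Ω T) (v : Fin d → Vec d → ℝ) (z : Vec d) : ℝ :=
  ∑ s ∈ hT.cellFinset, (interior (cell s)).indicator (fun _ => rtDiv v s) z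

lemma IsMesh.sum_indicator_eq (hT : IsMesh Ω T) {E : Type*} [AddCommMonoid E]
    (f : Finset (Vec d) → Vec d → E) {s : Finset (Vec d)} (hs : s ∈ cells T) {z : Vec d}
    (hz : z ∈ interior (cell s)) :
    ∑ t ∈ hT.cellFinset, (interior (cell t)).indicator (f t) z = f s z := by
  rw [Finset.sum_eq_single_of_mem s (hT.mem_cellFinset.2 hs), Set.indicator_of_mem hz]
  intro t ht hts
  refine Set.indicator_of_notMem (fun hzt => ?_) _
  exact Set.disjoint_left.1 (disjoint_interior_cell (hT.mem_cellFinset.1 ht) hs hts) hzt hz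

lemma IsMesh.memL2_sum_indicator (hT : IsMesh Ω T) {E : Type*} [NormedAddCommGroup E]
    {f : Finset (Vec d) → Vec d → E} (hf : ∀ s, Continuous (f s)) :
    MemL2 Ω fun z => ∑ t ∈ hT.cellFinset, (interior (cell t)).indicator (f t) z := by
  refine memLp_finsetSum _ fun s _ => ?_
  have h1 : MemLp (f s) 2 (volume.restrict (cell s)) := by
    obtain ⟨M, hM⟩ := (isCompact_cell s).exists_bound_of_continuousOn (hf s).continuousOn
    have : IsFiniteMeasure (volume.restrict (cell s)) :=
      ⟨by simpa using (isCompact_cell s).measure_lt_top⟩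
    exact MemLp.of_bound ((hf s).aestronglyMeasurable) M
      ((ae_restrict_iff' (measurableSet_cell s)).2 (Eventually.of_forall hM))
  have h2 : MemLp ((interior (cell s)).indicator (f s)) 2 volume :=
    (memLp_indicator_iff_restrict isOpen_interior.measurableSet).2
      (h1.mono_measure (Measure.restrict_mono interior_subset le_rfl))
  exact h2.restrict Ω

lemma ae_restrict_inter_cell {s : Finset (Vec d)} {P : Vec d → Prop}
    (h : ∀ z ∈ interior (cell s), P z) : ∀ᵐ z ∂volume.restrict (Ω ∩ cell s), P z := by
  have h1 : ∀ᵐ z ∂volume.restrict (cell s), P z := by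
    rw [← Measure.restrict_congr_set (ae_cell_eq_interior s),
      ae_restrict_iff' isOpen_interior.measurableSet]
    exact Eventually.of_forall h
  exact ae_mono (Measure.restrict_mono Set.inter_subset_right le_rfl) h1

/-- The Raviart-Thomas interpolant has a weak divergence. -/
theorem IsMesh.hasWeakDiv_rtField (hT : IsMesh Ω T) (hd : 1 ≤ d) (hΩ : IsOpen Ω)
    (hreg : interior (closure Ω) = Ω) (v : Fin d → Vec d → ℝ) :
    HasWeakDiv Ω (hT.rtField v) (hT.rtFieldDiv v) := by
  have hm : MemL2 Ω (hT.rtFieldDiv v) := hT.memL2_sum_indicator fun s => continuous_const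
  have hmv : MemL2 Ω (hT.rtField v) := hT.memL2_sum_indicator fun s => continuous_rtLocal v s
  refine ⟨hm, fun φ hφ => ?_⟩
  have hφ1 : ContDiff ℝ 1 φ := hφ.1.of_le (by simp)
  have i1 := integrable_sum_mul_partialDeriv hmv hφ
  have i2 := hm.integrable_mul hφ.memL2
  have i3 : IntegrableOn (fun z => ∑ i, hT.rtField v z i * partialDeriv i φ z +
    hT.rtFieldDiv v z * φ z) Ω := i1.add i2
  rw [eq_neg_iff_add_eq_zero, ← integral_add i1 i2, hT.setIntegral_eq_sum_interior hreg i3]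
  have h1 : ∀ s ∈ hT.cellFinset, ∫ z in interior (cell s),
      (∑ i, hT.rtField v z i * partialDeriv i φ z + hT.rtFieldDiv v z * φ z) =
      -(d * ∑ x ∈ s, ∑ i, volume.real (cell s) *
        baryGrad s x (EuclideanSpace.single i 1) * faceMean (s.erase x) (v i) *
          faceMean (s.erase x) φ) := by
    intro s hs
    have hs' := hT.mem_cellFinset.1 hs
    refine Eq.trans ?_ (integral_cell_rtLocal hd (T.indep hs'.1) hs'.2 v hφ1)
    refine Eq.trans ?_ (setIntegral_interior_cell s _)
    refine setIntegral_congr_fun isOpen_interior.measurableSet fun z hz => ?_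
    have e1 : hT.rtField v z = rtLocal v s z := hT.sum_indicator_eq (rtLocal v) hs' hz
    have e2 : hT.rtFieldDiv v z = rtDiv v s :=
      hT.sum_indicator_eq (fun s _ => rtDiv v s) hs' hz
    simp only [e1, e2, fderiv_apply_eq_sum]
  rw [Finset.sum_congr rfl h1, Finset.sum_neg_distrib, ← Finset.mul_sum,
    hT.sum_flux_eq_zero hd hΩ hreg v hφ, mul_zero, neg_zero]

lemma IsMesh.rtField_mem (hT : IsMesh Ω T) (hd : 1 ≤ d) (hΩ : IsOpen Ω)
    (hreg : interior (closure Ω) = Ω) (v : Fin d → Vec d → ℝ) :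
    hT.rtField v ∈ fluxSpace Ω T := by
  refine ⟨⟨hT.memL2_sum_indicator fun s => continuous_rtLocal v s, _,
    hT.hasWeakDiv_rtField hd hΩ hreg v⟩, fun s hs => ?_⟩
  obtain ⟨a, β, h⟩ := rtLocal_eq v s
  refine ⟨a, β, ae_restrict_inter_cell fun z hz => ?_⟩
  rw [← h]
  exact hT.sum_indicator_eq (rtLocal v) hs hz

/-- Stability of the Raviart-Thomas interpolant. -/
lemma IsMesh.l2norm_rtField_sq_le (hT : IsMesh Ω T) (hd : 1 ≤ d)
    (hbdd : Bornology.IsBounded Ω) (hreg : interior (closure Ω) = Ω) {σ : ℝ}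
    (hσ : IsShapeRegular σ T) {v : Fin d → Vec d → ℝ} (hv : ∀ i, ContDiff ℝ 1 (v i))
    {M : ℝ} (h0 : ∀ i, MemLp (v i) 2 ∧ ∫ z, v i z ^ 2 ≤ M)
    (h1 : ∀ i k, MemLp (partialDeriv k (v i)) 2 ∧ ∫ z, partialDeriv k (v i) z ^ 2 ≤ M) :
    l2norm Ω (hT.rtField v) ^ 2 ≤
      σ ^ 2 * (d + 1) ^ 2 * (d + 1 + Metric.diam (closure Ω) ^ 2) * (d * ((d + 1) * M)) := by
  rw [l2norm_sq_eq_integral]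
  have hm : MemL2 Ω (hT.rtField v) := hT.memL2_sum_indicator fun s => continuous_rtLocal v s
  have hint : IntegrableOn (fun z => ‖hT.rtField v z‖ ^ 2) Ω :=
    MemLp.integrable_norm_pow hm two_ne_zero
  rw [hT.setIntegral_eq_sum_interior hreg hint]
  set Q := σ ^ 2 * (d + 1) ^ 2 * (d + 1 + Metric.diam (closure Ω) ^ 2) with hQ
  have hQ0 : 0 ≤ Q := by positivity
  set f : Fin d → Vec d → ℝ := fun i z => v i z ^ 2 + ∑ k, partialDeriv k (v i) z ^ 2 with hf
  have hfi : ∀ i, Integrable (f i) := fun i =>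
    (h0 i).1.integrable_sq.add (integrable_finsetSum _ fun k _ => (h1 i k).1.integrable_sq)
  have hf0 : ∀ i z, 0 ≤ f i z := fun i z =>
    add_nonneg (sq_nonneg _) (Finset.sum_nonneg fun _ _ => sq_nonneg _)
  have hfM : ∀ i, ∫ z, f i z ≤ (d + 1) * M := by
    intro i
    rw [integral_add (h0 i).1.integrable_sq
      (integrable_finsetSum _ fun k _ => (h1 i k).1.integrable_sq),
      integral_finsetSum _ fun k _ => (h1 i k).1.integrable_sq]
    have := Finset.sum_le_sum fun k (_ : k ∈ (Finset.univ : Finset (Fin d))) => (h1 i k).2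
    simp only [Finset.sum_const, Finset.card_univ, Fintype.card_fin, nsmul_eq_mul] at this
    linarith [(h0 i).2]
  have hcell : ∀ s ∈ hT.cellFinset, ∫ z in interior (cell s), ‖hT.rtField v z‖ ^ 2 ≤
      Q * ∑ i, ∫ z in cell s, f i z := by
    intro s hs
    have hs' := hT.mem_cellFinset.1 hs
    obtain ⟨c₀, r, hr, hball, hdiam⟩ := hσ s hs'
    -- The trace inequality needs only an upper bound on the cell diameters, and this one does not
    -- depend on the mesh.
    have hle : Metric.diam (cell s) ≤ Metric.diam (closure Ω) :=
      Metric.diam_mono (hT.cell_subset_closure hs') hbdd.closure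
    refine le_trans (le_of_eq ?_) (integral_norm_rtLocal_sq_le hd (T.indep hs'.1) hs'.2 hv hr
      hball hdiam hle)
    refine Eq.trans ?_ (setIntegral_interior_cell s _)
    refine setIntegral_congr_fun isOpen_interior.measurableSet fun z hz => ?_
    have e1 : hT.rtField v z = rtLocal v s z := hT.sum_indicator_eq (rtLocal v) hs' hz
    simp only [e1]
  calc _ ≤ ∑ s ∈ hT.cellFinset, Q * ∑ i, ∫ z in cell s, f i z := Finset.sum_le_sum hcell
    _ = Q * ∑ i, ∫ z in Ω, f i z := by
        rw [← Finset.mul_sum, Finset.sum_comm]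
        congr 1
        exact Finset.sum_congr rfl fun i _ => (hT.setIntegral_eq_sum hreg (hfi i).integrableOn).symm
    _ ≤ Q * ∑ _i : Fin d, ((d + 1) * M) := by
        gcongr with i
        exact (setIntegral_le_integral (hfi i) (Eventually.of_forall (hf0 i))).trans (hfM i)
    _ = _ := by simp

end GlobalRT

/-! ### The uniform lifting constant. -/

section Lifting
variable {d : ℕ} {Ω : Set (Vec d)} {T : Geometry.SimplicialComplex ℝ (Vec d)}

/-- Smooth functions with compact support in an open set of finite measure, with the same mass as
its indicator function. -/
lemma exists_smooth_with_mass {U : Set (Vec d)} (hU : IsOpen U) (hne : U.Nonempty)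
    (hfin : volume U ≠ ⊤) : ∃ g : Vec d → ℝ, ContDiff ℝ ∞ g ∧ HasCompactSupport g ∧
      tsupport g ⊆ U ∧ (∀ z, 0 ≤ g z ∧ g z ≤ 2) ∧ ∫ z, g z = volume.real U := by
  have hpos : 0 < volume U := hU.measure_pos volume hne
  -- A compact set with more than half of the volume keeps the normalising factor `|U| / m` at most
  -- `2`.
  obtain ⟨K, hKU, hK, hKv⟩ := hU.exists_lt_isCompact (ENNReal.half_lt_self hpos.ne' hfin)
  obtain ⟨L, hL, hKL, hLU⟩ := exists_compact_between hK hU hKU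
  obtain ⟨f, hf1, hf0, hf⟩ := exists_contMDiffMap_one_nhds_of_subset_interior
    (modelWithCornersSelf ℝ (Vec d)) (n := ⊤) hK.isClosed hKL
  have hfs : ContDiff ℝ ∞ f := f.contMDiff.contDiff
  have hts : tsupport f ⊆ L := by
    refine closure_minimal (fun z hz => ?_) hL.isClosed
    by_contra h
    exact hz (hf0 z h)
  have hfc : HasCompactSupport f := hL.of_isClosed_subset (isClosed_tsupport _) hts
  have hfi : Integrable f := hfs.continuous.integrable_of_hasCompactSupport hfc
  have hUr : 0 < volume.real U := ENNReal.toReal_pos hpos.ne' hfin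
  set m := ∫ z, f z with hm
  have hmK : volume.real K ≤ m := by
    have h1 : volume.real K = ∫ z in K, f z := by
      rw [setIntegral_congr_fun (g := fun _ => (1 : ℝ)) hK.isClosed.measurableSet
        (fun z hz => hf1.self_of_nhdsSet z hz)]
      simp
    rw [h1]
    exact setIntegral_le_integral hfi (Eventually.of_forall fun z => (hf z).1)
  have hmU : volume.real U / 2 ≤ m := by
    refine le_trans ?_ hmK
    have := ENNReal.toReal_mono (hK.measure_lt_top.ne) hKv.le
    simpa [Measure.real] using this
  have hmpos : 0 < m := by linarith
  refine ⟨fun z => volume.real U / m * f z, contDiff_const.mul hfs, hfc.mul_left,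
    (tsupport_mul_subset_right).trans (hts.trans hLU), fun z => ⟨?_, ?_⟩, ?_⟩
  · exact mul_nonneg (by positivity) (hf z).1
  · have h2 : volume.real U / m ≤ 2 := by
      rw [div_le_iff₀ hmpos]; linarith
    calc _ ≤ 2 * 1 := mul_le_mul h2 (hf z).2 (hf z).1 zero_le_two
      _ = 2 := by norm_num
  · rw [integral_const_mul, div_mul_cancel₀ _ hmpos.ne']

lemma nonempty_interior_cell {s : Finset (Vec d)} (hi : AffineIndependent ℝ ((↑) : s → Vec d))
    (hc : s.card = d + 1) : (interior (cell s)).Nonempty := by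
  by_contra h
  rw [Set.not_nonempty_iff_eq_empty] at h
  have h1 := measure_congr (ae_cell_eq_interior s)
  rw [h, measure_empty] at h1
  have h2 := volume_cell_pos hi hc
  rw [Measure.real, ← h1] at h2
  simp at h2

lemma measureReal_interior_cell (s : Finset (Vec d)) :
    volume.real (interior (cell s)) = volume.real (cell s) := by
  rw [Measure.real, measure_congr (ae_cell_eq_interior s), Measure.real]

/-- A piecewise constant function has the cell averages of some smooth function with compact
support and comparable norm. -/
lemma IsMesh.exists_smooth_average (hT : IsMesh Ω T) (hΩ : IsOpen Ω)
    (hreg : interior (closure Ω) = Ω) {w : Vec d → ℝ} (hw : w ∈ pressureSpace Ω T) :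
    ∃ g : Vec d → ℝ, ContDiff ℝ ∞ g ∧ HasCompactSupport g ∧ tsupport g ⊆ Ω ∧
      ∫ z, g z ^ 2 ≤ 4 * l2norm Ω w ^ 2 ∧
      ∀ s ∈ cells T, ∀ᵐ z ∂volume.restrict (Ω ∩ cell s),
        volume.real (cell s) * w z = ∫ y in cell s, g y := by
  classical
  have hex : ∀ s : Finset (Vec d), ∃ (c : ℝ) (g : Vec d → ℝ), s ∈ cells T →
      (∀ᵐ z ∂volume.restrict (Ω ∩ cell s), w z = c) ∧ ContDiff ℝ ∞ g ∧ HasCompactSupport g ∧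
      tsupport g ⊆ interior (cell s) ∧ (∀ z, 0 ≤ g z ∧ g z ≤ 2) ∧
      ∫ z, g z = volume.real (cell s) := by
    intro s
    by_cases hs : s ∈ cells T
    · obtain ⟨c, hc⟩ := hw.2 s hs
      obtain ⟨g, h1, h2, h3, h4, h5⟩ := exists_smooth_with_mass (U := interior (cell s))
        isOpen_interior (nonempty_interior_cell (T.indep hs.1) hs.2)
        ((measure_mono interior_subset).trans_lt (isCompact_cell s).measure_lt_top).ne
      rw [measureReal_interior_cell] at h5
      exact ⟨c, g, fun _ => ⟨hc, h1, h2, h3, h4, h5⟩⟩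
    · exact ⟨0, 0, fun h => absurd h hs⟩
  choose c g hg using hex
  have hg' : ∀ s ∈ hT.cellFinset, _ := fun s hs => hg s (hT.mem_cellFinset.1 hs)
  -- One bump inside each cell, of mass equal to the volume, keeps the cell averages. Bumps are
  -- bounded by `2` with disjoint supports, whence the factor `4` for squared norms.
  set G : Vec d → ℝ := fun z => ∑ s ∈ hT.cellFinset, c s * g s z with hG
  have hGs : ContDiff ℝ ∞ G := ContDiff.sum fun s hs => contDiff_const.mul (hg' s hs).2.1
  have hzero : ∀ s ∈ hT.cellFinset, ∀ z ∉ interior (cell s), g s z = 0 := fun s hs z hz =>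
    image_eq_zero_of_notMem_tsupport fun h => hz ((hg' s hs).2.2.2.1 h)
  have hGts : tsupport G ⊆ ⋃ s ∈ hT.cellFinset, tsupport (g s) := by
    refine closure_minimal (fun z hz => ?_)
      (Set.Finite.isClosed_biUnion (Finset.finite_toSet _) fun s _ => isClosed_tsupport _)
    by_contra h
    refine hz (Finset.sum_eq_zero fun s hs => ?_)
    rw [image_eq_zero_of_notMem_tsupport fun h' => h (Set.mem_iUnion₂.2 ⟨s, hs, h'⟩), mul_zero]
  have hGcell : ∀ s ∈ hT.cellFinset, ∀ z ∈ interior (cell s), G z = c s * g s z := by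
    intro s hs z hz
    refine Finset.sum_eq_single_of_mem s hs fun t ht hts => ?_
    rw [hzero t ht z (fun hzt => Set.disjoint_left.1 (disjoint_interior_cell
      (hT.mem_cellFinset.1 ht) (hT.mem_cellFinset.1 hs) hts) hzt hz), mul_zero]
  have hGΩ : tsupport G ⊆ Ω := hGts.trans (Set.iUnion₂_subset fun s hs =>
    (hg' s hs).2.2.2.1.trans (hT.interior_cell_subset hreg (hT.mem_cellFinset.1 hs)))
  have hGc : HasCompactSupport G := by
    refine IsCompact.of_isClosed_subset ?_ (isClosed_tsupport _) hGts
    exact (Finset.finite_toSet hT.cellFinset).isCompact_biUnion fun s hs => (hg' s hs).2.2.1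
  have hmem : MemL2 Ω G := (hGs.continuous.memLp_of_hasCompactSupport hGc).restrict Ω
  refine ⟨G, hGs, hGc, hGΩ, ?_, fun s hs => ?_⟩
  · have e1 : ∫ z, G z ^ 2 = ∫ z in Ω, G z ^ 2 :=
      (setIntegral_eq_integral_of_forall_compl_eq_zero fun z hz => by
        rw [image_eq_zero_of_notMem_tsupport (fun h => hz (hGΩ h))]; ring).symm
    have hwi : IntegrableOn (fun z => w z ^ 2) Ω := hw.1.integrable_sq
    have e2 : l2norm Ω w ^ 2 = ∫ z in Ω, w z ^ 2 := by
      rw [l2norm_sq_eq_integral]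
      simp_rw [Real.norm_eq_abs, sq_abs]
    rw [e1, e2, hT.setIntegral_eq_sum_interior hreg hmem.integrable_sq,
      hT.setIntegral_eq_sum_interior hreg hwi, Finset.mul_sum]
    refine Finset.sum_le_sum fun s hs => ?_
    have hs' := hT.mem_cellFinset.1 hs
    have hsub := hT.interior_cell_subset hreg hs'
    rw [← integral_const_mul]
    refine setIntegral_mono_on_ae (hmem.integrable_sq.mono_measure
      (Measure.restrict_mono hsub le_rfl)) ((hwi.mono_set hsub).const_mul 4)
      isOpen_interior.measurableSet ?_
    have hc := (ae_restrict_iff' (hΩ.measurableSet.inter (measurableSet_cell s))).1 (hg' s hs).1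
    filter_upwards [hc] with z hz hzi
    rw [hGcell s hs z hzi, hz ⟨hsub hzi, interior_subset hzi⟩]
    have h4 : g s z ^ 2 ≤ 4 := by nlinarith [((hg' s hs).2.2.2.2.1 z).1, ((hg' s hs).2.2.2.2.1 z).2]
    nlinarith [sq_nonneg (c s)]
  · have hs' := hT.mem_cellFinset.2 hs
    have e1 : ∫ y in cell s, G y = volume.real (cell s) * c s := by
      rw [← setIntegral_interior_cell, setIntegral_congr_fun isOpen_interior.measurableSet
        (hGcell s hs'), integral_const_mul,
        setIntegral_eq_integral_of_forall_compl_eq_zero (hzero s hs'), (hg s hs).2.2.2.2.2,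
        mul_comm]
    filter_upwards [(hg s hs).1] with z hz
    rw [hz, e1]

/-- The divergence is uniformly surjective from the lowest order Raviart-Thomas space onto the
piecewise constants, for all shape regular meshes. -/
theorem exists_divLiftingConstant (hd : 1 ≤ d) (hΩ : IsOpen Ω) (hbdd : Bornology.IsBounded Ω)
    (hreg : interior (closure Ω) = Ω) (σ : ℝ) : ∃ C : ℝ, 0 < C ∧
      ∀ T : Geometry.SimplicialComplex ℝ (Vec d), IsMesh Ω T → IsShapeRegular σ T →
        IsDivLiftingConstant Ω T C := by
  obtain ⟨R, hR0, hR⟩ := hbdd.closure.subset_closedBall_lt 0 (0 : Vec d)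
  obtain ⟨c, hc, hlift⟩ := exists_smooth_lifting hd hR0
  set Q := σ ^ 2 * (d + 1) ^ 2 * (d + 1 + Metric.diam (closure Ω) ^ 2) *
    (d * ((d + 1) * (c * 4))) with hQ
  have hQ0 : 0 ≤ Q := by positivity
  -- The summand `1` only ensures positivity of the constant: `Q` vanishes for `σ = 0`.
  refine ⟨√Q + 1, by positivity, fun T hT hσ w hw => ?_⟩
  obtain ⟨g, hg, hgc, hgs, hgw, hgm⟩ := hT.exists_smooth_average hΩ hreg hw
  obtain ⟨v, hv, hdiv, h0, h1⟩ := hlift g hg hgc ((hgs.trans subset_closure).trans hR)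
  have hle : c * ∫ z, g z ^ 2 ≤ c * 4 * l2norm Ω w ^ 2 := by
    rw [mul_assoc]
    exact mul_le_mul_of_nonneg_left hgw hc.le
  refine ⟨hT.rtField v, hT.rtField_mem hd hΩ hreg v, ?_, ?_⟩
  · refine ((hT.hasWeakDiv_rtField hd hΩ hreg v).weakDiv_ae_eq hΩ).trans ?_
    have hall : ∀ᵐ z, ∀ s ∈ hT.cellFinset, z ∈ Ω ∩ cell s →
        volume.real (cell s) * w z = ∫ y in cell s, g y := by
      refine (ae_ball_iff (S := (hT.cellFinset : Set (Finset (Vec d))))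
        hT.cellFinset.countable_toSet).2 fun s hs => ?_
      exact (ae_restrict_iff' (hΩ.measurableSet.inter (measurableSet_cell s))).1
        (hgm s (hT.mem_cellFinset.1 hs))
    have hmem := (hT.ae_eq_biUnion hreg).mem_iff
    rw [EventuallyEq, ae_restrict_iff' hΩ.measurableSet]
    filter_upwards [hall, hmem] with z hz hzm hzΩ
    obtain ⟨s, hs, hzs⟩ := Set.mem_iUnion₂.1 (hzm.1 hzΩ)
    have hs' := hT.mem_cellFinset.1 hs
    have e1 : hT.rtFieldDiv v z = rtDiv v s :=
      hT.sum_indicator_eq (fun s _ => rtDiv v s) hs' hzs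
    have e2 := hz s hs ⟨hzΩ, interior_subset hzs⟩
    have e3 := volume_mul_rtDiv hd (T.indep hs'.1) hs'.2 hv
    have e4 : ∫ y in cell s, ∑ i, partialDeriv i (v i) y = ∫ y in cell s, g y :=
      setIntegral_congr_fun (measurableSet_cell s) fun y hy =>
        hdiv y (hR (hT.cell_subset_closure hs' hy))
    rw [e1]
    -- Times the volume of the cell, the divergence of the interpolant is the integral of `div v`,
    -- hence that of `g`, hence the volume times `w`.
    exact mul_left_cancel₀ (volume_cell_pos (T.indep hs'.1) hs'.2).ne'
      (e3.trans (e4.trans e2.symm))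
  · have hb := hT.l2norm_rtField_sq_le hd hbdd hreg hσ hv
      (fun i => ⟨(h0 i).1, (h0 i).2.trans hle⟩) (fun i k => ⟨(h1 i k).1, (h1 i k).2.trans hle⟩)
    have hb' : l2norm Ω (hT.rtField v) ^ 2 ≤ (√Q * l2norm Ω w) ^ 2 := by
      rw [mul_pow, Real.sq_sqrt hQ0]
      refine hb.trans (le_of_eq ?_)
      rw [hQ]
      ring
    have := le_of_sq_le_sq hb' (mul_nonneg (Real.sqrt_nonneg _) (l2norm_nonneg _))
    nlinarith [l2norm_nonneg (Ω := Ω) w]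

end Lifting

/-! ### Strain, Poincaré's inequality and Korn's inequality on `H¹₀`. -/

section Korn
variable {d : ℕ} {Ω : Set (Vec d)}

lemma MemH1.memL2_strain {z : Vec d → Vec d} (hz : MemH1 Ω z) (i j : Fin d) :
    MemL2 Ω fun x => strain Ω z x i j := by
  have h := ((hz.hasWeakPartial j i).1.add (hz.hasWeakPartial i j).1).mul_const (2⁻¹ : ℝ)
  refine (memLp_congr_ae (Eventually.of_forall fun x => ?_)).1 h
  simp [strain, div_eq_mul_inv]

lemma strainInner_eq_sum {y z : Vec d → Vec d} (hy : MemH1 Ω y) (hz : MemH1 Ω z) :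
    strainInner Ω y z =
      ∑ i, ∑ j, l2inner Ω (fun x => strain Ω y x i j) fun x => strain Ω z x i j := by
  have hint : ∀ i j, Integrable (fun x => strain Ω y x i j * strain Ω z x i j)
      (volume.restrict Ω) := fun i j => (hy.memL2_strain i j).integrable_mul (hz.memL2_strain i j)
  rw [strainInner, integral_finsetSum _ fun i _ => integrable_finsetSum _ fun j _ => hint i j]
  refine Finset.sum_congr rfl fun i _ => ?_
  rw [integral_finsetSum _ fun j _ => hint i j]
  refine Finset.sum_congr rfl fun j _ => ?_
  rw [l2inner]
  refine integral_congr_ae (Eventually.of_forall fun x => ?_)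
  simp [mul_comm]

lemma strainInner_self_eq_sum {z : Vec d → Vec d} (hz : MemH1 Ω z) :
    strainInner Ω z z = ∑ i, ∑ j, l2norm Ω (fun x => strain Ω z x i j) ^ 2 := by
  rw [strainInner_eq_sum hz hz]
  simp_rw [l2norm_sq]

lemma strainInner_self_nonneg (z : Vec d → Vec d) : 0 ≤ strainInner Ω z z :=
  integral_nonneg fun _ => Finset.sum_nonneg fun _ _ => Finset.sum_nonneg fun _ _ =>
    mul_self_nonneg _

lemma MemH1.strain_sub (hΩ : IsOpen Ω) {y z : Vec d → Vec d} (hy : MemH1 Ω y) (hz : MemH1 Ω z)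
    (i j : Fin d) : (fun x => strain Ω (y - z) x i j) =ᵐ[volume.restrict Ω]
      (fun x => strain Ω y x i j) - fun x => strain Ω z x i j := by
  filter_upwards [hy.weakPartial_sub hΩ hz i j, hy.weakPartial_sub hΩ hz j i] with x h1 h2
  simp only [strain, Matrix.of_apply, Pi.sub_apply] at h1 h2 ⊢
  rw [h1, h2]
  ring

lemma strainInner_sub_left (hΩ : IsOpen Ω) {y y' z : Vec d → Vec d} (hy : MemH1 Ω y)
    (hy' : MemH1 Ω y') (hz : MemH1 Ω z) :
    strainInner Ω (y - y') z = strainInner Ω y z - strainInner Ω y' z := by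
  rw [strainInner_eq_sum (hy.sub hy') hz, strainInner_eq_sum hy hz, strainInner_eq_sum hy' hz,
    ← Finset.sum_sub_distrib]
  refine Finset.sum_congr rfl fun i _ => ?_
  rw [← Finset.sum_sub_distrib]
  refine Finset.sum_congr rfl fun j _ => ?_
  rw [l2inner_congr (hy.strain_sub hΩ hy' i j) ae_eq_rfl,
    l2inner_sub_left (hy.memL2_strain i j) (hy'.memL2_strain i j) (hz.memL2_strain i j)]

lemma partialDeriv_comm {φ : Vec d → ℝ} (hφ : ContDiff ℝ 2 φ) (i j : Fin d) (x : Vec d) :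
    partialDeriv i (partialDeriv j φ) x = partialDeriv j (partialDeriv i φ) x := by
  have hd : DifferentiableAt ℝ (fderiv ℝ φ) x :=
    (hφ.fderiv_right (m := 1) (by norm_num)).differentiable one_ne_zero x
  have h : ∀ k l : Fin d, partialDeriv k (partialDeriv l φ) x =
      fderiv ℝ (fderiv ℝ φ) x (EuclideanSpace.single k 1) (EuclideanSpace.single l 1) := by
    intro k l
    have h1 : HasFDerivAt (fun y => fderiv ℝ φ y (EuclideanSpace.single l 1)) _ x :=
      hd.hasFDerivAt.clm_apply (hasFDerivAt_const _ _)
    change fderiv ℝ (fun y => fderiv ℝ φ y (EuclideanSpace.single l 1)) x _ = _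
    rw [h1.fderiv]
    simp
  rw [h, h]
  exact (hφ.contDiffAt.isSymmSndFDerivAt (by simp)) _ _

lemma contDiff_partialDeriv {φ : Vec d → ℝ} (hφ : ContDiff ℝ 2 φ) (i : Fin d) :
    ContDiff ℝ 1 (partialDeriv i φ) :=
  (hφ.fderiv_right (m := 1) (by norm_num)).clm_apply contDiff_const

/-- Two integrations by parts and the symmetry of second derivatives. In Korn's inequality this
exchanges the derivatives in the mixed terms. -/
lemma integral_partialDeriv_mul_partialDeriv {φ ψ : Vec d → ℝ} (hφ : ContDiff ℝ 2 φ)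
    (hψ : ContDiff ℝ 2 ψ) (hψc : HasCompactSupport ψ) (i j : Fin d) :
    ∫ x, partialDeriv i φ x * partialDeriv j ψ x = ∫ x, partialDeriv j φ x * partialDeriv i ψ x := by
  have h1 := integral_mul_partialDeriv (contDiff_partialDeriv hφ i) (hψ.of_le one_le_two) hψc j
  have h2 := integral_mul_partialDeriv (contDiff_partialDeriv hφ j) (hψ.of_le one_le_two) hψc i
  simp only [partialDeriv_comm hφ j i] at h1
  rw [h1, h2]

lemma IsTestFunction.contDiff_two {φ : Vec d → ℝ} (hφ : IsTestFunction Ω φ) : ContDiff ℝ 2 φ :=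
  contDiff_infty.1 hφ.1 2

/-- The Poincaré inequality for test functions. -/
lemma IsTestFunction.poincare {φ : Vec d → ℝ} (hφ : IsTestFunction Ω φ) {R : ℝ}
    (hR : ∀ x ∈ Ω, ‖x‖ ≤ R) (i : Fin d) :
    l2norm Ω φ ^ 2 ≤ 4 * R ^ 2 * l2norm Ω (partialDeriv i φ) ^ 2 := by
  have hφ1 : ContDiff ℝ 1 φ := hφ.1.of_le (by simp)
  have hxi : ContDiff ℝ 1 fun x : Vec d => x i := by fun_prop
  have hf : ContDiff ℝ 1 fun x : Vec d => x i * φ x := hxi.mul hφ1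
  have hibp := integral_mul_partialDeriv hf hφ1 hφ.2.1 i
  have hder : ∀ x, partialDeriv i (fun x : Vec d => x i * φ x) x = φ x + x i * partialDeriv i φ x := by
    intro x
    have h1 : HasFDerivAt (fun x : Vec d => x i) (EuclideanSpace.proj (𝕜 := ℝ) i : Vec d →L[ℝ] ℝ) x :=
      (EuclideanSpace.proj (𝕜 := ℝ) i : Vec d →L[ℝ] ℝ).hasFDerivAt
    have h2 := h1.mul (hφ1.differentiable one_ne_zero x).hasFDerivAt
    have h3 : fderiv ℝ (fun x : Vec d => x i * φ x) x = _ := h2.fderiv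
    rw [partialDeriv, h3]
    simp [partialDeriv]
    ring
  simp only [hder] at hibp
  have hc1 := hφ1.continuous
  have hc2 := continuous_partialDeriv hφ1 i
  have hcx := hxi.continuous
  have i1 : Integrable fun x => φ x * φ x :=
    (hc1.mul hc1).integrable_of_hasCompactSupport hφ.2.1.mul_left
  have i2 : Integrable fun x : Vec d => x i * φ x * partialDeriv i φ x :=
    ((hcx.mul hc1).mul hc2).integrable_of_hasCompactSupport
      (hasCompactSupport_partialDeriv hφ.2.1 i).mul_left
  have i3 : Integrable fun x => partialDeriv i φ x ^ 2 :=
    (hc2.memLp_of_hasCompactSupport (hasCompactSupport_partialDeriv hφ.2.1 i)).integrable_sq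
  have e1 : ∀ x : Vec d, (φ x + x i * partialDeriv i φ x) * φ x =
      φ x * φ x + x i * φ x * partialDeriv i φ x := fun x => by ring
  simp only [e1] at hibp
  rw [integral_add i1 i2] at hibp
  have e2 : l2norm Ω φ ^ 2 = ∫ x, φ x * φ x := by
    rw [l2norm_sq_eq_integral, setIntegral_eq_integral_of_forall_compl_eq_zero]
    · simp [pow_two]
    · intro x hx
      rw [image_eq_zero_of_notMem_tsupport fun h => hx (hφ.2.2 h)]
      simp
  have e3 : l2norm Ω (partialDeriv i φ) ^ 2 = ∫ x, partialDeriv i φ x ^ 2 := by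
    rw [l2norm_sq_eq_integral, setIntegral_eq_integral_of_forall_compl_eq_zero]
    · simp
    · intro x hx
      rw [image_eq_zero_of_notMem_tsupport fun h =>
        hx (hφ.2.2 (tsupport_partialDeriv_subset φ i h))]
      simp
  rw [e2, e3]
  -- Integration by parts gave `∫ φ² = -2 ∫ xᵢ φ ∂ᵢφ`. Young's inequality leaves half of `∫ φ²` on
  -- the right, and absorbing it doubles `2 R²` to `4 R²`.
  have hle : ∫ x, -2 * (x i * φ x * partialDeriv i φ x) ≤
      ∫ x, (1 / 2 * (φ x * φ x) + 2 * R ^ 2 * partialDeriv i φ x ^ 2) := by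
    refine integral_mono (i2.const_mul _) ((i1.const_mul _).add (i3.const_mul _)) fun x => ?_
    by_cases hx : x ∈ Ω
    · have h1 : |x i| ≤ R := (abs_coord_le_norm x i).trans (hR x hx)
      have h2 : x i ^ 2 ≤ R ^ 2 := sq_le_sq' (by linarith [neg_abs_le (x i)])
        ((le_abs_self _).trans h1)
      have h3 := mul_le_mul_of_nonneg_right h2 (sq_nonneg (partialDeriv i φ x))
      have h4 := sq_nonneg (φ x + 2 * (x i * partialDeriv i φ x))
      change -2 * (x i * φ x * partialDeriv i φ x) ≤
        1 / 2 * (φ x * φ x) + 2 * R ^ 2 * partialDeriv i φ x ^ 2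
      linarith [h3, h4, (by ring : (φ x + 2 * (x i * partialDeriv i φ x)) ^ 2 = φ x * φ x +
        4 * (x i * φ x * partialDeriv i φ x) + 4 * (x i ^ 2 * partialDeriv i φ x ^ 2))]
    · have : φ x = 0 := image_eq_zero_of_notMem_tsupport fun h => hx (hφ.2.2 h)
      simp only [this]
      have := mul_nonneg (sq_nonneg R) (sq_nonneg (partialDeriv i φ x))
      linarith
  rw [integral_const_mul, integral_add (i1.const_mul _) (i3.const_mul _), integral_const_mul,
    integral_const_mul] at hle
  linarith

/-- Korn's first inequality for test functions. -/
lemma IsTestFunction.korn (hΩ : IsOpen Ω) {φ : Vec d → Vec d} (hφ : IsTestFunction Ω φ) :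
    ∑ i, ∑ j, l2norm Ω (weakPartial Ω i fun x => φ x j) ^ 2 ≤ 2 * strainInner Ω φ φ := by
  have hw : ∀ i j, weakPartial Ω i (fun x => φ x j) =ᵐ[volume.restrict Ω]
      partialDeriv i fun x => φ x j := fun i j =>
    ((hφ.coord j).hasWeakPartial i).weakPartial_ae_eq hΩ
  set a : Fin d → Fin d → Vec d → ℝ := fun i j => partialDeriv i fun x => φ x j with ha
  have hm : ∀ i j, MemL2 Ω (a i j) := fun i j => (hφ.coord j).memL2_partialDeriv i
  have h1 : ∀ i j, l2norm Ω (weakPartial Ω i fun x => φ x j) ^ 2 = ∫ x in Ω, a i j x * a i j x := by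
    intro i j
    rw [l2norm_congr (hw i j), l2norm_sq_eq_integral]
    simp [pow_two, ha]
  have hall : ∀ᵐ x ∂volume.restrict Ω, ∀ i j, weakPartial Ω i (fun x => φ x j) x = a i j x := by
    rw [ae_all_iff]; intro i; rw [ae_all_iff]; exact fun j => hw i j
  have himul : ∀ i j k l, Integrable (fun x => a i j x * a k l x) (volume.restrict Ω) :=
    fun i j k l => (hm i j).integrable_mul (hm k l)
  have h2 : 2 * strainInner Ω φ φ = (∑ i, ∑ j, ∫ x in Ω, a i j x * a i j x) +
      ∑ i, ∑ j, ∫ x in Ω, a i j x * a j i x := by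
    have e : strainInner Ω φ φ = ∫ x in Ω, ∑ i, ∑ j,
        (1 / 4 * (a j i x * a j i x) + 1 / 4 * (a i j x * a i j x) + 1 / 2 * (a i j x * a j i x)) := by
      refine integral_congr_ae ?_
      filter_upwards [hall] with x hx
      refine Finset.sum_congr rfl fun i _ => Finset.sum_congr rfl fun j _ => ?_
      simp only [strain, Matrix.of_apply, hx]
      ring
    have hint : ∀ i j, Integrable (fun x => 1 / 4 * (a j i x * a j i x) +
        1 / 4 * (a i j x * a i j x) + 1 / 2 * (a i j x * a j i x)) (volume.restrict Ω) :=
      fun i j => (((himul j i j i).const_mul _).add ((himul i j i j).const_mul _)).add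
        ((himul i j j i).const_mul _)
    have e' : ∀ i j, ∫ x in Ω, (1 / 4 * (a j i x * a j i x) +
        1 / 4 * (a i j x * a i j x) + 1 / 2 * (a i j x * a j i x)) =
        1 / 4 * (∫ x in Ω, a j i x * a j i x) + 1 / 4 * (∫ x in Ω, a i j x * a i j x) +
          1 / 2 * ∫ x in Ω, a i j x * a j i x := by
      intro i j
      have h12 : Integrable (fun x => 1 / 4 * (a j i x * a j i x) + 1 / 4 * (a i j x * a i j x))
          (volume.restrict Ω) := ((himul j i j i).const_mul _).add ((himul i j i j).const_mul _)
      rw [integral_add h12 ((himul i j j i).const_mul _), integral_add ((himul j i j i).const_mul _)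
        ((himul i j i j).const_mul _), integral_const_mul, integral_const_mul, integral_const_mul]
    rw [e, integral_finsetSum _ fun i _ => integrable_finsetSum _ fun j _ => hint i j]
    have e'' : ∀ i, ∫ x in Ω, ∑ j, (1 / 4 * (a j i x * a j i x) + 1 / 4 * (a i j x * a i j x) +
        1 / 2 * (a i j x * a j i x)) = ∑ j, (1 / 4 * (∫ x in Ω, a j i x * a j i x) +
          1 / 4 * (∫ x in Ω, a i j x * a i j x) + 1 / 2 * ∫ x in Ω, a i j x * a j i x) := by
      intro i
      rw [integral_finsetSum _ fun j _ => hint i j]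
      exact Finset.sum_congr rfl fun j _ => e' i j
    rw [Finset.sum_congr rfl fun i _ => e'' i]
    simp only [Finset.sum_add_distrib, ← Finset.mul_sum]
    rw [Finset.sum_comm (f := fun i j => ∫ x in Ω, a j i x * a j i x)]
    ring
  -- The mixed terms add up to the square of the divergence, which is non-negative and can be
  -- dropped.
  have h3 : ∑ i, ∑ j, ∫ x in Ω, a i j x * a j i x = ∫ x in Ω, (∑ i, a i i x) ^ 2 := by
    have e : ∀ x, (∑ i, a i i x) ^ 2 = ∑ i, ∑ j, a j j x * a i i x := fun x => by
      rw [pow_two, Finset.sum_mul_sum, Finset.sum_comm]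
    simp only [e]
    rw [integral_finsetSum _ fun i _ => integrable_finsetSum _ fun j _ => himul j j i i]
    refine Finset.sum_congr rfl fun i _ => ?_
    rw [integral_finsetSum _ fun j _ => himul j j i i]
    refine Finset.sum_congr rfl fun j _ => ?_
    have hs : ∀ (i j k l : Fin d), ∫ x in Ω, a i j x * a k l x = ∫ x, a i j x * a k l x :=
      fun i j k l => setIntegral_eq_integral_of_tsupport_subset
        (tsupport_mul_subset_left.trans ((tsupport_partialDeriv_subset _ i).trans (hφ.coord j).2.2))
    rw [hs, hs]
    exact integral_partialDeriv_mul_partialDeriv (hφ.coord j).contDiff_two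
      (hφ.coord i).contDiff_two (hφ.coord i).2.1 i j
  rw [h2, h3]
  simp only [h1]
  have h4 : 0 ≤ ∫ x in Ω, (∑ i, a i i x) ^ 2 := integral_nonneg fun _ => sq_nonneg _
  linarith

lemma l2norm_sq_eq_sum {v : Vec d → Vec d} (hv : MemL2 Ω v) :
    l2norm Ω v ^ 2 = ∑ j, l2norm Ω (fun x => v x j) ^ 2 := by
  simp only [l2norm_sq_eq_integral, EuclideanSpace.real_norm_sq_eq, Real.norm_eq_abs, sq_abs]
  exact integral_finsetSum _ fun j _ => (hv.coord j).integrable_sq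

lemma tendsto_l2norm {E : Type*} [NormedAddCommGroup E] [InnerProductSpace ℝ E] {f : Vec d → E}
    {g : ℕ → Vec d → E} (hf : MemL2 Ω f)
    (hg : ∀ n, MemL2 Ω (g n)) (h : Tendsto (fun n => l2norm Ω (f - g n)) atTop (𝓝 0)) :
    Tendsto (fun n => l2norm Ω (g n)) atTop (𝓝 (l2norm Ω f)) := by
  rw [tendsto_iff_dist_tendsto_zero]
  refine squeeze_zero (fun _ => dist_nonneg) (fun n => ?_) h
  rw [dist_comm, Real.dist_eq, l2norm_eq_norm hf, l2norm_eq_norm (hg n),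
    l2norm_eq_norm (hf.sub (hg n)), MemLp.toLp_sub]
  exact abs_norm_sub_norm_le _ _

lemma h1norm_sq (z : Vec d → Vec d) : h1norm Ω z ^ 2 =
    l2norm Ω z ^ 2 + ∑ i, ∑ j, l2norm Ω (weakPartial Ω i fun x => z x j) ^ 2 :=
  Real.sq_sqrt (add_nonneg (sq_nonneg _) (Finset.sum_nonneg fun _ _ =>
    Finset.sum_nonneg fun _ _ => sq_nonneg _))

/-- On `H¹₀` the norm of `H¹` is controlled by the strain. -/
theorem MemH10.h1norm_sq_le (hd : 1 ≤ d) (hΩ : IsOpen Ω) {R : ℝ} (hR : ∀ x ∈ Ω, ‖x‖ ≤ R)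
    {z : Vec d → Vec d} (hz : MemH10 Ω z) :
    h1norm Ω z ^ 2 ≤ (4 * R ^ 2 + 1) * (2 * strainInner Ω z z) := by
  obtain ⟨hz1, φ, hφ, hφt⟩ := hz
  have hφ1 := fun n => (hφ n).memH1
  have htest : ∀ n, h1norm Ω (φ n) ^ 2 ≤ (4 * R ^ 2 + 1) * (2 * strainInner Ω (φ n) (φ n)) := by
    intro n
    have hk := (hφ n).korn hΩ
    set G := ∑ i, ∑ j, l2norm Ω (weakPartial Ω i fun x => φ n x j) ^ 2 with hG
    have hp : l2norm Ω (φ n) ^ 2 ≤ 4 * R ^ 2 * G := by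
      rw [l2norm_sq_eq_sum (hφ n).memL2]
      have i₀ : Fin d := ⟨0, hd⟩
      calc _ ≤ ∑ j, 4 * R ^ 2 * l2norm Ω (weakPartial Ω i₀ fun x => φ n x j) ^ 2 := by
            refine Finset.sum_le_sum fun j _ => ?_
            rw [l2norm_congr (((hφ n).coord j).hasWeakPartial i₀ |>.weakPartial_ae_eq hΩ)]
            exact ((hφ n).coord j).poincare hR i₀
        _ = 4 * R ^ 2 * ∑ j, l2norm Ω (weakPartial Ω i₀ fun x => φ n x j) ^ 2 := by
            rw [Finset.mul_sum]
        _ ≤ _ := by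
            refine mul_le_mul_of_nonneg_left ?_ (by positivity)
            exact Finset.single_le_sum
              (f := fun i => ∑ j, l2norm Ω (weakPartial Ω i fun x => φ n x j) ^ 2)
              (fun _ _ => Finset.sum_nonneg fun _ _ => sq_nonneg _) (Finset.mem_univ i₀)
    rw [h1norm_sq, ← hG]
    calc _ ≤ (4 * R ^ 2 + 1) * G := by linarith
      _ ≤ _ := mul_le_mul_of_nonneg_left hk (by positivity)
  rw [tendsto_h1norm_zero_iff] at hφt
  have hdt : ∀ i j, Tendsto (fun n => l2norm Ω ((weakPartial Ω i fun x => z x j) -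
      weakPartial Ω i fun x => φ n x j)) atTop (𝓝 0) := fun i j => by
    refine (hφt.2 i j).congr fun n => l2norm_congr (hz1.weakPartial_sub hΩ (hφ1 n) i j)
  -- Both sides of the bound are continuous along the approximating test functions, so it passes to
  -- the limit.
  have hL : Tendsto (fun n => h1norm Ω (φ n) ^ 2) atTop (𝓝 (h1norm Ω z ^ 2)) := by
    simp only [h1norm_sq]
    refine ((tendsto_l2norm hz1.1 (fun n => (hφ1 n).1) hφt.1).pow 2).add
      (tendsto_finsetSum _ fun i _ => tendsto_finsetSum _ fun j _ => Tendsto.pow ?_ 2)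
    exact tendsto_l2norm (hz1.hasWeakPartial i j).1 (fun n => ((hφ1 n).hasWeakPartial i j).1)
      (hdt i j)
  have hS : Tendsto (fun n => strainInner Ω (φ n) (φ n)) atTop (𝓝 (strainInner Ω z z)) := by
    simp only [strainInner_self_eq_sum hz1, fun n => strainInner_self_eq_sum (hφ1 n)]
    refine tendsto_finsetSum _ fun i _ => tendsto_finsetSum _ fun j _ => Tendsto.pow ?_ 2
    refine tendsto_l2norm (hz1.memL2_strain i j) (fun n => (hφ1 n).memL2_strain i j) ?_
    refine squeeze_zero (fun _ => l2norm_nonneg _) (fun n => ?_)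
      (by simpa using (hdt j i).add (hdt i j))
    have m1 := (hz1.hasWeakPartial j i).1.sub ((hφ1 n).hasWeakPartial j i).1
    have m2 := (hz1.hasWeakPartial i j).1.sub ((hφ1 n).hasWeakPartial i j).1
    have m3 := (hz1.memL2_strain i j).sub ((hφ1 n).memL2_strain i j)
    have e : MemLp.toLp _ m3 = (2⁻¹ : ℝ) • (MemLp.toLp _ m1 + MemLp.toLp _ m2) := by
      rw [← MemLp.toLp_add (p := 2) m1 m2, ← MemLp.toLp_const_smul]
      refine MemLp.toLp_congr _ _ (Eventually.of_forall fun x => ?_)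
      simp only [strain, Matrix.of_apply, Pi.sub_apply, Pi.add_apply, Pi.smul_apply, smul_eq_mul]
      ring
    rw [l2norm_eq_norm m1, l2norm_eq_norm m2, l2norm_eq_norm m3, e, norm_smul]
    have := norm_add_le (MemLp.toLp _ m1) (MemLp.toLp _ m2)
    have h0 := norm_nonneg (MemLp.toLp _ m1 + MemLp.toLp _ m2)
    rw [Real.norm_of_nonneg (by norm_num)]
    linarith
  exact le_of_tendsto_of_tendsto' hL ((hS.const_mul 2).const_mul _) htest

end Korn

/-! ### Monotone non-linearities and the quadratic inequality behind the scheme. -/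

section Nonlinearity
variable {d : ℕ} {Ω : Set (Vec d)}

/-- The mean value theorem turns the non-linearity into multiplication by a slope. The slope is used
pointwise only, so its measurability in `x` plays no role. -/
lemma exists_sub_eq_mul_sub {g : ℝ → ℝ} {m L : ℝ} (hg : Differentiable ℝ g)
    (hg' : ∀ s, m ≤ deriv g s ∧ deriv g s ≤ L) (s t : ℝ) :
    ∃ β, m ≤ β ∧ β ≤ L ∧ g s - g t = β * (s - t) := by
  rcases lt_trichotomy s t with h | rfl | h
  · obtain ⟨c, -, hc⟩ := exists_deriv_eq_slope g h hg.continuous.continuousOn hg.differentiableOn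
    refine ⟨deriv g c, (hg' c).1, (hg' c).2, ?_⟩
    rw [hc]
    have := sub_ne_zero.2 h.ne'
    field_simp
    ring
  · exact ⟨deriv g s, (hg' s).1, (hg' s).2, by simp⟩
  · obtain ⟨c, -, hc⟩ := exists_deriv_eq_slope g h hg.continuous.continuousOn hg.differentiableOn
    refine ⟨deriv g c, (hg' c).1, (hg' c).2, ?_⟩
    rw [hc]
    have := sub_ne_zero.2 h.ne'
    field_simp

/-- `g` grows at most linearly, and the constant `|g 0|` is square integrable because `Ω` is
bounded. -/
lemma MemL2.comp_of_deriv_bounds (hΩ : Bornology.IsBounded Ω) {g : ℝ → ℝ} {m L : ℝ} (hm : 0 < m)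
    (hg : Differentiable ℝ g) (hg' : ∀ s, m ≤ deriv g s ∧ deriv g s ≤ L) {p : Vec d → ℝ}
    (hp : MemL2 Ω p) : MemL2 Ω fun x => g (p x) := by
  have : IsFiniteMeasure (volume.restrict Ω) := ⟨by
    rw [Measure.restrict_apply_univ]
    exact hΩ.measure_lt_top⟩
  have hdom : MemLp (fun x => |g 0| + L * |p x|) 2 (volume.restrict Ω) :=
    MemLp.add (f := fun _ => |g 0|) (g := fun x => L * |p x|) (memLp_const _)
      (MemLp.const_mul (f := fun x => |p x|) (MemLp.norm hp) L)
  refine hdom.mono (hg.continuous.comp_aestronglyMeasurable hp.1)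
    (Eventually.of_forall fun x => ?_)
  obtain ⟨β, h1, h2, h3⟩ := exists_sub_eq_mul_sub hg hg' (p x) 0
  have h4 : g (p x) = g 0 + β * p x := by linarith
  rw [h4, Real.norm_eq_abs]
  refine (abs_add_le _ _).trans (le_trans ?_ (le_abs_self _))
  rw [abs_mul, abs_of_pos (hm.trans_le h1)]
  gcongr

lemma l2inner_comm {E : Type*} [NormedAddCommGroup E] [InnerProductSpace ℝ E] (f g : Vec d → E) :
    l2inner Ω f g = l2inner Ω g f := by
  simp only [l2inner, real_inner_comm]

lemma l2inner_eq_integral_mul (f g : Vec d → ℝ) : l2inner Ω f g = ∫ x in Ω, f x * g x := by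
  simp [l2inner, mul_comm]

lemma l2inner_weakDiv_sub (hΩ : IsOpen Ω) {v v' : Vec d → Vec d} (hv : MemHdiv Ω v)
    (hv' : MemHdiv Ω v') {g : Vec d → ℝ} (hg : MemL2 Ω g) :
    l2inner Ω (weakDiv Ω (v - v')) g = l2inner Ω (weakDiv Ω v) g - l2inner Ω (weakDiv Ω v') g := by
  rw [l2inner_congr (hv.weakDiv_sub hΩ hv') ae_eq_rfl,
    l2inner_sub_left hv.hasWeakDiv.1 hv'.hasWeakDiv.1 hg]

/-- The bracket is the tested error equation without flux and strain. The right side minus the left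
side is `(L₁ - β)(P - P')² + (β - b_m) P² + β P'² + (L₂ - η)(U - U')² + (η - h_m) U² + η U'² + 2 α
P' (U - U')`. The last term is the only one without a sign; it completes a square with `b_m P'²` and
`(α² / b_m)(U - U')²`. -/
lemma splitting_pointwise {b_m h_m L₁ L₂ α β η P P' U U' : ℝ} (hb : 0 < b_m) (hβ : b_m ≤ β)
    (hβL : β ≤ L₁) (hh : 0 < h_m) (hη : h_m ≤ η) (hηL : η + α ^ 2 / b_m ≤ L₂) :
    L₁ * (P' * P') + L₂ * (U' * U') ≤ (L₁ - b_m) * (P * P) + (L₂ - h_m) * (U * U) +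
      2 * (β * P * P' + L₁ * ((P' - P) * P') + α * (U * P') + L₂ * ((U' - U) * U') +
        η * U * U' - α * (P' * U')) := by
  have hc : b_m * (α ^ 2 / b_m) = α ^ 2 := mul_div_cancel₀ _ hb.ne'
  set c := α ^ 2 / b_m
  have h1 : 0 ≤ 2 * α * P' * (U - U') + b_m * P' ^ 2 + c * (U - U') ^ 2 := by
    refine (mul_nonneg_iff_of_pos_left hb).1 ?_
    have : b_m * (2 * α * P' * (U - U') + b_m * P' ^ 2 + c * (U - U') ^ 2) =
        (b_m * P' + α * (U - U')) ^ 2 := by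
      linear_combination (U - U') ^ 2 * hc
    rw [this]
    exact sq_nonneg _
  have h2 := mul_nonneg (sub_nonneg.2 hβL) (sq_nonneg (P - P'))
  have h3 := mul_nonneg (sub_nonneg.2 hβ) (sq_nonneg P')
  have h4 := mul_nonneg (sub_nonneg.2 hβ) (sq_nonneg P)
  have h5 := mul_nonneg (sub_nonneg.2 hη) (sq_nonneg U)
  have h6 := mul_nonneg (hh.le.trans hη) (sq_nonneg U')
  have h7 := mul_nonneg (sub_nonneg.2 hηL) (sq_nonneg (U - U'))
  linarith

lemma splitting_integrated {b_m L_b h_m L_h L₁ L₂ α : ℝ} (hb : 0 < b_m) (hh : 0 < h_m)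
    (hL₁ : L_b ≤ L₁) (hL₂ : L_h + α ^ 2 / b_m ≤ L₂) {P P' U U' B H : Vec d → ℝ}
    (hP : MemL2 Ω P) (hP' : MemL2 Ω P') (hU : MemL2 Ω U) (hU' : MemL2 Ω U')
    (hB : MemL2 Ω B) (hH : MemL2 Ω H)
    (hβ : ∀ x, ∃ β, b_m ≤ β ∧ β ≤ L_b ∧ B x = β * P x)
    (hη : ∀ᵐ x ∂volume.restrict Ω, ∃ η, h_m ≤ η ∧ η ≤ L_h ∧ H x = η * U x) :
    L₁ * l2norm Ω P' ^ 2 + L₂ * l2norm Ω U' ^ 2 ≤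
      (L₁ - b_m) * l2norm Ω P ^ 2 + (L₂ - h_m) * l2norm Ω U ^ 2 +
        2 * (l2inner Ω B P' + L₁ * l2inner Ω (P' - P) P' + α * l2inner Ω U P' +
          L₂ * l2inner Ω (U' - U) U' + l2inner Ω H U' - α * l2inner Ω P' U') := by
  simp only [l2norm_sq, l2inner_eq_integral_mul, ← integral_const_mul]
  have i1 := hB.integrable_mul hP'
  have i2 := ((hP'.sub hP).integrable_mul hP').const_mul L₁
  have i3 := (hU.integrable_mul hP').const_mul α
  have i4 := ((hU'.sub hU).integrable_mul hU').const_mul L₂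
  have i5 := hH.integrable_mul hU'
  have i6 := (hP'.integrable_mul hU').const_mul α
  have i7 := (hP'.integrable_mul hP').const_mul L₁
  have i8 := (hU'.integrable_mul hU').const_mul L₂
  have i9 := (hP.integrable_mul hP).const_mul (L₁ - b_m)
  have i10 := (hU.integrable_mul hU).const_mul (L₂ - h_m)
  have i12 := i1.fun_add i2
  have i13 := i12.fun_add i3
  have i14 := i13.fun_add i4
  have i15 := i14.fun_add i5
  have hsub : ∀ {f g : Vec d → ℝ}, Integrable f (volume.restrict Ω) →
      Integrable g (volume.restrict Ω) → Integrable (fun x => f x - g x) (volume.restrict Ω) :=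
    fun hf hg => hf.sub hg
  have i16 := (hsub i15 i6).const_mul 2
  have i90 := i9.fun_add i10
  rw [← integral_add i7 i8, ← integral_add i9 i10, ← integral_add i1 i2, ← integral_add i12 i3,
    ← integral_add i13 i4, ← integral_add i14 i5, ← integral_sub i15 i6, ← integral_const_mul,
    ← integral_add i90 i16]
  refine integral_mono_ae (i7.fun_add i8) (i90.fun_add i16) ?_
  filter_upwards [hη] with x ⟨η, h1, h2, h3⟩
  obtain ⟨β, g1, g2, g3⟩ := hβ x
  simp only [g3, h3, Pi.sub_apply]
  exact splitting_pointwise hb g1 (g2.trans hL₁) hh h1 (by linarith)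

end Nonlinearity

/-! ### Bounds for multiplication by the inverse permeability. -/

section Permeability
variable {d : ℕ} {Ω : Set (Vec d)} {k_m k_M : ℝ} {K : Vec d → ℝ} {q : Vec d → Vec d}

lemma ae_norm_inv_smul_le (hΩ : IsOpen Ω) (hk : 0 < k_m) (hK : ∀ x ∈ Ω, k_m ≤ K x ∧ K x ≤ k_M) :
    ∀ᵐ x ∂volume.restrict Ω, ‖(K x)⁻¹ • q x‖ ≤ k_m⁻¹ * ‖q x‖ := by
  refine ae_restrict_of_forall_mem hΩ.measurableSet fun x hx => ?_
  have h := (hK x hx).1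
  have h0 := hk.trans_le h
  rw [norm_smul, norm_inv, Real.norm_of_nonneg h0.le]
  gcongr

lemma MemL2.inv_smul (hΩ : IsOpen Ω) (hk : 0 < k_m) (hKm : AEMeasurable K (volume.restrict Ω))
    (hK : ∀ x ∈ Ω, k_m ≤ K x ∧ K x ≤ k_M) (hq : MemL2 Ω q) : MemL2 Ω fun x => (K x)⁻¹ • q x :=
  hq.of_le_mul (hKm.inv.aestronglyMeasurable.smul hq.1) (ae_norm_inv_smul_le hΩ hk hK)

lemma l2norm_inv_smul_le (hΩ : IsOpen Ω) (hk : 0 < k_m) (hKm : AEMeasurable K (volume.restrict Ω))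
    (hK : ∀ x ∈ Ω, k_m ≤ K x ∧ K x ≤ k_M) (hq : MemL2 Ω q) :
    l2norm Ω (fun x => (K x)⁻¹ • q x) ≤ k_m⁻¹ * l2norm Ω q := by
  rw [l2norm_eq_norm (hq.inv_smul hΩ hk hKm hK), l2norm_eq_norm hq]
  refine Lp.norm_le_mul_norm_of_ae_le_mul ?_
  filter_upwards [ae_norm_inv_smul_le (q := q) hΩ hk hK,
    (hq.inv_smul hΩ hk hKm hK).coeFn_toLp, hq.coeFn_toLp] with x h1 h2 h3
  rwa [h2, h3]

lemma le_l2inner_inv_smul (hΩ : IsOpen Ω) (hk : 0 < k_m)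
    (hKm : AEMeasurable K (volume.restrict Ω))
    (hK : ∀ x ∈ Ω, k_m ≤ K x ∧ K x ≤ k_M) (hq : MemL2 Ω q) :
    k_M⁻¹ * l2norm Ω q ^ 2 ≤ l2inner Ω (fun x => (K x)⁻¹ • q x) q := by
  rw [l2norm_sq, l2inner, ← integral_const_mul]
  refine setIntegral_mono_on ((hq.integrable_inner hq).const_mul _)
    ((hq.inv_smul hΩ hk hKm hK).integrable_inner hq) hΩ.measurableSet fun x hx => ?_
  have h := hK x hx
  have h0 := hk.trans_le h.1
  rw [real_inner_smul_left]
  exact mul_le_mul_of_nonneg_right (inv_anti₀ h0 h.2) real_inner_self_nonneg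

end Permeability

/-! ### The error estimate for one step of the scheme. -/

section Step
variable {d : ℕ} {Ω : Set (Vec d)} {T : Geometry.SimplicialComplex ℝ (Vec d)}

/-- The assumptions on the coefficients and on the parameters of the scheme. -/
structure Coefficients.Admissible (D : Coefficients d) (Ω : Set (Vec d))
    (b_m L_b h_m L_h k_m k_M L₁ L₂ : ℝ) : Prop where
  μ_pos : 0 < D.μ
  νf_pos : 0 < D.νf
  τ_pos : 0 < D.τ
  b_pos : 0 < b_m
  b_diff : Differentiable ℝ D.b
  b_deriv : ∀ s, b_m ≤ deriv D.b s ∧ deriv D.b s ≤ L_b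
  h_pos : 0 < h_m
  h_diff : Differentiable ℝ D.h
  h_deriv : ∀ s, h_m ≤ deriv D.h s ∧ deriv D.h s ≤ L_h
  km_pos : 0 < k_m
  kM_pos : 0 < k_M
  K_meas : AEMeasurable D.K (volume.restrict Ω)
  K_bounds : ∀ x ∈ Ω, k_m ≤ D.K x ∧ D.K x ≤ k_M
  L₁_ge : L_b ≤ L₁
  L₂_ge : L_h + D.α ^ 2 / b_m ≤ L₂

variable {Z : Set (Vec d → Vec d)} {D : Coefficients d} {b_m L_b h_m L_h k_m k_M L₁ L₂ C : ℝ}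
  {p₀ p pi p' : Vec d → ℝ} {u₀ q u ui q' u' : Vec d → Vec d}

/-- One step of the scheme reduces the energy of the error. -/
theorem IsSplittingStep.energy_le (hΩ : IsOpen Ω) (hbdd : Bornology.IsBounded Ω)
    (hC : 0 < C) (hlift : IsDivLiftingConstant Ω T C)
    (hZ : ∀ z ∈ Z, MemH1 Ω z) (hZsub : ∀ z ∈ Z, ∀ z' ∈ Z, z - z' ∈ Z)
    (A : D.Admissible Ω b_m L_b h_m L_h k_m k_M L₁ L₂)
    (sol : IsDiscreteSolution Ω T Z D p₀ u₀ p q u)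
    (hpi : pi ∈ pressureSpace Ω T) (hui : ui ∈ Z)
    (step : IsSplittingStep Ω T Z D L₁ L₂ p₀ u₀ pi ui p' q' u') :
    errorEnergy Ω L₁ L₂ b_m k_m k_M D.νf D.τ C (p' - p) (q' - q) (u' - u) +
        4 * D.μ * strainInner Ω (u' - u) (u' - u) ≤
      (L₁ - b_m) * l2norm Ω (pi - p) ^ 2 +
        (L₂ - h_m) * l2norm Ω (weakDiv Ω (ui - u)) ^ 2 := by
  have hP' := sub_mem_pressureSpace step.mem_p sol.mem_p
  have hQ' := sub_mem_fluxSpace step.mem_q sol.mem_q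
  have hE' := hZsub _ step.mem_u _ sol.mem_u
  have hu := hZ _ sol.mem_u
  have hu' := hZ _ step.mem_u
  have hui1 := hZ _ hui
  have hP := hpi.1.sub sol.mem_p.1
  have hUm := (hui1.sub hu).memHdiv.hasWeakDiv.1
  have hUm' := (hu'.sub hu).memHdiv.hasWeakDiv.1
  have hB1 := hpi.1.comp_of_deriv_bounds hbdd A.b_pos A.b_diff A.b_deriv
  have hB2 := sol.mem_p.1.comp_of_deriv_bounds hbdd A.b_pos A.b_diff A.b_deriv
  have hH1 := hui1.memHdiv.hasWeakDiv.1.comp_of_deriv_bounds hbdd A.h_pos A.h_diff A.h_deriv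
  have hH2 := hu.memHdiv.hasWeakDiv.1.comp_of_deriv_bounds hbdd A.h_pos A.h_diff A.h_deriv
  have hmain := splitting_integrated A.b_pos A.h_pos A.L₁_ge A.L₂_ge hP hP'.1 hUm hUm'
    (hB1.sub hB2) (hH1.sub hH2) (fun x => exists_sub_eq_mul_sub A.b_diff A.b_deriv (pi x) (p x))
    (by
      filter_upwards [hui1.memHdiv.weakDiv_sub hΩ hu.memHdiv] with x hx
      rw [hx]
      exact exists_sub_eq_mul_sub A.h_diff A.h_deriv _ _)
  have hflow : ∀ v ∈ fluxSpace Ω T, D.νf * l2inner Ω (fun x => (D.K x)⁻¹ • (q' - q) x) v =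
      l2inner Ω (p' - p) (weakDiv Ω v) := by
    intro v hv
    have e : (fun x => (D.K x)⁻¹ • (q' - q) x) =
        (fun x => (D.K x)⁻¹ • q' x) - fun x => (D.K x)⁻¹ • q x := by
      funext x
      simp [smul_sub]
    rw [e, l2inner_sub_left (step.mem_q.1.1.inv_smul hΩ A.km_pos A.K_meas A.K_bounds)
      (sol.mem_q.1.1.inv_smul hΩ A.km_pos A.K_meas A.K_bounds) hv.1.1,
      l2inner_sub_left step.mem_p.1 sol.mem_p.1 hv.1.hasWeakDiv.1]
    linear_combination step.flow v hv - sol.flow v hv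
  have hmass : l2inner Ω ((fun x => D.b (pi x)) - fun x => D.b (p x)) (p' - p) +
      L₁ * l2inner Ω ((p' - p) - (pi - p)) (p' - p) +
      D.α * l2inner Ω (weakDiv Ω (ui - u)) (p' - p) +
      D.τ * l2inner Ω (weakDiv Ω (q' - q)) (p' - p) = 0 := by
    rw [sub_sub_sub_cancel_right, l2inner_sub_left hB1 hB2 hP'.1,
      l2inner_weakDiv_sub hΩ hui1.memHdiv hu.memHdiv hP'.1,
      l2inner_weakDiv_sub hΩ step.mem_q.1 sol.mem_q.1 hP'.1]
    linear_combination step.mass _ hP' - sol.mass _ hP'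
  have hdisp : 2 * D.μ * strainInner Ω (u' - u) (u' - u) +
      L₂ * l2inner Ω (weakDiv Ω (u' - u) - weakDiv Ω (ui - u)) (weakDiv Ω (u' - u)) +
      l2inner Ω ((fun x => D.h (weakDiv Ω ui x)) - fun x => D.h (weakDiv Ω u x))
        (weakDiv Ω (u' - u)) - D.α * l2inner Ω (p' - p) (weakDiv Ω (u' - u)) = 0 := by
    rw [strainInner_sub_left hΩ hu' hu (hZ _ hE'), l2inner_sub_left hH1 hH2 hUm',
      l2inner_sub_left hUm' hUm hUm', l2inner_sub_left step.mem_p.1 sol.mem_p.1 hUm',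
      l2inner_weakDiv_sub hΩ hu'.memHdiv hu.memHdiv hUm',
      l2inner_weakDiv_sub hΩ hui1.memHdiv hu.memHdiv hUm']
    have h := step.displacement _ hE'
    rw [l2inner_sub_left hu'.memHdiv.hasWeakDiv.1 hui1.memHdiv.hasWeakDiv.1 hUm'] at h
    linear_combination h - sol.displacement _ hE'
  have hQ1 := hflow _ hQ'
  have hQ2 := le_l2inner_inv_smul hΩ A.km_pos A.K_meas A.K_bounds hQ'.1.1
  -- An inf-sup argument: the lift of the pressure error is the test function in the flow equation,
  -- so that the flux error bounds the pressure error.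
  have hPQ : l2norm Ω (p' - p) ≤ D.νf * C / k_m * l2norm Ω (q' - q) := by
    obtain ⟨v, hv, hdiv, hvn⟩ := hlift _ hP'
    have h1 : l2norm Ω (p' - p) ^ 2 = D.νf * l2inner Ω (fun x => (D.K x)⁻¹ • (q' - q) x) v := by
      rw [hflow v hv, l2norm_sq, l2inner_congr ae_eq_rfl hdiv]
    have h2 := l2inner_le (hQ'.1.1.inv_smul hΩ A.km_pos A.K_meas A.K_bounds) hv.1.1
    have h3 := l2norm_inv_smul_le hΩ A.km_pos A.K_meas A.K_bounds hQ'.1.1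
    have h4 : l2norm Ω (p' - p) ^ 2 ≤
        D.νf * (k_m⁻¹ * l2norm Ω (q' - q) * (C * l2norm Ω (p' - p))) := by
      rw [h1]
      refine mul_le_mul_of_nonneg_left (h2.trans ?_) A.νf_pos.le
      exact mul_le_mul h3 hvn (l2norm_nonneg _)
        (mul_nonneg (inv_nonneg.2 A.km_pos.le) (l2norm_nonneg _))
    rcases (l2norm_nonneg (Ω := Ω) (p' - p)).eq_or_lt with h0 | h0
    · rw [← h0]
      have := l2norm_nonneg (Ω := Ω) (q' - q)
      have := A.νf_pos
      have := A.km_pos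
      positivity
    · refine le_of_mul_le_mul_right ?_ h0
      calc _ = l2norm Ω (p' - p) ^ 2 := (pow_two _).symm
        _ ≤ _ := h4
        _ = _ := by ring
  have hPQ2 : D.τ * k_m ^ 2 / (D.νf * C ^ 2 * k_M) * l2norm Ω (p' - p) ^ 2 ≤
      D.τ * D.νf / k_M * l2norm Ω (q' - q) ^ 2 := by
    have hν := A.νf_pos
    have hkm := A.km_pos
    have hkM := A.kM_pos
    have hτ := A.τ_pos
    calc _ ≤ D.τ * k_m ^ 2 / (D.νf * C ^ 2 * k_M) * (D.νf * C / k_m * l2norm Ω (q' - q)) ^ 2 := by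
          have := l2norm_nonneg (Ω := Ω) (p' - p)
          gcongr
      _ = _ := by field_simp
  have hdivQ := l2inner_comm (Ω := Ω) (p' - p) (weakDiv Ω (q' - q))
  have hτQ := mul_le_mul_of_nonneg_left hQ2 (mul_pos A.τ_pos A.νf_pos).le
  have hbP := mul_nonneg A.b_pos.le (sq_nonneg (l2norm Ω (p' - p)))
  have hτQ' : D.τ * D.νf / k_M * l2norm Ω (q' - q) ^ 2 ≤
      D.τ * l2inner Ω (weakDiv Ω (q' - q)) (p' - p) := by
    rw [← hdivQ, ← hQ1]
    calc _ = _ := by rw [div_eq_mul_inv]; ring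
      _ ≤ _ := hτQ
      _ = _ := by ring
  -- Twice `hτQ'` bounds two copies of the weighted flux error: one stays in the energy, the other
  -- pays for the pressure term by `hPQ2`. As `hmain` provides the full weight `L₁`, the reduction
  -- by `b_m / 2` is slack.
  rw [errorEnergy]
  linarith

end Step

/-! ### Rates of contraction. -/

section Rate

/-- The entry `1 / 2` only keeps the rate positive, since both quotients may be zero. -/
lemma exists_common_rate {A₁ B₁ A₂ B₂ : ℝ} (h₁ : A₁ < B₁) (hB₁ : 0 < B₁) (h₂ : A₂ < B₂)
    (hB₂ : 0 < B₂) : ∃ r : ℝ, 0 < r ∧ r < 1 ∧ A₁ ≤ r * B₁ ∧ A₂ ≤ r * B₂ := by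
  refine ⟨max (1 / 2) (max (A₁ / B₁) (A₂ / B₂)), lt_max_of_lt_left (by norm_num),
    max_lt (by norm_num) (max_lt ((div_lt_one hB₁).2 h₁) ((div_lt_one hB₂).2 h₂)), ?_, ?_⟩
  · exact (div_le_iff₀ hB₁).1 ((le_max_left _ _).trans (le_max_right _ _))
  · exact (div_le_iff₀ hB₂).1 ((le_max_right _ _).trans (le_max_right _ _))

lemma le_sqrt_mul_sqrt_pow {w m M r : ℝ} {i : ℕ} (hm : 0 < m) (hr : 0 ≤ r) (hM : 0 ≤ M)
    (h : m * w ^ 2 ≤ r ^ i * M) : w ≤ √(M / m) * √r ^ i := by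
  have h1 : (√(M / m) * √r ^ i) ^ 2 = r ^ i * M / m := by
    rw [mul_pow, Real.sq_sqrt (div_nonneg hM hm.le), ← pow_mul, mul_comm i 2, pow_mul,
      Real.sq_sqrt hr]
    ring
  refine le_of_sq_le_sq ?_ (by positivity)
  rw [h1, le_div_iff₀ hm]
  linarith

end Rate

section Empty
variable {d : ℕ}

lemma l2norm_empty {E : Type*} [NormedAddCommGroup E] [InnerProductSpace ℝ E] (f : Vec d → E) :
    l2norm ∅ f = 0 := by
  simp [l2norm, l2inner]

lemma h1norm_empty (z : Vec d → Vec d) : h1norm ∅ z = 0 := by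
  simp [h1norm, l2norm_empty]

end Empty

/-! ### From the estimate of one step to linear convergence. -/

section Convergence
variable {d : ℕ} {Ω : Set (Vec d)} {T : Geometry.SimplicialComplex ℝ (Vec d)}
  {Z : Set (Vec d → Vec d)} {D : Coefficients d} {b_m L_b h_m L_h k_m k_M L₁ L₂ C : ℝ}
  {p₀ p : Vec d → ℝ} {u₀ q u : Vec d → Vec d}

/-- Linear convergence, given the decay of the energy in each step. -/
theorem exists_linear_convergence (hd : 1 ≤ d) (hΩ : IsOpen Ω) (hbdd : Bornology.IsBounded Ω)
    (hC : 0 < C) (A : D.Admissible Ω b_m L_b h_m L_h k_m k_M L₁ L₂)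
    {ep : ℕ → Vec d → ℝ} {eq eu : ℕ → Vec d → Vec d}
    (hstep : ∀ i, errorEnergy Ω L₁ L₂ b_m k_m k_M D.νf D.τ C (ep (i + 1)) (eq (i + 1))
        (eu (i + 1)) + 4 * D.μ * strainInner Ω (eu (i + 1)) (eu (i + 1)) ≤
      (L₁ - b_m) * l2norm Ω (ep i) ^ 2 + (L₂ - h_m) * l2norm Ω (weakDiv Ω (eu i)) ^ 2) :
    ∃ ρ : ℝ, 0 < ρ ∧ ρ < 1 ∧
      (∀ i, errorEnergy Ω L₁ L₂ b_m k_m k_M D.νf D.τ C (ep (i + 1)) (eq (i + 1)) (eu (i + 1)) ≤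
        ρ * errorEnergy Ω L₁ L₂ b_m k_m k_M D.νf D.τ C (ep i) (eq i) (eu i)) ∧
      ∃ M : ℝ, ∀ i, l2norm Ω (ep i) + l2norm Ω (eq i) + l2norm Ω (weakDiv Ω (eu i)) ≤ M * ρ ^ i ∧
        ((∀ i, MemH10 Ω (eu i)) → h1norm Ω (eu i) ≤ M * ρ ^ i) := by
  obtain ⟨R, hR⟩ := hbdd.exists_norm_le
  have hμ := A.μ_pos
  have hν := A.νf_pos
  have hτ := A.τ_pos
  have hb := A.b_pos
  have hh := A.h_pos
  have hkm := A.km_pos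
  have hkM := A.kM_pos
  have hbL : b_m ≤ L₁ := ((A.b_deriv 0).1.trans (A.b_deriv 0).2).trans A.L₁_ge
  have hhL : h_m ≤ L₂ := by
    have h1 := (A.h_deriv 0).1.trans (A.h_deriv 0).2
    have h2 : 0 ≤ D.α ^ 2 / b_m := by positivity
    linarith [A.L₂_ge]
  have hL₂ : 0 < L₂ := hh.trans_le hhL
  -- The strict gaps are `b_m / 2` for the pressure and `h_m` for the displacement; the permeability
  -- term in the energy is not needed for contraction.
  obtain ⟨r, hr0, hr1, hrp, hru⟩ := exists_common_rate (A₁ := L₁ - b_m) (B₁ := L₁ - b_m / 2)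
    (A₂ := L₂ - h_m) (B₂ := L₂) (by linarith) (by linarith) (by linarith) hL₂
  set E : ℕ → ℝ := fun i => errorEnergy Ω L₁ L₂ b_m k_m k_M D.νf D.τ C (ep i) (eq i) (eu i) with hE
  have hct : 0 < D.τ * k_m ^ 2 / (D.νf * C ^ 2 * k_M) := by positivity
  have hcp : 0 < L₁ - b_m / 2 + D.τ * k_m ^ 2 / (D.νf * C ^ 2 * k_M) := by linarith
  have hcq : 0 < D.τ * D.νf / k_M := by positivity
  have hEdef : ∀ i, E i = (L₁ - b_m / 2 + D.τ * k_m ^ 2 / (D.νf * C ^ 2 * k_M)) *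
      l2norm Ω (ep i) ^ 2 + D.τ * D.νf / k_M * l2norm Ω (eq i) ^ 2 +
        L₂ * l2norm Ω (weakDiv Ω (eu i)) ^ 2 := fun i => rfl
  have hpt : ∀ i, 0 ≤ (L₁ - b_m / 2 + D.τ * k_m ^ 2 / (D.νf * C ^ 2 * k_M)) *
      l2norm Ω (ep i) ^ 2 := fun i => mul_nonneg hcp.le (sq_nonneg _)
  have hqt : ∀ i, 0 ≤ D.τ * D.νf / k_M * l2norm Ω (eq i) ^ 2 :=
    fun i => mul_nonneg hcq.le (sq_nonneg _)
  have hut : ∀ i, 0 ≤ L₂ * l2norm Ω (weakDiv Ω (eu i)) ^ 2 :=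
    fun i => mul_nonneg hL₂.le (sq_nonneg _)
  have hE0 : ∀ i, 0 ≤ E i := fun i => by linarith [hEdef i, hpt i, hqt i, hut i]
  have hrate : ∀ i, E (i + 1) + 4 * D.μ * strainInner Ω (eu (i + 1)) (eu (i + 1)) ≤ r * E i := by
    intro i
    refine (hstep i).trans ?_
    have h1 := mul_le_mul_of_nonneg_right hrp (sq_nonneg (l2norm Ω (ep i)))
    have h2 := mul_le_mul_of_nonneg_right hru (sq_nonneg (l2norm Ω (weakDiv Ω (eu i))))
    have h3 := mul_nonneg hr0.le (hqt i)
    have h4 := mul_nonneg hr0.le (mul_nonneg hct.le (sq_nonneg (l2norm Ω (ep i))))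
    rw [hEdef]
    linarith
  have hs : ∀ i, 0 ≤ 4 * D.μ * strainInner Ω (eu i) (eu i) :=
    fun i => mul_nonneg (by positivity) (strainInner_self_nonneg _)
  have hE1 : ∀ i, E (i + 1) ≤ r * E i := fun i => by linarith [hrate i, hs (i + 1)]
  have hEi : ∀ i, E i ≤ r ^ i * E 0 := by
    intro i
    induction i with
    | zero => simp
    | succ i ih =>
      rw [pow_succ', mul_assoc]
      exact (hE1 i).trans (mul_le_mul_of_nonneg_left ih hr0.le)
  -- The energy contracts by `r`, but norms are square roots of energies and decay like `√r ^ i`.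
  -- The larger number `√r` serves for both.
  have hρ : r ≤ √r := Real.le_sqrt_of_sq_le (by nlinarith)
  set N := (4 * R ^ 2 + 1) * 2 with hN
  have hN0 : 0 < N := by positivity
  -- The strain is controlled only from the first computed iterate on, so the initial `H¹` norm is
  -- added to cover `i = 0`.
  set H := N * E 0 + 4 * D.μ * h1norm Ω (eu 0) ^ 2 with hH
  have hH0 : 0 ≤ H := add_nonneg (mul_nonneg hN0.le (hE0 0)) (by positivity)
  refine ⟨√r, Real.sqrt_pos.2 hr0, (Real.sqrt_lt' one_pos).2 (by simpa using hr1), fun i =>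
    (hE1 i).trans (mul_le_mul_of_nonneg_right hρ (hE0 i)),
    √(E 0 / (L₁ - b_m / 2 + D.τ * k_m ^ 2 / (D.νf * C ^ 2 * k_M))) +
      √(E 0 / (D.τ * D.νf / k_M)) + √(E 0 / L₂) + √(H / (4 * D.μ)), fun i => ⟨?_, fun hz => ?_⟩⟩
  · have h1 := le_sqrt_mul_sqrt_pow hcp hr0.le (hE0 0) (w := l2norm Ω (ep i)) (i := i)
      (by linarith [hEdef i, hEi i, hqt i, hut i])
    have h2 := le_sqrt_mul_sqrt_pow hcq hr0.le (hE0 0) (w := l2norm Ω (eq i)) (i := i)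
      (by linarith [hEdef i, hEi i, hpt i, hut i])
    have h3 := le_sqrt_mul_sqrt_pow hL₂ hr0.le (hE0 0) (w := l2norm Ω (weakDiv Ω (eu i))) (i := i)
      (by linarith [hEdef i, hEi i, hpt i, hqt i])
    have h4 : 0 ≤ √(H / (4 * D.μ)) * √r ^ i := by positivity
    linarith
  · have key : 4 * D.μ * h1norm Ω (eu i) ^ 2 ≤ r ^ i * H := by
      rcases i with _ | i
      · simpa [hH] using mul_nonneg hN0.le (hE0 0)
      · have h1 := (hz (i + 1)).h1norm_sq_le hd hΩ hR
        have h2 : 4 * D.μ * strainInner Ω (eu (i + 1)) (eu (i + 1)) ≤ r ^ (i + 1) * E 0 := by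
          have h3 := mul_le_mul_of_nonneg_left (hEi i) hr0.le
          rw [← mul_assoc, ← pow_succ'] at h3
          linarith [hrate i, hE0 (i + 1)]
        calc _ ≤ 4 * D.μ * ((4 * R ^ 2 + 1) * (2 * strainInner Ω (eu (i + 1)) (eu (i + 1)))) := by
              gcongr
          _ = N * (4 * D.μ * strainInner Ω (eu (i + 1)) (eu (i + 1))) := by rw [hN]; ring
          _ ≤ N * (r ^ (i + 1) * E 0) := mul_le_mul_of_nonneg_left h2 hN0.le
          _ = r ^ (i + 1) * (N * E 0) := by ring
          _ ≤ _ := by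
            refine mul_le_mul_of_nonneg_left ?_ (by positivity)
            rw [hH]
            exact le_add_of_nonneg_right (by positivity)
    refine (le_sqrt_mul_sqrt_pow (by positivity) hr0.le hH0 key).trans ?_
    refine mul_le_mul_of_nonneg_right (le_add_of_nonneg_left ?_) (by positivity)
    positivity

end Convergence

end Biot

end

/-! ### The theorem. -/

theorem mainTheorem1 (d : ℕ) (hd₁ : 1 ≤ d) (hd₃ : d ≤ 3)
    (Ω : Set (Biot.Vec d)) (hΩ_open : IsOpen Ω) (hΩ_bdd : Bornology.IsBounded Ω)
    (hΩ_reg : interior (closure Ω) = Ω) (σ : ℝ) :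
    ∃ C : ℝ, 0 < C ∧
      ∀ T : Geometry.SimplicialComplex ℝ (Biot.Vec d),
        Biot.IsMesh Ω T → Biot.IsShapeRegular σ T →
        Biot.IsDivLiftingConstant Ω T C ∧
        ∀ (Z : Set (Biot.Vec d → Biot.Vec d)),
          (Z = Biot.linearSpace Ω T ∨ Z = Biot.linearSpaceZero Ω T) →
        ∀ (D : Biot.Coefficients d) (b_m L_b h_m L_h k_m k_M L₁ L₂ : ℝ),
          0 < D.μ → 0 < D.νf → 0 < D.ρf → 0 < D.τ →
          MeasureTheory.MemLp D.f 2 (MeasureTheory.volume.restrict Ω) →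
          MeasureTheory.MemLp D.Sf 2 (MeasureTheory.volume.restrict Ω) →
          -- assumption on `b`
          0 < b_m → ContDiff ℝ 1 D.b → (∀ s, b_m ≤ deriv D.b s ∧ deriv D.b s ≤ L_b) →
          -- assumption on `h`
          0 < h_m → ContDiff ℝ 1 D.h → (∀ s, h_m ≤ deriv D.h s ∧ deriv D.h s ≤ L_h) →
          -- assumption on the permeability
          0 < k_m → AEMeasurable D.K (MeasureTheory.volume.restrict Ω) →
          (∀ x ∈ Ω, k_m ≤ D.K x ∧ D.K x ≤ k_M) →
          -- the parameters of the scheme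
          L_b ≤ L₁ → L_h + D.α ^ 2 / b_m ≤ L₂ →
        -- the previous time level, the discrete solution and the iterates
        ∀ (p₀ : Biot.Vec d → ℝ) (u₀ : Biot.Vec d → Biot.Vec d)
          (p : Biot.Vec d → ℝ) (q u : Biot.Vec d → Biot.Vec d)
          (pit : ℕ → Biot.Vec d → ℝ) (qit uit : ℕ → Biot.Vec d → Biot.Vec d),
          p₀ ∈ Biot.pressureSpace Ω T → u₀ ∈ Z →
          Biot.IsDiscreteSolution Ω T Z D p₀ u₀ p q u →
          pit 0 ∈ Biot.pressureSpace Ω T → qit 0 ∈ Biot.fluxSpace Ω T → uit 0 ∈ Z →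
          (∀ i, Biot.IsSplittingStep Ω T Z D L₁ L₂ p₀ u₀ (pit i) (uit i)
            (pit (i + 1)) (qit (i + 1)) (uit (i + 1))) →
          (∀ i, Biot.errorEnergy Ω L₁ L₂ b_m k_m k_M D.νf D.τ C
              (pit (i + 1) - p) (qit (i + 1) - q) (uit (i + 1) - u)
            ≤ (L₁ - b_m) * Biot.l2norm Ω (pit i - p) ^ 2
              + (L₂ - h_m) * Biot.l2norm Ω (Biot.weakDiv Ω (uit i - u)) ^ 2) ∧
          ∃ ρ : ℝ, 0 < ρ ∧ ρ < 1 ∧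
            (∀ i, Biot.errorEnergy Ω L₁ L₂ b_m k_m k_M D.νf D.τ C
                (pit (i + 1) - p) (qit (i + 1) - q) (uit (i + 1) - u)
              ≤ ρ * Biot.errorEnergy Ω L₁ L₂ b_m k_m k_M D.νf D.τ C
                (pit i - p) (qit i - q) (uit i - u)) ∧
            ∃ A : ℝ, ∀ i,
              Biot.l2norm Ω (pit i - p) + Biot.l2norm Ω (qit i - q)
                + Biot.l2norm Ω (Biot.weakDiv Ω (uit i - u)) ≤ A * ρ ^ i ∧
              (Z = Biot.linearSpaceZero Ω T →
                Biot.h1norm Ω (uit i - u) ≤ A * ρ ^ i) := by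
  obtain ⟨C, hC, hlift⟩ := Biot.exists_divLiftingConstant hd₁ hΩ_open hΩ_bdd hΩ_reg σ
  refine ⟨C, hC, fun T hT hσ => ⟨hlift T hT hσ, ?_⟩⟩
  intro Z hZ D b_m L_b h_m L_h k_m k_M L₁ L₂ hμ hν _ hτ _ _ hb hb1 hb2 hh hh1 hh2 hk hKm hK hL₁
    hL₂ p₀ u₀ p q u pit qit uit _ _ sol hp0 hq0 hu0 step
  -- On the empty set the bounds on the permeability are vacuous and do not give `0 < k_M`, but all
  -- norms vanish there.
  rcases Ω.eq_empty_or_nonempty with rfl | ⟨x₀, hx₀⟩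
  · refine ⟨fun i => ?_, 1 / 2, by norm_num, by norm_num, fun i => ?_, 0, fun i => ⟨?_, fun _ => ?_⟩⟩
    all_goals simp [Biot.errorEnergy, Biot.l2norm_empty, Biot.h1norm_empty]
  have A : D.Admissible Ω b_m L_b h_m L_h k_m k_M L₁ L₂ :=
    { μ_pos := hμ, νf_pos := hν, τ_pos := hτ, b_pos := hb
      b_diff := hb1.differentiable one_ne_zero, b_deriv := hb2, h_pos := hh
      h_diff := hh1.differentiable one_ne_zero, h_deriv := hh2, km_pos := hk
      kM_pos := hk.trans_le ((hK x₀ hx₀).1.trans (hK x₀ hx₀).2)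
      K_meas := hKm, K_bounds := hK, L₁_ge := hL₁, L₂_ge := hL₂ }
  have hZ1 : ∀ z ∈ Z, Biot.MemH1 Ω z := by
    rcases hZ with rfl | rfl
    · exact fun z hz => hz.1
    · exact fun z hz => hz.1.1
  have hZsub : ∀ z ∈ Z, ∀ z' ∈ Z, z - z' ∈ Z := by
    rcases hZ with rfl | rfl
    · exact fun z hz z' hz' => Biot.sub_mem_linearSpace hz hz'
    · exact fun z hz z' hz' => Biot.sub_mem_linearSpaceZero hΩ_open hz hz'
  have hpi : ∀ i, pit i ∈ Biot.pressureSpace Ω T := by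
    rintro (_ | i)
    · exact hp0
    · exact (step i).mem_p
  have hui : ∀ i, uit i ∈ Z := by
    rintro (_ | i)
    · exact hu0
    · exact (step i).mem_u
  have hstep := fun i => (step i).energy_le hΩ_open hΩ_bdd hC (hlift T hT hσ) hZ1 hZsub A sol
    (hpi i) (hui i)
  refine ⟨fun i => ?_, ?_⟩
  · have := mul_nonneg hμ.le
      (Biot.strainInner_self_nonneg (Ω := Ω) (uit (i + 1) - u))
    linarith [hstep i]
  · obtain ⟨ρ, h0, h1, hE, M, hM⟩ := Biot.exists_linear_convergence hd₁ hΩ_open hΩ_bdd hC A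
      (ep := fun i => pit i - p) (eq := fun i => qit i - q) (eu := fun i => uit i - u) hstep
    refine ⟨ρ, h0, h1, hE, M, fun i => ⟨(hM i).1, ?_⟩⟩
    rintro rfl
    exact (hM i).2 fun j => (hZsub _ (hui j) _ sol.mem_u).2
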